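/- Setting. Let $n\ge 1$ and let $\mathbb{R}_n$ be the real Clifford algebra with units $e_1,\dots,e_n$, $e_i^2=-1$, $e_ie_j=-e_je_i$ $(i\neq j)$, basis $e_A$ and $|s|^2=\sum_A s_A^2$; let $\overline{e_A}=(-1)^{|A|(|A|+1)/2}e_A$, let $\mathbb{R}^{n+1}\subseteq\mathbb{R}_n$ be the paravectors $s=s_0+s_1e_1+\dots+s_ne_n$, and $\mathbb{S}=\{J\in\mathbb{R}^{n+1}: J_0=0,\ |J|=1\}$. Let $V=\{\sum_A v_A\otimes e_A\}$ be the two-sided Clifford module over a real Banach space $V_{\mathbb{R}}$, with $\|v\|^2=\sum_A\|v_A\|^2$, and let $\mathcal{B}(V)$ be the bounded right-linear operators on $V$. For an operator $A$ and $a\in\mathbb{R}_n$ let $(Aa)(v)=A(av)$; a Clifford number itself acts as an operator by left multiplication. For $\theta\in(0,\frac{\pi}{2})$ let $I_\theta=(-\theta,\theta)\cup(\pi-\theta,\pi+\theta)$ and $D_\theta=\{re^{J\phi}: r>0,\ J\in\mathbb{S},\ \phi\in I_\theta\}$. A function $f:D_\theta\to\mathbb{R}_n$ is in $\mathcal{SH}_L(D_\theta)$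 if $f(x+Jy)=F_0(x,y)+JF_1(x,y)$ for all $J\in\mathbb{S}$ and all $(x,y)$ with $x+\mathbb{S}y\subseteq D_\theta$, where $F_0,F_1$ are $\mathbb{R}_n$-valued $C^1$ functions, $F_0$ is even and $F_1$ is odd in $y$, and $\partial_xF_0=\partial_yF_1$, $\partial_yF_0=-\partial_xF_1$; it is in $\mathcal{N}(D_\theta)$ (intrinsic) if $F_0,F_1$ are moreover real valued. $\mathcal{SH}_L^0(D_\theta)$ (resp. $\mathcal{N}^0(D_\theta)$) is the set of bounded $f\in\mathcal{SH}_L(D_\theta)$ (resp. $\mathcal{N}(D_\theta)$) with $\int_0^\infty|f(te^{J\phi})|\frac{dt}{t}<\infty$ for all $J\in\mathbb{S}$, $\phi\in I_\theta$. $\mathcal{SH}_L^{\rm bnd}(D_\theta)$ is the set of all functions $$f(s)=f_\infty+\tfrac{1}{1+s^2}(f_0-f_\infty)+\widetilde f(s),\qquad f_0,f_\infty\in\mathbb{R}_n,\ \widetilde f\in\mathcal{SH}_L^0(D_\theta),$$ (the coefficients $f_0,f_\infty,\widetilde f$ are unique), and $\mathcal{N}^{\rm bnd}(D_\theta)$ is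 the set of all such functions with $f_0,f_\infty\in\mathbb{R}$ and $\widetilde f\in\mathcal{N}^0(D_\theta)$. Let $T$ be a closed right-linear operator in $V$ whose domain is a two-sided submodule. Let $Q_s[T]=T^2-2s_0T+|s|^2$ on $\operatorname{dom}(T^2)$, $\rho_S(T)=\{s\in\mathbb{R}^{n+1}: Q_s[T]^{-1}\in\mathcal{B}(V)\}$, $\sigma_S(T)=\mathbb{R}^{n+1}\setminus\rho_S(T)$, and $S_L^{-1}(s,T)=Q_s[T]^{-1}\overline s-TQ_s[T]^{-1}$ for $s\in\rho_S(T)$. $T$ is bisectorial of angle $\omega\in(0,\frac{\pi}{2})$ if $\sigma_S(T)\subseteq\overline{D_\omega}$ and for every $\varphi\in(\omega,\frac{\pi}{2})$ there is $C_\varphi\ge 0$ with $\|S_L^{-1}(s,T)\|\le C_\varphi/|s|$ for all $s\in\mathbb{R}^{n+1}\setminus(D_\varphi\cup\{0\})$. For such $T$ and $\theta\in(\omega,\frac{\pi}{2})$, the extended $\omega$-functional calculus of $f\in\mathcal{SH}_L^{\rm bnd}(D_\theta)$ is $$f(T)=f_\infty+(1+T^2)^{-1}(f_0-f_\infty)+\widetilde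 f(T),\qquad \widetilde f(T)=\frac{1}{2\pi}\int_{\partial D_\varphi\cap\mathbb{C}_J}S_L^{-1}(s,T)\,ds_J\,\widetilde f(s),$$ with arbitrary $J\in\mathbb{S}$, $\varphi\in(\omega,\theta)$. Here $\mathbb{C}_J=\{x+Jy:x,y\in\mathbb{R}\}$, $ds_J=ds/J$, and the positively oriented boundary consists of the two curves $\gamma_\pm(t)=\pm|t|e^{-\operatorname{sgn}(t)J\varphi}$, $t\in\mathbb{R}$. Theorem. Let $T$ be bisectorial of angle $\omega\in(0,\frac{\pi}{2})$, let $\theta\in(\omega,\frac{\pi}{2})$, $g\in\mathcal{N}^{\rm bnd}(D_\theta)$ and $f\in\mathcal{SH}_L^{\rm bnd}(D_\theta)$. Then $gf\in\mathcal{SH}_L^{\rm bnd}(D_\theta)$ and $$(gf)(T)=g(T)f(T),$$ where each of the three operators $(gf)(T)$, $g(T)$, $f(T)$ may be computed with its own choice of $J\in\mathbb{S}$ and $\varphi\in(\omega,\theta)$. -/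

import Mathlib

open MeasureTheory Set

noncomputable section

namespace BisectorialCalculus

/-! ### The Clifford algebra `ℝ_n` and Clifford modules -/

/-- The Clifford module `V = { ∑_A v_A ⊗ e_A : v_A ∈ E }` over a real normed space `E`. The index
`A = (i₁ < ⋯ < i_r)` is the finite set `{i₁, …, i_r}`, and `‖v‖² = ∑_A ‖v_A‖²`. -/
abbrev CliffMod (n : ℕ) (E : Type*) : Type _ := PiLp 2 (fun _ : Finset (Fin n) => E)

/-- The underlying real vector space of the Clifford algebra `ℝ_n`, with `|s|² = ∑_A s_A²`. -/
abbrev Cliff (n : ℕ) : Type := CliffMod n ℝ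

/-- The sign in `e_A e_B = sgn A B • e_{A ∆ B}`: every pair `a ∈ A`, `b ∈ B` with `b < a` costs one
transposition of anticommuting units, every common index costs a factor `e_i² = -1`. -/
def sgn {n : ℕ} (A B : Finset (Fin n)) : ℝ := ∏ a ∈ A, ∏ b ∈ B, if b ≤ a then (-1 : ℝ) else 1

/-- Left multiplication `v ↦ s v`, as a bounded real-linear operator: the bilinear extension of
`e_B (v ⊗ e_A) = v ⊗ (e_B e_A)`. -/
def lmul {n : ℕ} {E : Type*} [NormedAddCommGroup E] [NormedSpace ℝ E] (s : Cliff n) :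
    CliffMod n E →L[ℝ] CliffMod n E :=
  (PiLp.continuousLinearEquiv 2 ℝ (fun _ : Finset (Fin n) => E)).symm.toContinuousLinearMap ∘L
    ContinuousLinearMap.pi (fun C => ∑ B, (sgn B (symmDiff B C) * s B) •
      PiLp.proj (𝕜 := ℝ) 2 (fun _ : Finset (Fin n) => E) (symmDiff B C))

/-- Right multiplication `v ↦ v s`, as a bounded real-linear operator: the bilinear extension of
`(v ⊗ e_A) e_B = v ⊗ (e_A e_B)`. -/
def rmul {n : ℕ} {E : Type*} [NormedAddCommGroup E] [NormedSpace ℝ E] (s : Cliff n) :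
    CliffMod n E →L[ℝ] CliffMod n E :=
  (PiLp.continuousLinearEquiv 2 ℝ (fun _ : Finset (Fin n) => E)).symm.toContinuousLinearMap ∘L
    ContinuousLinearMap.pi (fun C => ∑ B, (sgn (symmDiff B C) B * s B) •
      PiLp.proj (𝕜 := ℝ) 2 (fun _ : Finset (Fin n) => E) (symmDiff B C))

section Algebra

variable {n : ℕ} {E : Type*} [NormedAddCommGroup E] [NormedSpace ℝ E]

theorem lmul_apply (s : Cliff n) (v : CliffMod n E) (C : Finset (Fin n)) :
    lmul s v C = ∑ B, (sgn B (symmDiff B C) * s B) • v (symmDiff B C) := by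
  simp [lmul]

theorem rmul_apply (s : Cliff n) (v : CliffMod n E) (C : Finset (Fin n)) :
    rmul s v C = ∑ B, (sgn (symmDiff B C) B * s B) • v (symmDiff B C) := by
  simp [rmul]

theorem prod_symmDiff_of_sq {ι : Type*} [DecidableEq ι] (f : ι → ℝ) (hf : ∀ i, f i * f i = 1)
    (A B : Finset ι) : ∏ i ∈ symmDiff A B, f i = (∏ i ∈ A, f i) * ∏ i ∈ B, f i := by
  have h1 : ∏ i ∈ symmDiff A B, f i = (∏ i ∈ A \ B, f i) * ∏ i ∈ B \ A, f i := by
    rw [symmDiff_def, Finset.sup_eq_union, Finset.prod_union]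
    exact disjoint_sdiff_sdiff
  have h2 : (∏ i ∈ A \ B, f i) * ∏ i ∈ A ∩ B, f i = ∏ i ∈ A, f i := by
    rw [← Finset.prod_union (Finset.disjoint_sdiff_inter A B), Finset.sdiff_union_inter]
  have h3 : (∏ i ∈ B \ A, f i) * ∏ i ∈ A ∩ B, f i = ∏ i ∈ B, f i := by
    rw [Finset.inter_comm,
      ← Finset.prod_union (Finset.disjoint_sdiff_inter B A), Finset.sdiff_union_inter]
  have h4 : (∏ i ∈ A ∩ B, f i) * ∏ i ∈ A ∩ B, f i = 1 := by
    rw [← Finset.prod_mul_distrib]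
    exact Finset.prod_eq_one fun i _ => hf i
  rw [h1, ← h2, ← h3]
  linear_combination (-(∏ i ∈ A \ B, f i) * ∏ i ∈ B \ A, f i) * h4

theorem sgn_mul_self (A B : Finset (Fin n)) : sgn A B * sgn A B = 1 := by
  unfold sgn
  rw [← Finset.prod_mul_distrib]
  refine Finset.prod_eq_one fun a _ => ?_
  rw [← Finset.prod_mul_distrib]
  refine Finset.prod_eq_one fun b _ => ?_
  split_ifs <;> norm_num

theorem sgn_symmDiff_left (A B C : Finset (Fin n)) :
    sgn (symmDiff A B) C = sgn A C * sgn B C := by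
  unfold sgn
  refine prod_symmDiff_of_sq _ (fun a => ?_) A B
  rw [← Finset.prod_mul_distrib]
  refine Finset.prod_eq_one fun b _ => ?_
  split_ifs <;> norm_num

theorem sgn_symmDiff_right (A B C : Finset (Fin n)) :
    sgn A (symmDiff B C) = sgn A B * sgn A C := by
  unfold sgn
  rw [← Finset.prod_mul_distrib]
  refine Finset.prod_congr rfl fun a _ => ?_
  refine prod_symmDiff_of_sq _ (fun b => ?_) B C
  split_ifs <;> norm_num

theorem symmDiff_cancel (B C D : Finset (Fin n)) :
    symmDiff (symmDiff B C) (symmDiff B D) = symmDiff C D := by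
  rw [symmDiff_comm B C, symmDiff_assoc, symmDiff_symmDiff_cancel_left]

/-- The product of `ℝ_n`. -/
instance : Mul (Cliff n) := ⟨fun s t => lmul s t⟩

instance : One (Cliff n) := ⟨EuclideanSpace.single ∅ 1⟩

theorem mul_def (s t : Cliff n) : s * t = lmul s t := rfl

theorem one_def : (1 : Cliff n) = EuclideanSpace.single ∅ 1 := rfl

theorem lmul_one (v : CliffMod n E) : lmul (1 : Cliff n) v = v := by
  ext C
  rw [lmul_apply, Finset.sum_eq_single ∅]
  · rw [show symmDiff ∅ C = C from bot_symmDiff C]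
    simp [one_def, sgn]
  · intro B _ hB
    simp [one_def, hB]
  · simp

theorem lmul_mul (s t : Cliff n) (v : CliffMod n E) : lmul (s * t) v = lmul s (lmul t v) := by
  ext D
  simp only [mul_def, lmul_apply, Finset.smul_sum, Finset.mul_sum, Finset.sum_smul, smul_eq_mul,
    smul_smul]
  rw [Finset.sum_comm]
  refine Finset.sum_congr rfl fun B _ => ?_
  have hB : Function.Involutive (fun C : Finset (Fin n) => symmDiff B C) :=
    fun C => symmDiff_symmDiff_cancel_left B C
  refine Fintype.sum_equiv (Function.Involutive.toPerm _ hB) _ _ fun C => ?_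
  simp only [Function.Involutive.coe_toPerm, symmDiff_cancel]
  congr 1
  simp only [sgn_symmDiff_left, sgn_symmDiff_right]
  linear_combination (sgn B B * sgn B C * sgn C C * sgn C D * s B * t (symmDiff B C)) *
    (-sgn_mul_self B D)

instance : Ring (Cliff n) where
  __ := (inferInstance : AddCommGroup (Cliff n))
  mul_assoc s t u := by rw [mul_def, lmul_mul]; rfl
  one_mul s := lmul_one s
  mul_one s := by
    ext C
    rw [mul_def, lmul_apply, Finset.sum_eq_single C]
    · simp [one_def, sgn]
    · intro B _ hB
      have : symmDiff B C ≠ ∅ := fun h => hB (symmDiff_eq_bot.1 h)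
      simp [one_def, this]
    · simp
  left_distrib s t u := map_add (lmul s) t u
  right_distrib s t u := by
    ext C
    simp [mul_def, lmul_apply, mul_add, add_mul, Finset.sum_add_distrib]
  zero_mul s := by
    ext C
    simp [mul_def, lmul_apply]
  mul_zero s := map_zero (lmul s)

/-- The basis vector `e_A`. -/
def basisVec (A : Finset (Fin n)) : Cliff n := EuclideanSpace.single A 1

theorem basisVec_mul (A B : Finset (Fin n)) :
    basisVec A * basisVec B = sgn A B • basisVec (symmDiff A B) := by
  ext C
  rw [mul_def, lmul_apply, Finset.sum_eq_single A]
  · by_cases h : C = symmDiff A B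
    · subst h
      simp [basisVec]
    · have h' : symmDiff A C ≠ B := by
        rintro rfl
        simp at h
      simp [basisVec, h, h']
  · intro D _ hD
    simp [basisVec, hD]
  · simp

/-- `e_i² = -1`. -/
theorem unit_mul_self (i : Fin n) : basisVec {i} * basisVec {i} = (-1 : Cliff n) := by
  rw [basisVec_mul, symmDiff_self]
  simp [sgn, basisVec, one_def]

/-- `e_i e_j = - e_j e_i` for `i ≠ j`. -/
theorem unit_anticomm {i j : Fin n} (h : i ≠ j) :
    basisVec {i} * basisVec {j} = -((basisVec {j} * basisVec {i} : Cliff n)) := by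
  rw [basisVec_mul, basisVec_mul, symmDiff_comm, ← neg_smul]
  congr 1
  rcases lt_or_gt_of_ne h with h | h
  · simp [sgn, h.le, h.not_ge]
  · simp [sgn, h.le, h.not_ge]

/-- `e_A = e_{i₁} ⋯ e_{i_r}`, by splitting off the largest index. -/
theorem basisVec_insert (A : Finset (Fin n)) (i : Fin n) (h : ∀ a ∈ A, a < i) :
    basisVec (insert i A) = basisVec A * basisVec {i} := by
  have hi : i ∉ A := fun hA => lt_irrefl _ (h i hA)
  have h1 : symmDiff A {i} = insert i A := by
    ext a
    simp only [Finset.mem_symmDiff, Finset.mem_singleton, Finset.mem_insert]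
    by_cases ha : a = i
    · subst ha
      simp [hi]
    · simp [ha]
  have h2 : sgn A {i} = 1 := by
    unfold sgn
    refine Finset.prod_eq_one fun a ha => ?_
    simp [(h a ha).not_ge]
  rw [basisVec_mul, h1, h2, one_smul]

end Algebra

/-- The conjugate `s̄`. -/
def conj {n : ℕ} (s : Cliff n) : Cliff n :=
  WithLp.toLp 2 fun A => (-1 : ℝ) ^ (A.card * (A.card + 1) / 2) * s A

/-- The paravectors `ℝ^{n+1} ⊆ ℝ_n`. The real part of `s` is its coordinate `s ∅`. -/
def paravectors (n : ℕ) : Set (Cliff n) := {s | ∀ A : Finset (Fin n), 2 ≤ A.card → s A = 0}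

/-- The sphere `𝕊` of purely imaginary paravectors of modulus one. -/
def imagSphere (n : ℕ) : Set (Cliff n) := {s | s ∈ paravectors n ∧ s ∅ = 0 ∧ ‖s‖ = 1}

/-- `x + J y`. -/
def slicePt {n : ℕ} (J : Cliff n) (x y : ℝ) : Cliff n := x • (1 : Cliff n) + y • J

/-- `e^{Jφ} = cos φ + J sin φ`. -/
def sliceExp {n : ℕ} (J : Cliff n) (φ : ℝ) : Cliff n := slicePt J (Real.cos φ) (Real.sin φ)

/-! ### Slice hyperholomorphic functions -/

/-- `𝒰 = {(x, y) : x + 𝕊 y ⊆ U}`. -/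
def sliceDomain {n : ℕ} (U : Set (Cliff n)) : Set (ℝ × ℝ) :=
  {p | ∀ J ∈ imagSphere n, slicePt J p.1 p.2 ∈ U}

/-- The components `f₀`, `f₁` represent `f` on the open axially symmetric set `U ⊆ ℝ^{n+1}` as a
left slice hyperholomorphic function. Only the values of `f` on `U` and those of `f₀`, `f₁` on
`𝒰` matter. -/
structure IsSlicePair {n : ℕ} (U : Set (Cliff n)) (f : Cliff n → Cliff n)
    (f₀ f₁ : ℝ × ℝ → Cliff n) : Prop where
  contDiff₀ : ContDiffOn ℝ 1 f₀ (sliceDomain U)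
  contDiff₁ : ContDiffOn ℝ 1 f₁ (sliceDomain U)
  repr : ∀ p ∈ sliceDomain U, ∀ J ∈ imagSphere n, f (slicePt J p.1 p.2) = f₀ p + J * f₁ p
  even : ∀ p ∈ sliceDomain U, f₀ (p.1, -p.2) = f₀ p
  odd : ∀ p ∈ sliceDomain U, f₁ (p.1, -p.2) = -f₁ p
  cauchyRiemann₁ : ∀ p ∈ sliceDomain U, fderiv ℝ f₀ p (1, 0) = fderiv ℝ f₁ p (0, 1)
  cauchyRiemann₂ : ∀ p ∈ sliceDomain U, fderiv ℝ f₀ p (0, 1) = -fderiv ℝ f₁ p (1, 0)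

/-- `f ∈ 𝒮ℋ_L(U)`. -/
def IsSliceHyp {n : ℕ} (U : Set (Cliff n)) (f : Cliff n → Cliff n) : Prop :=
  ∃ f₀ f₁ : ℝ × ℝ → Cliff n, IsSlicePair U f f₀ f₁

/-- `f ∈ 𝒩(U)`: the components `f₀`, `f₁` are real valued. -/
def IsIntrinsic {n : ℕ} (U : Set (Cliff n)) (f : Cliff n → Cliff n) : Prop :=
  ∃ f₀ f₁ : ℝ × ℝ → ℝ,
    IsSlicePair U f (fun p => f₀ p • (1 : Cliff n)) (fun p => f₁ p • (1 : Cliff n))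

/-- `I_ω = (-ω, ω) ∪ (π - ω, π + ω)`. -/
def angles (ω : ℝ) : Set ℝ := Ioo (-ω) ω ∪ Ioo (Real.pi - ω) (Real.pi + ω)

/-- The double sector `D_ω = {s ∈ ℝ^{n+1} \ {0} : Arg s ∈ I_ω}`. -/
def doubleSector (n : ℕ) (ω : ℝ) : Set (Cliff n) :=
  {s | ∃ J ∈ imagSphere n, ∃ φ ∈ angles ω, ∃ r : ℝ, 0 < r ∧ s = r • sliceExp J φ}

/-- Boundedness on `D_θ` together with `∫_0^∞ |f(t e^{Jφ})| dt / t < ∞` for all `J ∈ 𝕊`,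
`φ ∈ I_θ`. -/
def HasDecay {n : ℕ} (θ : ℝ) (f : Cliff n → Cliff n) : Prop :=
  (∃ M : ℝ, ∀ s ∈ doubleSector n θ, ‖f s‖ ≤ M) ∧
    ∀ J ∈ imagSphere n, ∀ φ ∈ angles θ,
      IntegrableOn (fun t : ℝ => ‖f (t • sliceExp J φ)‖ / t) (Ioi 0)

/-- `f ∈ 𝒮ℋ_L^0(D_θ)`. -/
def MemSH0 {n : ℕ} (θ : ℝ) (f : Cliff n → Cliff n) : Prop :=
  IsSliceHyp (doubleSector n θ) f ∧ HasDecay θ f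

/-- `g ∈ 𝒩^0(D_θ)`. -/
def MemN0 {n : ℕ} (θ : ℝ) (g : Cliff n → Cliff n) : Prop :=
  IsIntrinsic (doubleSector n θ) g ∧ HasDecay θ g

/-- `f(s) = f_∞ + (1 + s²)⁻¹ (f_0 - f_∞) + f̃(s)` for all `s ∈ D_θ`. (The element `1 + s²` is
invertible there if `θ < π / 2`.) -/
def HasDecomposition {n : ℕ} (θ : ℝ) (f : Cliff n → Cliff n) (fzero finf : Cliff n)
    (ftilde : Cliff n → Cliff n) : Prop :=
  ∀ s ∈ doubleSector n θ,
    f s = finf + Ring.inverse (1 + s ^ 2) * (fzero - finf) + ftilde s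

/-- `f ∈ 𝒮ℋ_L^bnd(D_θ)`. -/
def MemSHbnd {n : ℕ} (θ : ℝ) (f : Cliff n → Cliff n) : Prop :=
  ∃ (fzero finf : Cliff n) (ftilde : Cliff n → Cliff n),
    MemSH0 θ ftilde ∧ HasDecomposition θ f fzero finf ftilde

/-- `g ∈ 𝒩^bnd(D_θ)`: now `g_0`, `g_∞` are real and `g̃` is intrinsic. -/
def MemNbnd {n : ℕ} (θ : ℝ) (g : Cliff n → Cliff n) : Prop :=
  ∃ (gzero ginf : ℝ) (gtilde : Cliff n → Cliff n),
    MemN0 θ gtilde ∧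
      HasDecomposition θ g (gzero • (1 : Cliff n)) (ginf • (1 : Cliff n)) gtilde

/-! ### Closed operators, the `S`-resolvent and bisectorial operators -/

/-- `T ∈ 𝒦(V)`: a closed right-linear operator whose domain is a two-sided submodule of `V`. -/
structure ClosedOperator (n : ℕ) (E : Type*) [NormedAddCommGroup E] [NormedSpace ℝ E] where
  toPMap : CliffMod n E →ₗ.[ℝ] CliffMod n E
  lmul_mem : ∀ (a : Cliff n), ∀ v ∈ toPMap.domain, lmul a v ∈ toPMap.domain
  rmul_mem : ∀ (a : Cliff n), ∀ v ∈ toPMap.domain, rmul a v ∈ toPMap.domain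
  map_rmul : ∀ (a : Cliff n) (v : toPMap.domain),
    toPMap ⟨rmul a v, rmul_mem a v v.2⟩ = rmul a (toPMap v)
  closed : toPMap.IsClosed

section Operators

variable {n : ℕ} {E : Type*} [NormedAddCommGroup E] [NormedSpace ℝ E]

/-- `dom (T²) = {v ∈ dom T : T v ∈ dom T}`. -/
def sqDomain (T : ClosedOperator n E) : Submodule ℝ (CliffMod n E) :=
  (T.toPMap.domain.comap T.toPMap.toFun).map T.toPMap.domain.subtype

theorem sqDomain_le (T : ClosedOperator n E) : sqDomain T ≤ T.toPMap.domain :=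
  Submodule.map_subtype_le _ _

theorem sqDomain_map (T : ClosedOperator n E) (v : sqDomain T) :
    T.toPMap ⟨v, sqDomain_le T v.2⟩ ∈ T.toPMap.domain := by
  obtain ⟨v, ⟨w, hw, rfl⟩⟩ := v
  exact hw

/-- The operator `T² - 2 a T + b` with domain `dom (T²)`, for real `a`, `b`. -/
def quadOp (T : ClosedOperator n E) (a b : ℝ) (v : sqDomain T) : CliffMod n E :=
  T.toPMap ⟨T.toPMap ⟨v, sqDomain_le T v.2⟩, sqDomain_map T v⟩
    - (2 * a) • T.toPMap ⟨v, sqDomain_le T v.2⟩ + b • (v : CliffMod n E)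

/-- `B ∈ ℬ(V)` is the bounded right-linear inverse of `T² - 2 a T + b`. -/
structure IsQuadInverse (T : ClosedOperator n E) (a b : ℝ)
    (B : CliffMod n E →L[ℝ] CliffMod n E) : Prop where
  map_rmul : ∀ (c : Cliff n) (v : CliffMod n E), B (rmul c v) = rmul c (B v)
  mem : ∀ w, B w ∈ sqDomain T
  right_inv : ∀ w, quadOp T a b ⟨B w, mem w⟩ = w
  left_inv : ∀ v : sqDomain T, B (quadOp T a b v) = v

open Classical in
/-- `(T² - 2 a T + b)⁻¹ ∈ ℬ(V)`; zero if there is no bounded inverse. -/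
def quadInverse (T : ClosedOperator n E) (a b : ℝ) : CliffMod n E →L[ℝ] CliffMod n E :=
  if h : ∃ B, IsQuadInverse T a b B then h.choose else 0

/-- The `S`-resolvent set: all paravectors `s` such that `Q_s[T] = T² - 2 s₀ T + |s|²` has a
bounded inverse. -/
def resolventSet (T : ClosedOperator n E) : Set (Cliff n) :=
  {s | s ∈ paravectors n ∧ ∃ B, IsQuadInverse T (s ∅) (‖s‖ ^ 2) B}

/-- The `S`-spectrum. -/
def spectrumS (T : ClosedOperator n E) : Set (Cliff n) := paravectors n \ resolventSet T

/-- `Q_s[T]⁻¹`. -/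
def resolventQ (T : ClosedOperator n E) (s : Cliff n) : CliffMod n E →L[ℝ] CliffMod n E :=
  quadInverse T (s ∅) (‖s‖ ^ 2)

theorem resolventQ_mem (T : ClosedOperator n E) (s : Cliff n) (v : CliffMod n E) :
    resolventQ T s v ∈ T.toPMap.domain := by
  unfold resolventQ quadInverse
  split_ifs with h
  · exact sqDomain_le T (h.choose_spec.mem v)
  · simp

/-- `T B` as a bounded operator, for a bounded operator `B` with range in `dom T`; the closed graph
theorem shows that it is bounded. -/
def compBounded [CompleteSpace E] (T : ClosedOperator n E)
    (B : CliffMod n E →L[ℝ] CliffMod n E) (hB : ∀ v, B v ∈ T.toPMap.domain) :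
    CliffMod n E →L[ℝ] CliffMod n E :=
  ContinuousLinearMap.ofIsClosedGraph
    (g := T.toPMap.toFun ∘ₗ LinearMap.codRestrict T.toPMap.domain B.toLinearMap hB) (by
      have h : ((T.toPMap.toFun ∘ₗ
          LinearMap.codRestrict T.toPMap.domain B.toLinearMap hB).graph :
            Set (CliffMod n E × CliffMod n E)) =
          (fun p : CliffMod n E × CliffMod n E => (B p.1, p.2)) ⁻¹'
            (T.toPMap.graph : Set (CliffMod n E × CliffMod n E)) := by
        ext ⟨v, w⟩
        simp only [SetLike.mem_coe, LinearMap.mem_graph_iff, Set.mem_preimage,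
          LinearPMap.mem_graph_iff]
        constructor
        · rintro rfl
          exact ⟨⟨B v, hB v⟩, rfl, rfl⟩
        · rintro ⟨⟨y, hy⟩, h1, h2⟩
          simp only at h1 h2
          subst h1
          exact h2.symm
      rw [h]
      exact T.closed.preimage (by fun_prop))

theorem compBounded_apply [CompleteSpace E] (T : ClosedOperator n E)
    (B : CliffMod n E →L[ℝ] CliffMod n E) (hB : ∀ v, B v ∈ T.toPMap.domain) (v : CliffMod n E) :
    compBounded T B hB v = T.toPMap ⟨B v, hB v⟩ := rfl

/-- The left `S`-resolvent operator `S_L⁻¹(s, T) = Q_s[T]⁻¹ s̄ - T Q_s[T]⁻¹`. -/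
def leftResolvent [CompleteSpace E] (T : ClosedOperator n E) (s : Cliff n) :
    CliffMod n E →L[ℝ] CliffMod n E :=
  resolventQ T s ∘L lmul (conj s) - compBounded T (resolventQ T s) (resolventQ_mem T s)

/-- `T` is bisectorial of angle `ω`. -/
def IsBisectorial [CompleteSpace E] (T : ClosedOperator n E) (ω : ℝ) : Prop :=
  spectrumS T ⊆ closure (doubleSector n ω) ∧
    ∀ φ ∈ Ioo ω (Real.pi / 2), ∃ C : ℝ, 0 ≤ C ∧
      ∀ s ∈ paravectors n \ (doubleSector n φ ∪ {0}), ‖leftResolvent T s‖ ≤ C / ‖s‖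

/-! ### The functional calculi -/

/-- The path integral `∫_γ S(s) ds_J f(s) = ∫_ℝ S(γ(t)) (γ'(t) / J) f(γ(t)) dt` in `ℬ(V)` along a
curve `γ : ℝ → ℂ_J`, where a Clifford number acts on `V` by left multiplication and
`J⁻¹ = -J`. -/
def pathIntegral (J : Cliff n) (γ : ℝ → Cliff n)
    (S : Cliff n → (CliffMod n E →L[ℝ] CliffMod n E)) (f : Cliff n → Cliff n) :
    CliffMod n E →L[ℝ] CliffMod n E :=
  ∫ t : ℝ, S (γ t) ∘L lmul (deriv γ t * (-J) * f (γ t))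

/-- The curve `γ_+(t) = |t| e^{- sgn(t) J φ}`, which is the boundary of the right half of
`D_φ ∩ ℂ_J`. The boundary of the left half is `γ_- = -γ_+`. -/
def boundaryCurve (J : Cliff n) (φ : ℝ) (t : ℝ) : Cliff n :=
  |t| • sliceExp J (-(Real.sign t * φ))

/-- The `ω`-functional calculus `f(T) = (2π)⁻¹ ∫_{∂D_φ ∩ ℂ_J} S_L⁻¹(s, T) ds_J f(s)`. -/
def omegaCalculus [CompleteSpace E] (T : ClosedOperator n E) (J : Cliff n) (φ : ℝ)
    (f : Cliff n → Cliff n) : CliffMod n E →L[ℝ] CliffMod n E :=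
  (1 / (2 * Real.pi)) •
    (pathIntegral J (boundaryCurve J φ) (leftResolvent T) f +
      pathIntegral J (fun t => -boundaryCurve J φ t) (leftResolvent T) f)

open Classical in
/-- The extended `ω`-functional calculus
`f(T) = f_∞ + (1 + T²)⁻¹ (f_0 - f_∞) + f̃(T)` for `f ∈ 𝒮ℋ_L^bnd(D_θ)`, where `f̃(T)` is computed with
the imaginary unit `J ∈ 𝕊` and the angle `φ`. The coefficients `f_0`, `f_∞` and `f̃` (on `D_θ`) are
unique. -/
def extendedCalculus [CompleteSpace E] (T : ClosedOperator n E) (θ : ℝ) (J : Cliff n) (φ : ℝ)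
    (f : Cliff n → Cliff n) : CliffMod n E →L[ℝ] CliffMod n E :=
  if h : MemSHbnd θ f then
    let fzero : Cliff n := h.choose
    let finf : Cliff n := h.choose_spec.choose
    let ftilde : Cliff n → Cliff n := h.choose_spec.choose_spec.choose
    lmul finf + quadInverse T 0 1 ∘L lmul (fzero - finf) + omegaCalculus T J φ ftilde
  else 0

end Operators

end BisectorialCalculus

end

/-! The module `V` carries right multiplications, which commute with `T`. Right multiplication by
`e_1` squares to `-1`, so it gives `V` a complex structure for which `T` is complex linear. With
`z̄` acting from the right, `ρ(z) = Q_z[T]⁻¹ z̄ - T Q_z[T]⁻¹` is then the ordinary resolvent `(z -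
T)⁻¹` (`sliceResolvent`). It satisfies the resolvent identity and inherits the bisectorial bound, so
the classical holomorphic calculus of a bisectorial operator is available.

The slice calculus is translated into this one. Write `f̃ = ∑_A F_A e_A` with `F_A` holomorphic on a
plane double sector and `F_A(z̄)` conjugate to `F_A(z)`. When the contributions of two conjugate
boundary points are added, left multiplication by elements of `ℂ_J` occurs only through sums of the
form `w + w̄`, which are real and therefore agree with the same sums for the right action
(`leftResolvent_add_conj`). Hence `f̃(T) = ∑_A F_A(T) e_A`, independently of `J`
(`IsBisectorial.omegaCalculus_eq`). For an intrinsic function only `A = ∅` survives, and the theorem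
reduces to a product formula for scalar functions: `G(T) F_A(T) e_A` has to be `(G F_A)(T) e_A`.

For decaying functions this is `SectorialResolvent.contourCalculus_mul`: two nested contours, the
resolvent identity, Fubini and Cauchy's formula. Operator identities are tested against functionals
that are complex linear for the right action, so only scalar integrals occur. Functions are merely
bounded and `dt/t`-integrable on each ray, so contours are shifted in logarithmic coordinates with a
Gaussian regularisation (`integral_line_eq_of_strip`); the same shift gives independence of the
angle.

The constants and `u = (1 + z²)⁻¹` lie outside the decaying class. The operator of `u` is `(1 +
T²)⁻¹ = ρ(i) ρ(-i)`. Products of `u` with a decaying function follow from two applications of the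
resolvent identity, and `u² - u = -(z u)²` is a decaying function whose operator comes from a
residue computation. Uniqueness of the coefficients makes the decomposition selected in
`extendedCalculus` irrelevant. -/

noncomputable section

namespace BisectorialCalculus

/-! ### Contour shifts in strips and sectors. -/

open Filter Topology Complex in
/-- Contour shift between the boundary lines of a horizontal strip: boundedness near the two ends of
the strip and integrability along the two lines are enough. -/
theorem integral_line_eq_of_strip {F : ℂ → ℂ} {a b R B : ℝ} (hab : a ≤ b)
    (hF : DifferentiableOn ℂ F {w | w.im ∈ Icc a b})
    (hB : ∀ w : ℂ, w.im ∈ Icc a b → R ≤ |w.re| → ‖F w‖ ≤ B)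
    (ha : Integrable fun u : ℝ => F (u + a * I)) (hb : Integrable fun u : ℝ => F (u + b * I)) :
    ∫ u : ℝ, F (u + a * I) = ∫ u : ℝ, F (u + b * I) := by
  set m : ℝ := max (a ^ 2) (b ^ 2) with hm
  have hm0 : 0 ≤ m := le_max_of_le_left (sq_nonneg a)
  have hsq : ∀ y ∈ Icc a b, y ^ 2 ≤ m := by
    intro y hy
    rcases le_total 0 y with h | h
    · exact le_max_of_le_right (by nlinarith [hy.2])
    · exact le_max_of_le_left (by nlinarith [hy.1])
  have hnorm : ∀ (N : ℕ) (w : ℂ),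
      ‖cexp (-w ^ 2 / (N + 1))‖ = Real.exp ((w.im ^ 2 - w.re ^ 2) / (N + 1)) := by
    intro N w
    rw [Complex.norm_exp]
    congr 1
    have : (-w ^ 2 / ((N : ℂ) + 1)) = ((1 / ((N : ℝ) + 1) : ℝ) : ℂ) * (-w ^ 2) := by
      push_cast; ring
    rw [this, Complex.re_ofReal_mul]
    simp only [pow_two, neg_re, mul_re]
    ring
  -- Mere boundedness of `F` does not make the vertical sides of a rectangle negligible. The
  -- Gaussian factor does, and it tends to `1` pointwise while staying bounded by `exp m` on the
  -- strip.
  set G : ℕ → ℂ → ℂ := fun N w => F w * cexp (-w ^ 2 / (N + 1)) with hG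
  have hline : ∀ c ∈ Icc a b, Integrable (fun u : ℝ => F (u + c * I)) →
      Tendsto (fun N : ℕ => ∫ u in (-((N : ℝ) + 1))..((N : ℝ) + 1), G N (u + c * I)) atTop
        (𝓝 (∫ u : ℝ, F (u + c * I))) := by
    intro c hc hi
    have hrew : ∀ N : ℕ, ∫ u in (-((N : ℝ) + 1))..((N : ℝ) + 1), G N (u + c * I) =
        ∫ u : ℝ, (Ioc (-((N : ℝ) + 1)) ((N : ℝ) + 1)).indicator (fun u : ℝ => G N (u + c * I)) u := by
      intro N
      rw [intervalIntegral.integral_of_le (by linarith [N.cast_nonneg (α := ℝ)]),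
        integral_indicator measurableSet_Ioc]
    simp_rw [hrew]
    refine tendsto_integral_of_dominated_convergence
      (fun u => ‖F (u + c * I)‖ * Real.exp m) ?_ (hi.norm.mul_const _) ?_ ?_
    · intro N
      refine AEStronglyMeasurable.indicator ?_ measurableSet_Ioc
      refine hi.aestronglyMeasurable.mul (Continuous.aestronglyMeasurable ?_)
      fun_prop
    · intro N
      refine Eventually.of_forall fun u => ?_
      refine (norm_indicator_le_norm_self _ _).trans ?_
      rw [hG, norm_mul]
      refine mul_le_mul_of_nonneg_left ?_ (norm_nonneg _)
      rw [hnorm]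
      refine Real.exp_le_exp.2 ?_
      have h1 : (1 : ℝ) ≤ N + 1 := by linarith [N.cast_nonneg (α := ℝ)]
      rw [div_le_iff₀ (by linarith)]
      have : ((u : ℂ) + c * I).im = c := by simp
      rw [this]
      nlinarith [hsq c hc, sq_nonneg ((u : ℂ) + c * I).re]
    · refine Eventually.of_forall fun u => ?_
      have h1 : ∀ᶠ N : ℕ in atTop, G N (u + c * I) =
          (Ioc (-((N : ℝ) + 1)) ((N : ℝ) + 1)).indicator (fun u : ℝ => G N (u + c * I)) u := by
        filter_upwards [eventually_ge_atTop ⌈|u|⌉₊] with N hN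
        have h2 : |u| ≤ N := (Nat.le_ceil _).trans (by exact_mod_cast hN)
        rw [abs_le] at h2
        rw [indicator_of_mem]
        exact ⟨by linarith [h2.1], by linarith [h2.2]⟩
      refine Tendsto.congr' h1 ?_
      have h3 : Tendsto (fun N : ℕ => -((u : ℂ) + c * I) ^ 2 * (1 / ((N : ℂ) + 1))) atTop (𝓝 0) := by
        have := (tendsto_one_div_add_atTop_nhds_zero_nat (𝕜 := ℂ)).const_mul (-((u : ℂ) + c * I) ^ 2)
        simpa using this
      have h4 := ((Complex.continuous_exp.tendsto 0).comp h3).const_mul (F (u + c * I))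
      simp only [Complex.exp_zero, mul_one] at h4
      refine h4.congr fun N => ?_
      simp [hG, div_eq_mul_inv]
  -- The sign `s` selects the side. The half-width `N + 1` of the rectangle is also the denominator
  -- in the Gaussian, so the factor on a side is at most `exp m * exp (-(N + 1))`.
  have hside : ∀ s : ℝ, |s| = 1 →
      Tendsto (fun N : ℕ => ∫ y in a..b, G N ((s * ((N : ℝ) + 1) : ℝ) + y * I)) atTop (𝓝 0) := by
    intro s hs
    have hlim : Tendsto (fun N : ℕ => B * Real.exp m * Real.exp (-((N : ℝ) + 1)) * |b - a|) atTop
        (𝓝 0) := by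
      have h1 : Tendsto (fun N : ℕ => Real.exp (-((N : ℝ) + 1))) atTop (𝓝 0) :=
        Real.tendsto_exp_neg_atTop_nhds_zero.comp
          (tendsto_atTop_add_const_right _ _ tendsto_natCast_atTop_atTop)
      simpa using (h1.const_mul (B * Real.exp m)).mul_const |b - a|
    refine squeeze_zero_norm' ?_ hlim
    filter_upwards [eventually_ge_atTop ⌈R⌉₊] with N hN
    refine intervalIntegral.norm_integral_le_of_norm_le_const fun y hy => ?_
    rw [uIoc_of_le hab] at hy
    have hy' : y ∈ Icc a b := Ioc_subset_Icc_self hy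
    have hN0 := N.cast_nonneg (α := ℝ)
    have hre : (((s * ((N : ℝ) + 1) : ℝ) : ℂ) + y * I).re = s * ((N : ℝ) + 1) := by simp
    have him : (((s * ((N : ℝ) + 1) : ℝ) : ℂ) + y * I).im = y := by simp
    have hR : R ≤ N := (Nat.le_ceil _).trans (by exact_mod_cast hN)
    have hs2 : s ^ 2 = 1 := by rw [← sq_abs, hs, one_pow]
    have hFB := hB (((s * ((N : ℝ) + 1) : ℝ) : ℂ) + y * I) (by rw [him]; exact hy') (by
      rw [hre, abs_mul, hs, one_mul, abs_of_nonneg (by linarith)]; linarith)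
    rw [hG, norm_mul, mul_assoc]
    refine mul_le_mul hFB ?_ (norm_nonneg _) ((norm_nonneg _).trans hFB)
    rw [hnorm, ← Real.exp_add, hre, him]
    refine Real.exp_le_exp.2 ?_
    rw [div_le_iff₀ (by linarith)]
    rw [mul_pow, hs2]
    nlinarith [hsq y hy', mul_nonneg hm0 hN0]
  have hdiff : ∀ N : ℕ, DifferentiableOn ℂ (G N) {w | w.im ∈ Icc a b} := by
    intro N
    refine hF.mul (Differentiable.differentiableOn ?_)
    fun_prop
  have hrect : ∀ N : ℕ,
      (∫ u in (-((N : ℝ) + 1))..((N : ℝ) + 1), G N (u + a * I)) -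
      (∫ u in (-((N : ℝ) + 1))..((N : ℝ) + 1), G N (u + b * I)) +
      I • (∫ y in a..b, G N ((1 * ((N : ℝ) + 1) : ℝ) + y * I)) -
      I • (∫ y in a..b, G N (((-1) * ((N : ℝ) + 1) : ℝ) + y * I)) = 0 := by
    intro N
    have := Complex.integral_boundary_rect_eq_zero_of_differentiableOn (G N)
      (⟨-((N : ℝ) + 1), a⟩ : ℂ) (⟨(N : ℝ) + 1, b⟩ : ℂ) ((hdiff N).mono ?_)
    · simpa using this
    · intro w hw
      have := hw.2
      simpa [uIcc_of_le hab] using this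
  have hlim := (((hline a ⟨le_rfl, hab⟩ ha).sub (hline b ⟨hab, le_rfl⟩ hb)).add
    ((hside 1 (by simp)).const_smul I)).sub ((hside (-1) (by simp)).const_smul I)
  simp_rw [hrect] at hlim
  have := tendsto_nhds_unique hlim tendsto_const_nhds
  simp only [smul_zero, add_zero, sub_zero] at this
  exact sub_eq_zero.1 this

/-- Integrability along the ray `{t d : t > 0}`. -/
def RayIntegrable (h : ℂ → ℂ) (d : ℂ) : Prop := IntegrableOn (fun t : ℝ => h (t * d)) (Ioi 0)

/-- The integral `∫ h(z) dz` along the ray `{t d : t > 0}`. -/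
def rayIntegral (h : ℂ → ℂ) (d : ℂ) : ℂ := d * ∫ t in Ioi (0 : ℝ), h (t * d)

theorem rayIntegral_sub {h k : ℂ → ℂ} {d : ℂ} (hh : RayIntegrable h d) (hk : RayIntegrable k d) :
    rayIntegral (fun z => h z - k z) d = rayIntegral h d - rayIntegral k d := by
  simp only [rayIntegral]
  rw [integral_sub hh hk, mul_sub]

theorem rayIntegral_const_mul (c : ℂ) (h : ℂ → ℂ) (d : ℂ) :
    rayIntegral (fun z => c * h z) d = c * rayIntegral h d := by
  simp only [rayIntegral]
  rw [integral_const_mul]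
  ring

open Complex

/-- The substitution `t = exp u` turns the ray of direction `a` into the horizontal line of height
`a`; the factor `exp (u + a i)` is the Jacobian times the constant direction. -/
theorem rayIntegrable_exp_iff {h : ℂ → ℂ} {a : ℝ} :
    RayIntegrable h (cexp (a * I)) ↔
      Integrable fun u : ℝ => h (cexp (u + a * I)) * cexp (u + a * I) := by
  unfold RayIntegrable
  have h1 := integrableOn_image_iff_integrableOn_abs_deriv_smul (s := univ) (f := Real.exp)
    (f' := Real.exp) MeasurableSet.univ (fun x _ => (Real.hasDerivAt_exp x).hasDerivWithinAt)
    Real.exp_injective.injOn (fun t : ℝ => h (t * cexp (a * I)))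
  rw [image_univ, Real.range_exp, integrableOn_univ] at h1
  rw [h1, ← integrable_mul_const_iff (c := cexp (a * I)) (isUnit_iff_ne_zero.2 (Complex.exp_ne_zero _))]
  refine integrable_congr (Filter.Eventually.of_forall fun u => ?_)
  dsimp only
  rw [Complex.exp_add, ← Complex.ofReal_exp, abs_of_pos (Real.exp_pos u), Complex.real_smul]
  ring

theorem rayIntegral_exp_eq (h : ℂ → ℂ) (a : ℝ) :
    rayIntegral h (cexp (a * I)) = ∫ u : ℝ, h (cexp (u + a * I)) * cexp (u + a * I) := by
  unfold rayIntegral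
  have h1 := integral_image_eq_integral_abs_deriv_smul (s := univ) (f := Real.exp)
    (f' := Real.exp) MeasurableSet.univ (fun x _ => (Real.hasDerivAt_exp x).hasDerivWithinAt)
    Real.exp_injective.injOn (fun t : ℝ => h (t * cexp (a * I)))
  rw [image_univ, Real.range_exp, setIntegral_univ] at h1
  rw [h1, ← integral_const_mul]
  refine integral_congr_ae (Filter.Eventually.of_forall fun u => ?_)
  dsimp only
  rw [Complex.exp_add, ← Complex.ofReal_exp, abs_of_pos (Real.exp_pos u), Complex.real_smul]
  ring

theorem exp_add_mul_I (w : ℂ) : cexp w = (Real.exp w.re : ℝ) * cexp (w.im * I) := by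
  rw [Complex.ofReal_exp, ← Complex.exp_add, Complex.re_add_im]

/-- Rotation of the ray of integration within a sector. -/
theorem rayIntegral_eq_of_le {h : ℂ → ℂ} {a b R B : ℝ} (hab : a ≤ b) (hR : 0 < R) {U : Set ℂ}
    (hU : IsOpen U) (hmem : ∀ α ∈ Icc a b, ∀ t : ℝ, 0 < t → t * cexp (α * I) ∈ U)
    (hh : DifferentiableOn ℂ h U)
    (hB : ∀ α ∈ Icc a b, ∀ t : ℝ, 0 < t → (R ≤ t ∨ t ≤ R⁻¹) → t * ‖h (t * cexp (α * I))‖ ≤ B)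
    (ha : RayIntegrable h (cexp (a * I))) (hb : RayIntegrable h (cexp (b * I))) :
    rayIntegral h (cexp (a * I)) = rayIntegral h (cexp (b * I)) := by
  -- Under the exponential, the bound on `t * ‖h‖` near `0` and near `∞` becomes boundedness at the
  -- two ends of the strip.
  rw [rayIntegral_exp_eq, rayIntegral_exp_eq]
  refine integral_line_eq_of_strip (F := fun w => h (cexp w) * cexp w) (R := Real.log R) (B := B)
    hab ?_ ?_ (rayIntegrable_exp_iff.1 ha) (rayIntegrable_exp_iff.1 hb)
  · intro w hw
    refine DifferentiableAt.differentiableWithinAt ?_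
    have h1 : cexp w ∈ U := by
      rw [exp_add_mul_I]
      exact hmem _ hw _ (Real.exp_pos _)
    have h2 : DifferentiableAt ℂ (fun w => h (cexp w)) w :=
      DifferentiableAt.comp w (hh.differentiableAt (hU.mem_nhds h1))
        Complex.differentiable_exp.differentiableAt
    exact h2.mul Complex.differentiable_exp.differentiableAt
  · intro w hw hre
    have h1 : R ≤ Real.exp w.re ∨ Real.exp w.re ≤ R⁻¹ := by
      rcases le_abs.1 hre with h | h
      · left
        rwa [← Real.log_le_iff_le_exp hR]
      · right
        rw [← Real.le_log_iff_exp_le (inv_pos.2 hR), Real.log_inv]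
        linarith
    have h2 := hB _ hw _ (Real.exp_pos _) h1
    rw [norm_mul, Complex.norm_exp, mul_comm, exp_add_mul_I]
    exact h2

theorem rayIntegral_eq_of_sector {h : ℂ → ℂ} {a b R B : ℝ} (hR : 0 < R) {U : Set ℂ}
    (hU : IsOpen U) (hmem : ∀ α ∈ uIcc a b, ∀ t : ℝ, 0 < t → t * cexp (α * I) ∈ U)
    (hh : DifferentiableOn ℂ h U)
    (hB : ∀ α ∈ uIcc a b, ∀ t : ℝ, 0 < t → (R ≤ t ∨ t ≤ R⁻¹) → t * ‖h (t * cexp (α * I))‖ ≤ B)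
    (ha : RayIntegrable h (cexp (a * I))) (hb : RayIntegrable h (cexp (b * I))) :
    rayIntegral h (cexp (a * I)) = rayIntegral h (cexp (b * I)) := by
  rcases le_total a b with hab | hab
  · rw [uIcc_of_le hab] at hmem hB
    exact rayIntegral_eq_of_le hab hR hU hmem hh hB ha hb
  · rw [uIcc_of_ge hab] at hmem hB
    exact (rayIntegral_eq_of_le hab hR hU hmem hh hB hb ha).symm

/-- With `p` the cosine of the angle between `d` and `d'`, the square of `‖t d - s d'‖` exceeds `(1
- p) / 2 * (t + s)²` by `(1 + p) / 2 * (t - s)²`, and `p < 1` because the directions differ. This is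
the estimate that keeps Cauchy kernels under control on rays missing the pole. -/
theorem exists_le_norm_sub {d d' : ℂ} (hd : ‖d‖ = 1) (hd' : ‖d'‖ = 1) (hne : d ≠ d') :
    ∃ c : ℝ, 0 < c ∧ ∀ t s : ℝ, 0 ≤ t → 0 ≤ s → c * (t + s) ≤ ‖t * d - s * d'‖ := by
  have h1 : d.re ^ 2 + d.im ^ 2 = 1 := by
    rw [← one_pow 2, ← hd, Complex.sq_norm, Complex.normSq_apply]; ring
  have h2 : d'.re ^ 2 + d'.im ^ 2 = 1 := by
    rw [← one_pow 2, ← hd', Complex.sq_norm, Complex.normSq_apply]; ring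
  set p : ℝ := d.re * d'.re + d.im * d'.im with hp
  have hlt : p < 1 := by
    by_contra hcon
    apply hne
    have h3 : (d.re - d'.re) ^ 2 + (d.im - d'.im) ^ 2 ≤ 0 := by nlinarith
    have h4 : d.re - d'.re = 0 := by nlinarith [sq_nonneg (d.re - d'.re), sq_nonneg (d.im - d'.im)]
    have h5 : d.im - d'.im = 0 := by nlinarith [sq_nonneg (d.re - d'.re), sq_nonneg (d.im - d'.im)]
    exact Complex.ext (by linarith) (by linarith)
  have hge : -1 ≤ p := by nlinarith [sq_nonneg (d.re + d'.re), sq_nonneg (d.im + d'.im)]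
  have hpos : 0 < (1 - p) / 2 := by linarith
  refine ⟨Real.sqrt ((1 - p) / 2), Real.sqrt_pos.2 hpos, fun t s ht hs => ?_⟩
  refine (sq_le_sq₀ (by positivity) (norm_nonneg _)).1 ?_
  rw [mul_pow, Real.sq_sqrt hpos.le, Complex.sq_norm, Complex.normSq_apply]
  simp only [sub_re, sub_im, re_ofReal_mul, im_ofReal_mul]
  have : (t * d.re - s * d'.re) * (t * d.re - s * d'.re) +
      (t * d.im - s * d'.im) * (t * d.im - s * d'.im) =
      t ^ 2 * (d.re ^ 2 + d.im ^ 2) + s ^ 2 * (d'.re ^ 2 + d'.im ^ 2) - 2 * t * s * p := by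
    rw [hp]; ring
  rw [this, h1, h2]
  nlinarith [mul_nonneg (by linarith : 0 ≤ 1 + p) (sq_nonneg (t - s))]

theorem exp_mul_I_ne_of_lt {α β : ℝ} (h1 : α < β) (h2 : β < α + 2 * Real.pi) :
    cexp (α * I) ≠ cexp (β * I) := by
  intro h
  rw [Complex.exp_eq_exp_iff_exists_int] at h
  obtain ⟨k, hk⟩ := h
  have h3 : α = β + k * (2 * Real.pi) := by
    have := congrArg Complex.im hk
    simpa using this
  have h4 : (k : ℝ) < 0 := by
    by_contra hcon
    push Not at hcon
    nlinarith [mul_nonneg hcon Real.two_pi_pos.le]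
  have h5 : (-1 : ℝ) < k := by
    by_contra hcon
    push Not at hcon
    nlinarith [mul_le_mul_of_nonneg_right hcon Real.two_pi_pos.le]
  have h6 : k < 0 := by exact_mod_cast h4
  have h7 : -1 < k := by exact_mod_cast h5
  omega

theorem norm_le_two_mul_norm_sub {z w : ℂ} (h : 2 * ‖w‖ ≤ ‖z‖ ∨ 2 * ‖z‖ ≤ ‖w‖) :
    ‖z‖ ≤ 2 * ‖z - w‖ ∧ ‖w‖ ≤ 2 * ‖z - w‖ := by
  have h1 := norm_sub_norm_le z w
  have h2 := norm_sub_norm_le w z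
  rw [norm_sub_rev w z] at h2
  have := norm_nonneg z
  have := norm_nonneg w
  rcases h with h | h <;> constructor <;> linarith

theorem norm_mul_exp_mul_I {t : ℝ} (ht : 0 ≤ t) (α : ℝ) : ‖(t : ℂ) * cexp (α * I)‖ = t := by
  rw [norm_mul, Complex.norm_exp_ofReal_mul_I, mul_one, Complex.norm_real, Real.norm_of_nonneg ht]

theorem mul_exp_add_pi (s α : ℝ) : (s : ℂ) * cexp ((α + Real.pi : ℝ) * I) = -(s * cexp (α * I)) := by
  have : ((α + Real.pi : ℝ) : ℂ) * I = α * I + Real.pi * I := by push_cast; ring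
  rw [this, Complex.exp_add, Complex.exp_pi_mul_I]
  ring

theorem exp_sub_pi (α : ℝ) : cexp ((α - Real.pi : ℝ) * I) = cexp ((α + Real.pi : ℝ) * I) := by
  rw [Complex.exp_eq_exp_iff_exists_int]
  exact ⟨-1, by push_cast; ring⟩

/-! ### Cauchy's formula for one sector. -/

/-- The rational kernel that replaces the Cauchy kernel near `z₀` and is integrable at infinity. -/
def evenKernel (z₀ z : ℂ) : ℂ := 2 * z₀ / ((z - z₀) * (z + z₀))

theorem norm_evenKernel_le {z z₀ : ℂ} (hz₀ : z₀ ≠ 0)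
    (h : 2 * ‖z₀‖ ≤ ‖z‖ ∨ 2 * ‖z‖ ≤ ‖z₀‖) : ‖z‖ * ‖evenKernel z₀ z‖ ≤ 8 := by
  have h1 := norm_le_two_mul_norm_sub h
  have h2 := norm_le_two_mul_norm_sub (z := z) (w := -z₀) (by simpa using h)
  rw [norm_neg, sub_neg_eq_add] at h2
  have h0 : 0 < ‖z₀‖ := norm_pos_iff.2 hz₀
  have hp1 : 0 < ‖z - z₀‖ := by linarith
  have hp2 : 0 < ‖z + z₀‖ := by linarith
  rw [evenKernel, norm_div, norm_mul, norm_mul, Complex.norm_ofNat, ← mul_div_assoc,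
    div_le_iff₀ (mul_pos hp1 hp2)]
  have := mul_le_mul h1.1 h2.2 h0.le (by positivity)
  nlinarith

/-- Both factors of the denominator are at least a constant times `t + s`, which gives a comparison
with `(1 + t²)⁻¹`. -/
theorem rayIntegrable_evenKernel {α₀ s α : ℝ} (hs : 0 < s)
    (h1 : cexp (α * I) ≠ cexp (α₀ * I)) (h2 : cexp (α * I) ≠ cexp ((α₀ + Real.pi : ℝ) * I)) :
    RayIntegrable (evenKernel (s * cexp (α₀ * I))) (cexp (α * I)) := by
  obtain ⟨c₁, hc₁, hb₁⟩ := exists_le_norm_sub (Complex.norm_exp_ofReal_mul_I _)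
    (Complex.norm_exp_ofReal_mul_I _) h1
  obtain ⟨c₂, hc₂, hb₂⟩ := exists_le_norm_sub (Complex.norm_exp_ofReal_mul_I _)
    (Complex.norm_exp_ofReal_mul_I _) h2
  have hm : 0 < min 1 (s ^ 2) := lt_min one_pos (by positivity)
  refine Integrable.mono' (g := fun t : ℝ => 2 * s / (c₁ * c₂ * min 1 (s ^ 2)) * (1 + t ^ 2)⁻¹)
    (integrable_inv_one_add_sq.integrableOn.const_mul _) ?_ ?_
  · refine Measurable.aestronglyMeasurable ?_
    unfold evenKernel
    fun_prop
  · refine (ae_restrict_iff' measurableSet_Ioi).2 (Filter.Eventually.of_forall fun t ht => ?_)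
    have ht0 : 0 < t := ht
    have e1 := hb₁ t s ht0.le hs.le
    have e2 := hb₂ t s ht0.le hs.le
    rw [mul_exp_add_pi, sub_neg_eq_add] at e2
    rw [evenKernel, norm_div, norm_mul (2 : ℂ), norm_mul_exp_mul_I hs.le, norm_mul, Complex.norm_ofNat]
    rw [← div_eq_mul_inv, div_div]
    refine div_le_div_of_nonneg_left (by positivity) (by positivity) ?_
    calc c₁ * c₂ * min 1 (s ^ 2) * (1 + t ^ 2) ≤ c₁ * c₂ * (t + s) ^ 2 := by
          rw [mul_assoc]
          refine mul_le_mul_of_nonneg_left ?_ (by positivity)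
          have := min_le_left 1 (s ^ 2)
          have := min_le_right 1 (s ^ 2)
          nlinarith [mul_pos ht0 hs, mul_nonneg (sub_nonneg.2 (min_le_left 1 (s ^ 2))) (sq_nonneg t)]
      _ = (c₁ * (t + s)) * (c₂ * (t + s)) := by ring
      _ ≤ _ := mul_le_mul e1 e2 (by positivity) (norm_nonneg _)

/-- On a ray perpendicular to `z₀ = s e` (so `σ` is `i` or `-i`) the kernel is a constant times `(1
+ (t/s)²)⁻¹`, and the integral is an arctangent. -/
theorem rayIntegral_evenKernel_of_eq {s : ℝ} (hs : 0 < s) (e d : ℂ) (he : e ≠ 0) (σ : ℂ)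
    (hd : d = σ * e) (hσ : σ ^ 2 = -1) : rayIntegral (evenKernel (s * e)) d = -(Real.pi * σ) := by
  unfold rayIntegral
  have h1 : ∀ t : ℝ, evenKernel (s * e) (t * d) =
      (-2 / (s * e)) * (((1 + (s⁻¹ * t) ^ 2)⁻¹ : ℝ) : ℂ) := by
    intro t
    have hs' : (s : ℂ) ≠ 0 := by exact_mod_cast hs.ne'
    have hden : ((s ^ 2 + t ^ 2 : ℝ) : ℂ) ≠ 0 := by exact_mod_cast (by positivity)
    have h2 : (t * d - s * e) * (t * d + s * e) = -e ^ 2 * ((s ^ 2 + t ^ 2 : ℝ) : ℂ) := by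
      rw [hd]
      push_cast
      linear_combination t ^ 2 * e ^ 2 * hσ
    have h3 : (1 + (s⁻¹ * t) ^ 2)⁻¹ = s ^ 2 / (s ^ 2 + t ^ 2) := by
      field_simp
    rw [evenKernel, h2, h3]
    rw [Complex.ofReal_div]
    field_simp
    push_cast
    ring
  simp_rw [h1]
  rw [integral_const_mul, integral_complex_ofReal,
    integral_comp_mul_left_Ioi (fun t => (1 + t ^ 2)⁻¹) 0 (inv_pos.2 hs), mul_zero,
    integral_Ioi_inv_one_add_sq, Real.arctan_zero, hd]
  have hs' : (s : ℂ) ≠ 0 := by exact_mod_cast hs.ne'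
  rw [inv_inv, smul_eq_mul]
  push_cast
  field_simp
  simp

theorem rayIntegral_evenKernel_eq {α₀ s a b : ℝ} (hs : 0 < s)
    (hne : ∀ α ∈ uIcc a b, cexp (α * I) ≠ cexp (α₀ * I) ∧
      cexp (α * I) ≠ cexp ((α₀ + Real.pi : ℝ) * I)) :
    rayIntegral (evenKernel (s * cexp (α₀ * I))) (cexp (a * I)) =
      rayIntegral (evenKernel (s * cexp (α₀ * I))) (cexp (b * I)) := by
  set z₀ : ℂ := s * cexp (α₀ * I) with hz
  have hn : ‖z₀‖ = s := norm_mul_exp_mul_I hs.le _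
  have hz0 : z₀ ≠ 0 := by rw [← norm_pos_iff, hn]; exact hs
  have hray : ∀ α ∈ uIcc a b, ∀ t : ℝ, 0 < t →
      (t : ℂ) * cexp (α * I) ≠ z₀ ∧ (t : ℂ) * cexp (α * I) ≠ -z₀ := by
    intro α hα t ht
    obtain ⟨c₁, hc₁, hb₁⟩ := exists_le_norm_sub (Complex.norm_exp_ofReal_mul_I _)
      (Complex.norm_exp_ofReal_mul_I _) (hne α hα).1
    obtain ⟨c₂, hc₂, hb₂⟩ := exists_le_norm_sub (Complex.norm_exp_ofReal_mul_I _)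
      (Complex.norm_exp_ofReal_mul_I _) (hne α hα).2
    have e1 := hb₁ t s ht.le hs.le
    have e2 := hb₂ t s ht.le hs.le
    rw [mul_exp_add_pi] at e2
    rw [← sub_ne_zero, ← norm_pos_iff, ← sub_ne_zero (b := -z₀),
      ← norm_pos_iff (a := _ - -z₀)]
    exact ⟨lt_of_lt_of_le (by positivity) e1, lt_of_lt_of_le (by positivity) e2⟩
  refine rayIntegral_eq_of_sector (U := {z₀}ᶜ ∩ {-z₀}ᶜ) (R := max (2 * s) (2 / s)) (B := 8)
    (lt_max_of_lt_left (by positivity)) (isOpen_compl_singleton.inter isOpen_compl_singleton)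
    hray ?_ ?_ ?_ ?_
  · intro z hz
    have h1 : z - z₀ ≠ 0 := sub_ne_zero.2 hz.1
    have h2 : z + z₀ ≠ 0 := fun h => hz.2 (eq_neg_of_add_eq_zero_left h)
    unfold evenKernel
    refine DifferentiableAt.differentiableWithinAt ?_
    refine (differentiableAt_const _).div (by fun_prop) (mul_ne_zero h1 h2)
  · intro α hα t ht hR
    have h1 : ‖(t : ℂ) * cexp (α * I)‖ = t := norm_mul_exp_mul_I ht.le _
    have := norm_evenKernel_le (z := t * cexp (α * I)) hz0 (by
      rw [h1, hn]
      rcases hR with h | h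
      · exact Or.inl ((le_max_left _ _).trans h)
      · right
        have h2 := h.trans (inv_anti₀ (by positivity) (le_max_right (2 * s) (2 / s)))
        rw [inv_div] at h2
        linarith)
    rwa [h1] at this
  · exact rayIntegrable_evenKernel hs (hne a left_mem_uIcc).1 (hne a left_mem_uIcc).2
  · exact rayIntegrable_evenKernel hs (hne b right_mem_uIcc).1 (hne b right_mem_uIcc).2

/-- The ray can be rotated to the perpendicular direction without meeting the poles `z₀` and `-z₀`.
Together with the opposite value on the other side of `z₀`, this makes the kernel contribute a jump
of `2πi`. -/
theorem rayIntegral_evenKernel_lower {α₀ s a : ℝ} (hs : 0 < s) (h1 : α₀ - Real.pi < a)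
    (h2 : a < α₀) : rayIntegral (evenKernel (s * cexp (α₀ * I))) (cexp (a * I)) = Real.pi * I := by
  have hpi := Real.pi_pos
  rw [rayIntegral_evenKernel_eq (b := α₀ - Real.pi / 2) hs,
    rayIntegral_evenKernel_of_eq hs _ _ (Complex.exp_ne_zero _) (-I)]
  · ring
  · rw [show ((α₀ - Real.pi / 2 : ℝ) : ℂ) * I = -(Real.pi / 2 * I) + α₀ * I by push_cast; ring,
      Complex.exp_add, Complex.exp_neg, Complex.exp_pi_div_two_mul_I, Complex.inv_I]
  · rw [neg_sq, I_sq]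
  · intro α hα
    have hα1 : α₀ - Real.pi < α := lt_of_lt_of_le (lt_min h1 (by linarith)) hα.1
    have hα2 : α < α₀ := lt_of_le_of_lt hα.2 (max_lt h2 (by linarith))
    refine ⟨exp_mul_I_ne_of_lt hα2 (by linarith), ?_⟩
    exact exp_mul_I_ne_of_lt (by linarith) (by linarith)

theorem rayIntegral_evenKernel_upper {α₀ s a : ℝ} (hs : 0 < s) (h1 : α₀ < a)
    (h2 : a < α₀ + Real.pi) :
    rayIntegral (evenKernel (s * cexp (α₀ * I))) (cexp (a * I)) = -(Real.pi * I) := by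
  have hpi := Real.pi_pos
  rw [rayIntegral_evenKernel_eq (b := α₀ + Real.pi / 2) hs,
    rayIntegral_evenKernel_of_eq hs _ _ (Complex.exp_ne_zero _) I]
  · rw [show ((α₀ + Real.pi / 2 : ℝ) : ℂ) * I = (Real.pi / 2 * I) + α₀ * I by push_cast; ring,
      Complex.exp_add, Complex.exp_pi_div_two_mul_I]
  · exact I_sq
  · intro α hα
    have hα1 : α₀ < α := lt_of_lt_of_le (lt_min h1 (by linarith)) hα.1
    have hα2 : α < α₀ + Real.pi := lt_of_le_of_lt hα.2 (max_lt h2 (by linarith))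
    exact ⟨(exp_mul_I_ne_of_lt hα1 (by linarith)).symm, exp_mul_I_ne_of_lt hα2 (by linarith)⟩

/-- Cauchy's integral formula for a sector of opening less than `π`. -/
theorem rayIntegral_sub_eq_of_mem_sector {f : ℂ → ℂ} {a b α₀ s R B : ℝ} (hs : 0 < s)
    (ha : a < α₀) (hb : α₀ < b) (hab : b < a + Real.pi) (hR : 0 < R) {U : Set ℂ} (hU : IsOpen U)
    (hmem : ∀ α ∈ Icc a b, ∀ t : ℝ, 0 < t → t * cexp (α * I) ∈ U) (hf : DifferentiableOn ℂ f U)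
    (hB : ∀ α ∈ Icc a b, ∀ t : ℝ, 0 < t → (R ≤ t ∨ t ≤ R⁻¹) → ‖f (t * cexp (α * I))‖ ≤ B)
    (ia : RayIntegrable (fun z => f z / (z - s * cexp (α₀ * I))) (cexp (a * I)))
    (ib : RayIntegrable (fun z => f z / (z - s * cexp (α₀ * I))) (cexp (b * I))) :
    rayIntegral (fun z => f z / (z - s * cexp (α₀ * I))) (cexp (a * I)) -
      rayIntegral (fun z => f z / (z - s * cexp (α₀ * I))) (cexp (b * I)) =
      2 * Real.pi * I * f (s * cexp (α₀ * I)) := by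
  set z₀ : ℂ := s * cexp (α₀ * I) with hz
  have hpi := Real.pi_pos
  have hn : ‖z₀‖ = s := norm_mul_exp_mul_I hs.le _
  have hz0 : z₀ ≠ 0 := by rw [← norm_pos_iff, hn]; exact hs
  have hzU : z₀ ∈ U := hmem α₀ ⟨ha.le, hb.le⟩ s hs
  -- Subtracting `f z₀` times the even kernel from `f z / (z - z₀)` leaves `N z / ((z - z₀) (z +
  -- z₀))`. Since `N` vanishes at `z₀`, the divided slope `dslope` removes the singularity, and the
  -- difference `H` is holomorphic on the sector.
  set N : ℂ → ℂ := fun z => f z * (z + z₀) - 2 * z₀ * f z₀ with hN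
  have hN0 : N z₀ = 0 := by simp only [hN]; ring
  set H : ℂ → ℂ := fun z => dslope N z₀ z / (z + z₀) with hH
  have hHeq : ∀ z, z ≠ z₀ → z + z₀ ≠ 0 →
      H z = f z / (z - z₀) - f z₀ * evenKernel z₀ z := by
    intro z h1 h2
    have h3 : z - z₀ ≠ 0 := sub_ne_zero.2 h1
    simp only [hH, dslope_of_ne _ h1, slope_def_field, hN, evenKernel]
    field_simp
    ring
  have hplus : ∀ α ∈ Icc a b, ∀ t : ℝ, 0 < t → (t : ℂ) * cexp (α * I) + z₀ ≠ 0 := by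
    intro α hα t ht
    have hne : cexp (α * I) ≠ cexp ((α₀ + Real.pi : ℝ) * I) :=
      exp_mul_I_ne_of_lt (by linarith [hα.2]) (by linarith [hα.1])
    obtain ⟨c₂, hc₂, hb₂⟩ := exists_le_norm_sub (Complex.norm_exp_ofReal_mul_I _)
      (Complex.norm_exp_ofReal_mul_I _) hne
    have e2 := hb₂ t s ht.le hs.le
    rw [mul_exp_add_pi, sub_neg_eq_add] at e2
    rw [← norm_pos_iff]
    exact lt_of_lt_of_le (by positivity) e2
  have hminus : ∀ α : ℝ, cexp (α * I) ≠ cexp (α₀ * I) → ∀ t : ℝ, 0 < t →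
      (t : ℂ) * cexp (α * I) ≠ z₀ := by
    intro α hne t ht
    obtain ⟨c₂, hc₂, hb₂⟩ := exists_le_norm_sub (Complex.norm_exp_ofReal_mul_I _)
      (Complex.norm_exp_ofReal_mul_I _) hne
    have e2 := hb₂ t s ht.le hs.le
    rw [← sub_ne_zero, ← norm_pos_iff]
    exact lt_of_lt_of_le (by positivity) e2
  have hda : cexp (a * I) ≠ cexp (α₀ * I) := exp_mul_I_ne_of_lt ha (by linarith)
  have hdb : cexp (b * I) ≠ cexp (α₀ * I) := (exp_mul_I_ne_of_lt hb (by linarith)).symm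
  have hda' : cexp (a * I) ≠ cexp ((α₀ + Real.pi : ℝ) * I) :=
    exp_mul_I_ne_of_lt (by linarith) (by linarith)
  have hdb' : cexp (b * I) ≠ cexp ((α₀ + Real.pi : ℝ) * I) :=
    exp_mul_I_ne_of_lt (by linarith) (by linarith)
  have hab' : a ≤ b := by linarith
  have iH : ∀ α ∈ Icc a b, cexp (α * I) ≠ cexp (α₀ * I) →
      cexp (α * I) ≠ cexp ((α₀ + Real.pi : ℝ) * I) →
      RayIntegrable (fun z => f z / (z - z₀)) (cexp (α * I)) →
      RayIntegrable H (cexp (α * I)) ∧ rayIntegral H (cexp (α * I)) =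
        rayIntegral (fun z => f z / (z - z₀)) (cexp (α * I)) -
          f z₀ * rayIntegral (evenKernel z₀) (cexp (α * I)) := by
    intro α hα h1 h2 hi
    have hk : RayIntegrable (fun z => f z₀ * evenKernel z₀ z) (cexp (α * I)) :=
      (rayIntegrable_evenKernel hs h1 h2).const_mul _
    have hcongr : EqOn (fun t : ℝ => f (t * cexp (α * I)) / (t * cexp (α * I) - z₀) -
        f z₀ * evenKernel z₀ (t * cexp (α * I))) (fun t : ℝ => H (t * cexp (α * I))) (Ioi 0) :=
      fun t ht => (hHeq _ (hminus α h1 t ht) (hplus α hα t ht)).symm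
    constructor
    · exact IntegrableOn.congr_fun (hi.sub hk) hcongr measurableSet_Ioi
    · rw [← rayIntegral_const_mul, ← rayIntegral_sub hi hk]
      unfold rayIntegral
      rw [setIntegral_congr_fun measurableSet_Ioi hcongr]
  obtain ⟨iHa, eHa⟩ := iH a ⟨le_rfl, hab'⟩ hda hda' ia
  obtain ⟨iHb, eHb⟩ := iH b ⟨hab', le_rfl⟩ hdb hdb' ib
  -- Only `-z₀` has to be avoided now, and it lies outside the sector because its opening is less
  -- than `π`. The radius bound forces `|z|` and `|z₀|` to differ by a factor of at least `2`,
  -- whence the constants `2 * B` and `8`.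
  have key : rayIntegral H (cexp (a * I)) = rayIntegral H (cexp (b * I)) := by
    refine rayIntegral_eq_of_le (U := U ∩ {-z₀}ᶜ) (R := max R (max (2 * s) (2 / s)))
      (B := 2 * B + ‖f z₀‖ * 8) hab'
      (lt_max_of_lt_left hR) (hU.inter isOpen_compl_singleton) ?_ ?_ ?_ iHa iHb
    · intro α hα t ht
      exact ⟨hmem α hα t ht, fun h => hplus α hα t ht (by rw [mem_singleton_iff.1 h]; ring)⟩
    · refine DifferentiableOn.div ?_ (by fun_prop) ?_
      · refine ((Complex.differentiableOn_dslope (hU.mem_nhds hzU)).2 ?_).mono inter_subset_left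
        exact (hf.mul (by fun_prop)).sub (by fun_prop)
      · intro z hz h
        exact hz.2 (eq_neg_of_add_eq_zero_left h)
    · intro α hα t ht hR'
      have h1 : ‖(t : ℂ) * cexp (α * I)‖ = t := norm_mul_exp_mul_I ht.le _
      have hR1 : R ≤ t ∨ t ≤ R⁻¹ := hR'.imp (fun h => (le_max_left _ _).trans h)
        (fun h => h.trans (inv_anti₀ hR (le_max_left _ _)))
      have hR2 : 2 * ‖z₀‖ ≤ ‖(t : ℂ) * cexp (α * I)‖ ∨ 2 * ‖(t : ℂ) * cexp (α * I)‖ ≤ ‖z₀‖ := by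
        rw [h1, hn]
        rcases hR' with h | h
        · exact Or.inl (((le_max_left _ _).trans (le_max_right _ _)).trans h)
        · right
          have h2 := h.trans (inv_anti₀ (b := 2 / s) (by positivity)
            ((le_max_right _ _).trans (le_max_right _ _)))
          rw [inv_div] at h2
          linarith
      have h3 := norm_le_two_mul_norm_sub hR2
      have h4 := norm_evenKernel_le hz0 hR2
      rw [h1] at h3 h4
      have h5 : (0 : ℝ) < ‖(t : ℂ) * cexp (α * I) - z₀‖ := by linarith [h3.1]
      rw [hHeq _ (sub_ne_zero.1 (norm_pos_iff.1 h5)) (hplus α hα t ht)]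
      have hBt := hB α hα t ht hR1
      have h6 : t * ‖f (t * cexp (α * I)) / (t * cexp (α * I) - z₀)‖ ≤ 2 * B := by
        rw [norm_div, ← mul_div_assoc, div_le_iff₀ h5]
        have := mul_le_mul h3.1 hBt (norm_nonneg _) (by positivity)
        linarith
      calc t * ‖f (t * cexp (α * I)) / (t * cexp (α * I) - z₀) -
            f z₀ * evenKernel z₀ (t * cexp (α * I))‖
          ≤ t * (‖f (t * cexp (α * I)) / (t * cexp (α * I) - z₀)‖ +
            ‖f z₀‖ * ‖evenKernel z₀ (t * cexp (α * I))‖) := by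
            refine mul_le_mul_of_nonneg_left ?_ ht.le
            rw [← norm_mul]
            exact norm_sub_le _ _
        _ ≤ _ := by nlinarith [norm_nonneg (f z₀)]
  rw [eHa, eHb, rayIntegral_evenKernel_lower hs (by linarith) ha,
    rayIntegral_evenKernel_upper hs hb (by linarith)] at key
  linear_combination key

end BisectorialCalculus

end

noncomputable section

namespace BisectorialCalculus

open Complex

/-! ### Double sectors in the complex plane and contour integrals around them -/

/-- The double sector `{r e^{iα} : r > 0, α ∈ I_θ}` of the complex plane. -/
def sector (θ : ℝ) : Set ℂ := {z | |z.im| * Real.cos θ < |z.re| * Real.sin θ}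

/-- The complement of the closure of the double sector of angle `ω`. -/
def cosector (ω : ℝ) : Set ℂ := {z | |z.re| * Real.sin ω < |z.im| * Real.cos ω}

theorem isOpen_sector (θ : ℝ) : IsOpen (sector θ) := by
  apply isOpen_lt <;> fun_prop

theorem isOpen_cosector (ω : ℝ) : IsOpen (cosector ω) := by
  apply isOpen_lt <;> fun_prop

theorem polar_mem_sector_iff {θ α t : ℝ} (ht : 0 < t) :
    (t : ℂ) * cexp (α * I) ∈ sector θ ↔
      |Real.sin α| * Real.cos θ < |Real.cos α| * Real.sin θ := by
  simp only [sector, mem_ofPred_eq, re_ofReal_mul, im_ofReal_mul, exp_ofReal_mul_I_re,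
    exp_ofReal_mul_I_im, abs_mul, abs_of_pos ht, mul_assoc]
  exact mul_lt_mul_iff_right₀ ht

theorem polar_mem_cosector_iff {ω α t : ℝ} (ht : 0 < t) :
    (t : ℂ) * cexp (α * I) ∈ cosector ω ↔
      |Real.cos α| * Real.sin ω < |Real.sin α| * Real.cos ω := by
  simp only [cosector, mem_ofPred_eq, re_ofReal_mul, im_ofReal_mul, exp_ofReal_mul_I_re,
    exp_ofReal_mul_I_im, abs_mul, abs_of_pos ht, mul_assoc]
  exact mul_lt_mul_iff_right₀ ht

theorem abs_sin_mul_cos_lt {θ α : ℝ} (hθ : θ ∈ Ioo 0 (Real.pi / 2)) (hα : α ∈ angles θ) :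
    |Real.sin α| * Real.cos θ < |Real.cos α| * Real.sin θ := by
  have key : ∀ β ∈ Ioo (-θ) θ, |Real.sin β| * Real.cos θ < |Real.cos β| * Real.sin θ := by
    intro β hβ
    have hc : 0 < Real.cos β := Real.cos_pos_of_mem_Ioo ⟨by linarith [hβ.1, hθ.2], by linarith [hβ.2, hθ.2]⟩
    have h1 : 0 < Real.sin (θ - β) :=
      Real.sin_pos_of_pos_of_lt_pi (by linarith [hβ.2]) (by linarith [hβ.1, hθ.2])
    have h2 : 0 < Real.sin (θ + β) :=
      Real.sin_pos_of_pos_of_lt_pi (by linarith [hβ.1]) (by linarith [hβ.2, hθ.2])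
    rw [Real.sin_sub] at h1
    rw [Real.sin_add] at h2
    rw [abs_of_pos hc]
    rcases abs_cases (Real.sin β) with ⟨h, _⟩ | ⟨h, _⟩ <;> rw [h] <;> linarith
  rcases hα with h | h
  · exact key α h
  · have := key (α - Real.pi) ⟨by linarith [h.1], by linarith [h.2]⟩
    rwa [Real.sin_sub_pi, Real.cos_sub_pi, abs_neg, abs_neg] at this

theorem polar_mem_sector {θ α t : ℝ} (hθ : θ ∈ Ioo 0 (Real.pi / 2)) (hα : α ∈ angles θ)
    (ht : 0 < t) : (t : ℂ) * cexp (α * I) ∈ sector θ :=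
  (polar_mem_sector_iff ht).2 (abs_sin_mul_cos_lt hθ hα)

theorem polar_mem_cosector {ω α t : ℝ} (hω : ω ∈ Ioo 0 (Real.pi / 2))
    (hα : α ∈ Ioo ω (Real.pi - ω) ∨ α + Real.pi ∈ Ioo ω (Real.pi - ω) ∨
      α - Real.pi ∈ Ioo ω (Real.pi - ω)) (ht : 0 < t) :
    (t : ℂ) * cexp (α * I) ∈ cosector ω := by
  rw [polar_mem_cosector_iff ht]
  have key : ∀ β ∈ Ioo ω (Real.pi - ω),
      |Real.cos β| * Real.sin ω < |Real.sin β| * Real.cos ω := by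
    intro β hβ
    have hc : 0 < Real.sin β :=
      Real.sin_pos_of_pos_of_lt_pi (by linarith [hβ.1, hω.1]) (by linarith [hβ.2, hω.1])
    have h1 : 0 < Real.sin (β - ω) :=
      Real.sin_pos_of_pos_of_lt_pi (by linarith [hβ.1]) (by linarith [hβ.2, hω.1])
    have h2 : 0 < Real.sin (β + ω) :=
      Real.sin_pos_of_pos_of_lt_pi (by linarith [hβ.1, hω.1]) (by linarith [hβ.2])
    rw [Real.sin_sub] at h1
    rw [Real.sin_add] at h2
    rw [abs_of_pos hc]
    rcases abs_cases (Real.cos β) with ⟨h, _⟩ | ⟨h, _⟩ <;> rw [h] <;> linarith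
  rcases hα with h | h | h
  · exact key α h
  · simpa using key _ h
  · simpa using key _ h

theorem cosector_anti {φ θ : ℝ} (hφ : 0 < φ) (h : φ ≤ θ) (hθ : θ < Real.pi / 2) :
    cosector θ ⊆ cosector φ := by
  intro z hz
  simp only [cosector, mem_ofPred_eq] at hz ⊢
  have h1 : 0 < Real.cos θ := Real.cos_pos_of_mem_Ioo ⟨by linarith, hθ⟩
  have h2 : 0 < Real.cos φ := Real.cos_pos_of_mem_Ioo ⟨by linarith, by linarith⟩
  have h3 : 0 ≤ Real.sin (θ - φ) :=
    Real.sin_nonneg_of_nonneg_of_le_pi (by linarith) (by linarith)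
  rw [Real.sin_sub] at h3
  have h4 := mul_lt_mul_of_pos_right hz h2
  have h5 := mul_nonneg (abs_nonneg z.re) h3
  nlinarith

theorem ne_zero_of_mem_cosector {ω : ℝ} {z : ℂ} (hz : z ∈ cosector ω) : z ≠ 0 := by
  rintro rfl
  simp [cosector] at hz

/-- The defining strict inequality is continuous in the angle. Resolvent bounds hold only for angles
strictly larger than `ω`, so this room is needed at every point. -/
theorem exists_mem_cosector_gt {ω : ℝ} (hω : ω ∈ Ioo 0 (Real.pi / 2)) {z : ℂ}
    (hz : z ∈ cosector ω) : ∃ ψ ∈ Ioo ω (Real.pi / 2), z ∈ cosector ψ := by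
  have h1 : ∀ᶠ ψ in nhds ω, |z.re| * Real.sin ψ < |z.im| * Real.cos ψ :=
    (isOpen_lt (by fun_prop) (by fun_prop)).mem_nhds hz
  have h2 : ∀ᶠ ψ in nhds ω, ψ < Real.pi / 2 := eventually_lt_nhds hω.2
  have h3 : ∀ᶠ ψ in nhdsWithin ω (Ioi ω), ψ ∈ Ioi ω := self_mem_nhdsWithin
  obtain ⟨ψ, ⟨h3, h4⟩, h5⟩ := (((h1.and h2).filter_mono nhdsWithin_le_nhds).and h3).exists
  exact ⟨ψ, ⟨h5, h4⟩, h3⟩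

/-- The directions of the four rays bounding the double sector of angle `φ`. -/
def contourAngle (φ : ℝ) : Fin 4 → ℝ := ![-φ, φ, Real.pi - φ, Real.pi + φ]

/-- The orientations of the four rays: `1` if the ray is traversed away from `0`. -/
def contourSign : Fin 4 → ℂ := ![1, -1, 1, -1]

/-- The unit vectors on the four rays. -/
def contourDir (φ : ℝ) (k : Fin 4) : ℂ := cexp (contourAngle φ k * I)

/-- `∫_{∂D_φ} h(z) dz`. -/
def contourIntegral (φ : ℝ) (h : ℂ → ℂ) : ℂ :=
  ∑ k, contourSign k * rayIntegral h (contourDir φ k)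

theorem contourIntegral_def' (φ : ℝ) (h : ℂ → ℂ) : contourIntegral φ h =
    rayIntegral h (cexp ((-φ : ℝ) * I)) - rayIntegral h (cexp (φ * I)) +
      (rayIntegral h (cexp ((Real.pi - φ : ℝ) * I)) -
        rayIntegral h (cexp ((Real.pi + φ : ℝ) * I))) := by
  simp only [contourIntegral, contourSign, contourDir, contourAngle, Fin.sum_univ_four,
    Matrix.cons_val_zero, Matrix.cons_val_one, Matrix.cons_val]
  ring

theorem norm_contourDir (φ : ℝ) (k : Fin 4) : ‖contourDir φ k‖ = 1 :=
  Complex.norm_exp_ofReal_mul_I _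

theorem contourAngle_mem_angles {φ θ : ℝ} (h0 : 0 < φ) (h : φ < θ) (k : Fin 4) :
    contourAngle φ k ∈ angles θ := by
  have := Real.pi_pos
  fin_cases k
  · exact Or.inl ⟨by simp [contourAngle]; linarith, by simp [contourAngle]; linarith⟩
  · exact Or.inl ⟨by simp [contourAngle]; linarith, by simp [contourAngle]; linarith⟩
  · exact Or.inr ⟨by simp [contourAngle]; linarith, by simp [contourAngle]; linarith⟩
  · exact Or.inr ⟨by simp [contourAngle]; linarith, by simp [contourAngle]; linarith⟩

theorem contour_mem_sector {φ θ t : ℝ} (h0 : 0 < φ) (h : φ < θ) (hθ : θ < Real.pi / 2)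
    (ht : 0 < t) (k : Fin 4) : (t : ℂ) * contourDir φ k ∈ sector θ :=
  polar_mem_sector ⟨h0.trans h, hθ⟩ (contourAngle_mem_angles h0 h k) ht

theorem contour_mem_cosector {φ ω t : ℝ} (h0 : 0 < ω) (h : ω < φ) (hφ : φ < Real.pi / 2)
    (ht : 0 < t) (k : Fin 4) : (t : ℂ) * contourDir φ k ∈ cosector ω := by
  refine polar_mem_cosector ⟨h0, by linarith⟩ ?_ ht
  fin_cases k
  · exact Or.inr (Or.inl ⟨by simp [contourAngle]; linarith, by simp [contourAngle]; linarith⟩)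
  · exact Or.inl ⟨by simp [contourAngle]; linarith, by simp [contourAngle]; linarith⟩
  · exact Or.inl ⟨by simp [contourAngle]; linarith, by simp [contourAngle]; linarith⟩
  · exact Or.inr (Or.inr ⟨by simp [contourAngle]; linarith, by simp [contourAngle]; linarith⟩)

/-- Bounded holomorphic functions on the double sector that are integrable with respect to
`dt / t` along all rays. -/
structure HolDecay (θ : ℝ) (f : ℂ → ℂ) : Prop where
  differentiableOn : DifferentiableOn ℂ f (sector θ)
  bounded : ∃ M : ℝ, ∀ z ∈ sector θ, ‖f z‖ ≤ M
  integrable : ∀ α ∈ angles θ, IntegrableOn (fun t : ℝ => ‖f (t * cexp (α * I))‖ / t) (Ioi 0)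

namespace HolDecay

variable {θ : ℝ} {f g : ℂ → ℂ}

theorem continuousOn_ray (hf : DifferentiableOn ℂ f (sector θ)) (hθ : θ ∈ Ioo 0 (Real.pi / 2))
    {α : ℝ} (hα : α ∈ angles θ) :
    ContinuousOn (fun t : ℝ => f (t * cexp (α * I))) (Ioi 0) :=
  hf.continuousOn.comp (by fun_prop) fun _ ht => polar_mem_sector hθ hα ht

/-- A function that is bounded by a multiple of `|f|` belongs to the class as well. -/
theorem of_le (hf : HolDecay θ f) (hθ : θ ∈ Ioo 0 (Real.pi / 2))
    (hg : DifferentiableOn ℂ g (sector θ)) (C : ℝ)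
    (h : ∀ z ∈ sector θ, ‖g z‖ ≤ C * ‖f z‖) : HolDecay θ g where
  differentiableOn := hg
  bounded := by
    obtain ⟨M, hM⟩ := hf.bounded
    refine ⟨|C| * M, fun z hz => (h z hz).trans ?_⟩
    exact mul_le_mul (le_abs_self C) (hM z hz) (norm_nonneg _) (abs_nonneg C)
  integrable α hα := by
    refine Integrable.mono' ((hf.integrable α hα).const_mul C) ?_ ?_
    · refine ContinuousOn.aestronglyMeasurable ?_ measurableSet_Ioi
      refine (continuousOn_ray hg hθ hα).norm.div continuousOn_id fun t ht => ?_
      exact (ne_of_gt ht)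
    · refine (ae_restrict_iff' measurableSet_Ioi).2 (Filter.Eventually.of_forall fun t ht => ?_)
      have ht0 : 0 < t := ht
      rw [norm_div, norm_norm, Real.norm_of_nonneg ht0.le, ← mul_div_assoc]
      exact div_le_div_of_nonneg_right (h _ (polar_mem_sector hθ hα ht)) ht0.le

theorem mul_bounded (hf : HolDecay θ f) (hθ : θ ∈ Ioo 0 (Real.pi / 2))
    (hg : DifferentiableOn ℂ g (sector θ)) (hb : ∃ M : ℝ, ∀ z ∈ sector θ, ‖g z‖ ≤ M) :
    HolDecay θ (fun z => g z * f z) := by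
  obtain ⟨M, hM⟩ := hb
  refine hf.of_le hθ (hg.mul hf.differentiableOn) M fun z hz => ?_
  rw [norm_mul]
  exact mul_le_mul_of_nonneg_right (hM z hz) (norm_nonneg _)

theorem const_mul (hf : HolDecay θ f) (hθ : θ ∈ Ioo 0 (Real.pi / 2)) (c : ℂ) :
    HolDecay θ (fun z => c * f z) :=
  hf.mul_bounded hθ (differentiableOn_const c) ⟨‖c‖, fun _ _ => le_rfl⟩

theorem add (hf : HolDecay θ f) (hg : HolDecay θ g) (hθ : θ ∈ Ioo 0 (Real.pi / 2)) :
    HolDecay θ (fun z => f z + g z) where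
  differentiableOn := hf.differentiableOn.add hg.differentiableOn
  bounded := by
    obtain ⟨M, hM⟩ := hf.bounded
    obtain ⟨N, hN⟩ := hg.bounded
    exact ⟨M + N, fun z hz => (norm_add_le _ _).trans (add_le_add (hM z hz) (hN z hz))⟩
  integrable α hα := by
    refine Integrable.mono' ((hf.integrable α hα).add (hg.integrable α hα)) ?_ ?_
    · refine ContinuousOn.aestronglyMeasurable ?_ measurableSet_Ioi
      refine (continuousOn_ray (hf.differentiableOn.add hg.differentiableOn) hθ hα).norm.div
        continuousOn_id fun t ht => ?_
      exact (ne_of_gt ht)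
    · refine (ae_restrict_iff' measurableSet_Ioi).2 (Filter.Eventually.of_forall fun t ht => ?_)
      have ht0 : 0 < t := ht
      rw [norm_div, norm_norm, Real.norm_of_nonneg ht0.le, Pi.add_apply, ← add_div]
      exact div_le_div_of_nonneg_right (norm_add_le _ _) ht0.le

theorem rayIntegrable_mul (hf : HolDecay θ f) (hθ : θ ∈ Ioo 0 (Real.pi / 2)) {α : ℝ}
    (hα : α ∈ angles θ) {h : ℂ → ℂ} {C : ℝ}
    (hc : ContinuousOn (fun t : ℝ => h (t * cexp (α * I))) (Ioi 0))
    (hb : ∀ t : ℝ, 0 < t → t * ‖h (t * cexp (α * I))‖ ≤ C) :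
    RayIntegrable (fun z => f z * h z) (cexp (α * I)) := by
  refine Integrable.mono' ((hf.integrable α hα).const_mul C) ?_ ?_
  · exact ((continuousOn_ray hf.differentiableOn hθ hα).mul hc).aestronglyMeasurable
      measurableSet_Ioi
  · refine (ae_restrict_iff' measurableSet_Ioi).2 (Filter.Eventually.of_forall fun t ht => ?_)
    have ht0 : 0 < t := ht
    rw [norm_mul, ← mul_div_assoc, le_div_iff₀ ht0]
    nlinarith [hb t ht, norm_nonneg (f (t * cexp (α * I)))]

theorem rayIntegrable_div (hf : HolDecay θ f) (hθ : θ ∈ Ioo 0 (Real.pi / 2)) {α β s : ℝ}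
    (hα : α ∈ angles θ) (hs : 0 < s) (hne : cexp (α * I) ≠ cexp (β * I)) :
    RayIntegrable (fun z => f z / (z - s * cexp (β * I))) (cexp (α * I)) := by
  obtain ⟨c, hc, hb⟩ := exists_le_norm_sub (Complex.norm_exp_ofReal_mul_I _)
    (Complex.norm_exp_ofReal_mul_I _) hne
  have hpos : ∀ t : ℝ, 0 < t → c * t ≤ ‖(t : ℂ) * cexp (α * I) - s * cexp (β * I)‖ :=
    fun t ht => le_trans (by nlinarith [mul_pos hc hs]) (hb t s ht.le hs.le)
  simp only [div_eq_mul_inv]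
  refine hf.rayIntegrable_mul hθ hα (C := c⁻¹) ?_ ?_
  · refine ContinuousOn.inv₀ (by fun_prop) fun t ht => ?_
    rw [← norm_pos_iff]
    exact lt_of_lt_of_le (mul_pos hc ht) (hpos t ht)
  · intro t ht
    have h1 := lt_of_lt_of_le (mul_pos hc ht) (hpos t ht)
    rw [norm_inv, ← div_eq_mul_inv, div_le_iff₀ h1, ← div_eq_inv_mul, le_div_iff₀ hc]
    linarith [hpos t ht]

theorem rayIntegral_div_eq (hf : HolDecay θ f) (hθ : θ ∈ Ioo 0 (Real.pi / 2)) {a b β s : ℝ}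
    (hab : a ≤ b) (hsub : Icc a b ⊆ angles θ) (hs : 0 < s)
    (hne : ∀ α ∈ Icc a b, cexp (α * I) ≠ cexp (β * I)) :
    rayIntegral (fun z => f z / (z - s * cexp (β * I))) (cexp (a * I)) =
      rayIntegral (fun z => f z / (z - s * cexp (β * I))) (cexp (b * I)) := by
  obtain ⟨M, hM⟩ := hf.bounded
  set z₀ : ℂ := s * cexp (β * I) with hz
  have hn : ‖z₀‖ = s := norm_mul_exp_mul_I hs.le _
  refine rayIntegral_eq_of_le (U := sector θ ∩ {z₀}ᶜ) (R := max (2 * s) (2 / s)) (B := 2 * M) hab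
    (lt_max_of_lt_left (by positivity)) ((isOpen_sector θ).inter isOpen_compl_singleton)
    ?_ ?_ ?_ (hf.rayIntegrable_div hθ (hsub ⟨le_rfl, hab⟩) hs (hne a ⟨le_rfl, hab⟩))
    (hf.rayIntegrable_div hθ (hsub ⟨hab, le_rfl⟩) hs (hne b ⟨hab, le_rfl⟩))
  · intro α hα t ht
    refine ⟨polar_mem_sector hθ (hsub hα) ht, fun h => hne α hα ?_⟩
    have h1 : (t : ℂ) * cexp (α * I) = s * cexp (β * I) := h
    have h2 : t = s := by
      have := congrArg norm h1
      rwa [norm_mul_exp_mul_I ht.le, norm_mul_exp_mul_I hs.le] at this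
    rw [h2] at h1
    exact mul_left_cancel₀ (by exact_mod_cast hs.ne') h1
  · refine (hf.differentiableOn.mono inter_subset_left).div (by fun_prop) fun z hz => ?_
    exact sub_ne_zero.2 hz.2
  · intro α hα t ht hR
    have h1 : ‖(t : ℂ) * cexp (α * I)‖ = t := norm_mul_exp_mul_I ht.le _
    have h2 := norm_le_two_mul_norm_sub (z := t * cexp (α * I)) (w := z₀) (by
      rw [h1, hn]
      rcases hR with h | h
      · exact Or.inl ((le_max_left _ _).trans h)
      · right
        have h2 := h.trans (inv_anti₀ (by positivity) (le_max_right (2 * s) (2 / s)))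
        rw [inv_div] at h2
        linarith)
    rw [h1] at h2
    have h3 : 0 < ‖(t : ℂ) * cexp (α * I) - z₀‖ := by linarith [h2.1]
    rw [norm_div, ← mul_div_assoc, div_le_iff₀ h3]
    have := mul_le_mul h2.1 (hM _ (polar_mem_sector hθ (hsub hα) ht)) (norm_nonneg _) (by positivity)
    linarith

theorem contourIntegral_div_eq_zero (hf : HolDecay θ f) (hθ : θ ∈ Ioo 0 (Real.pi / 2)) {φ : ℝ}
    (hφ : φ ∈ Ioo 0 θ) {w : ℂ} (hw : w ∈ cosector φ) :
    contourIntegral φ (fun z => f z / (z - w)) = 0 := by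
  have hw0 := ne_zero_of_mem_cosector hw
  have hs : 0 < ‖w‖ := norm_pos_iff.2 hw0
  have hpi := Real.pi_pos
  have h2 := hθ.2
  have hne : ∀ α : ℝ, α ∈ Icc (-φ) φ ∨ α - Real.pi ∈ Icc (-φ) φ →
      cexp (α * I) ≠ cexp (w.arg * I) := by
    -- A point of `cosector φ` lies in `cosector φ'` for some `φ' > φ`, whereas the directions
    -- considered lie in the double sector of angle `φ'`.
    intro α hα heq
    rw [← Complex.norm_mul_exp_arg_mul_I w, ← heq, polar_mem_cosector_iff hs] at hw
    have key : ∀ φ' ∈ Ioo φ (Real.pi / 2), |Real.sin α| * Real.cos φ' < |Real.cos α| * Real.sin φ' := by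
      intro φ' hφ'
      refine abs_sin_mul_cos_lt ⟨hφ.1.trans hφ'.1, hφ'.2⟩ ?_
      rcases hα with h | h
      · exact Or.inl ⟨by linarith [h.1, hφ'.1], by linarith [h.2, hφ'.1]⟩
      · exact Or.inr ⟨by linarith [h.1, hφ'.1], by linarith [h.2, hφ'.1]⟩
    obtain ⟨φ', hφ', hmem⟩ := exists_mem_cosector_gt ⟨hφ.1, hφ.2.trans hθ.2⟩
      ((polar_mem_cosector_iff hs).2 hw)
    rw [polar_mem_cosector_iff hs] at hmem
    exact lt_asymm hmem (key φ' hφ')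
  rw [contourIntegral_def', ← Complex.norm_mul_exp_arg_mul_I w]
  rw [hf.rayIntegral_div_eq hθ (a := -φ) (b := φ) (by linarith [hφ.1]) ?_ hs ?_,
    hf.rayIntegral_div_eq hθ (a := Real.pi - φ) (b := Real.pi + φ) (by linarith [hφ.1]) ?_ hs ?_,
    sub_self, sub_self, add_zero]
  · exact fun α hα => Or.inr ⟨by linarith [hα.1, hφ.2], by linarith [hα.2, hφ.2]⟩
  · exact fun α hα => hne α (Or.inr ⟨by linarith [hα.1], by linarith [hα.2]⟩)
  · exact fun α hα => Or.inl ⟨by linarith [hα.1, hφ.2], by linarith [hα.2, hφ.2]⟩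
  · exact fun α hα => hne α (Or.inl hα)

/-- Cauchy's integral formula for the double sector. -/
theorem contourIntegral_div (hf : HolDecay θ f) (hθ : θ ∈ Ioo 0 (Real.pi / 2)) {φ : ℝ}
    (hφ : φ ∈ Ioo 0 θ) {s α₀ : ℝ} (hs : 0 < s) (hα₀ : α₀ ∈ angles φ) :
    contourIntegral φ (fun z => f z / (z - s * cexp (α₀ * I))) =
      2 * Real.pi * I * f (s * cexp (α₀ * I)) := by
  have hpi := Real.pi_pos
  have h1 := hφ.1
  have h2 := hφ.2
  have h3 := hθ.2
  obtain ⟨M, hM⟩ := hf.bounded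
  have hsubr : Icc (-φ) φ ⊆ angles θ := fun α hα => Or.inl ⟨by linarith [hα.1], by linarith [hα.2]⟩
  have hsubl : Icc (Real.pi - φ) (Real.pi + φ) ⊆ angles θ :=
    fun α hα => Or.inr ⟨by linarith [hα.1], by linarith [hα.2]⟩
  have hcauchy : ∀ a b : ℝ, Icc a b ⊆ angles θ → a < α₀ → α₀ < b → b < a + Real.pi →
      rayIntegral (fun z => f z / (z - s * cexp (α₀ * I))) (cexp (a * I)) -
        rayIntegral (fun z => f z / (z - s * cexp (α₀ * I))) (cexp (b * I)) =
        2 * Real.pi * I * f (s * cexp (α₀ * I)) := by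
    intro a b hsub ha hb hab
    refine rayIntegral_sub_eq_of_mem_sector (R := 1) (B := M) hs ha hb hab one_pos (isOpen_sector θ)
      (fun α hα t ht => polar_mem_sector hθ (hsub hα) ht) hf.differentiableOn
      (fun α hα t ht _ => hM _ (polar_mem_sector hθ (hsub hα) ht)) ?_ ?_
    · exact hf.rayIntegrable_div hθ (hsub ⟨le_rfl, by linarith⟩) hs
        (exp_mul_I_ne_of_lt ha (by linarith))
    · exact hf.rayIntegrable_div hθ (hsub ⟨by linarith, le_rfl⟩) hs
        (exp_mul_I_ne_of_lt hb (by linarith)).symm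
  rw [contourIntegral_def']
  -- Cauchy's formula applies to the half containing the point; the two rays of the other half
  -- cancel after a rotation.
  rcases hα₀ with h | h
  · rw [hcauchy (-φ) φ hsubr h.1 h.2 (by linarith),
      hf.rayIntegral_div_eq hθ (a := Real.pi - φ) (b := Real.pi + φ) (by linarith) hsubl hs,
      sub_self, add_zero]
    intro α hα
    exact (exp_mul_I_ne_of_lt (by linarith [h.2, hα.1]) (by linarith [h.1, hα.2])).symm
  · rw [hcauchy (Real.pi - φ) (Real.pi + φ) hsubl h.1 h.2 (by linarith),
      hf.rayIntegral_div_eq hθ (a := -φ) (b := φ) (by linarith) hsubr hs,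
      sub_self, zero_add]
    intro α hα
    exact exp_mul_I_ne_of_lt (by linarith [h.1, hα.2]) (by linarith [h.2, hα.1])

end HolDecay

end BisectorialCalculus

end

noncomputable section

namespace BisectorialCalculus

open Complex

/-! ### The functions `(1 + z²)⁻¹` and `z (1 + z²)⁻¹` -/

/-- Factor `1 + z²` as `(z - i)(z + i)`. Each factor has squared modulus `1 + |z|² ∓ 2 Im z`, and in
the sector `|Im z| ≤ sin θ |z|`, so `2 |Im z| ≤ sin θ (1 + |z|²)`. -/
theorem le_norm_one_add_sq {θ : ℝ} (hθ : θ ∈ Ioo 0 (Real.pi / 2)) {z : ℂ} (hz : z ∈ sector θ) :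
    (1 - Real.sin θ) * (1 + ‖z‖ ^ 2) ≤ ‖1 + z ^ 2‖ := by
  have hs : 0 < Real.sin θ := Real.sin_pos_of_pos_of_lt_pi hθ.1 (by linarith [hθ.2, Real.pi_pos])
  have hs1 : Real.sin θ ≤ 1 := Real.sin_le_one θ
  have hn : ‖z‖ ^ 2 = z.re ^ 2 + z.im ^ 2 := by rw [Complex.sq_norm, Complex.normSq_apply]; ring
  have hz' : |z.im| * Real.cos θ ≤ |z.re| * Real.sin θ := le_of_lt hz
  have hcos : 0 < Real.cos θ := Real.cos_pos_of_mem_Ioo ⟨by linarith [hθ.1, hθ.2], hθ.2⟩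
  have h1 : |z.im| ≤ Real.sin θ * ‖z‖ := by
    refine (sq_le_sq₀ (abs_nonneg _) (by positivity)).1 ?_
    have h2 := mul_self_le_mul_self (by positivity) hz'
    rw [mul_pow, hn, sq_abs]
    have h3 : |z.im| * |z.im| = z.im ^ 2 := by rw [← sq_abs z.im]; ring
    have h4 : |z.re| * |z.re| = z.re ^ 2 := by rw [← sq_abs z.re]; ring
    nlinarith [Real.sin_sq_add_cos_sq θ]
  have h2 : 2 * |z.im| ≤ Real.sin θ * (1 + ‖z‖ ^ 2) := by
    nlinarith [sq_nonneg (‖z‖ - 1)]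
  have h3 := abs_le.1 (le_refl |z.im|)
  have hA : 0 ≤ (1 - Real.sin θ) * (1 + ‖z‖ ^ 2) := mul_nonneg (by linarith) (by positivity)
  have e1 : (1 - Real.sin θ) * (1 + ‖z‖ ^ 2) ≤ ‖z - I‖ ^ 2 := by
    have : ‖z - I‖ ^ 2 = ‖z‖ ^ 2 + 1 - 2 * z.im := by
      rw [hn, Complex.sq_norm, Complex.normSq_apply]; simp; ring
    rw [this]; linarith [h3.2]
  have e2 : (1 - Real.sin θ) * (1 + ‖z‖ ^ 2) ≤ ‖z + I‖ ^ 2 := by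
    have : ‖z + I‖ ^ 2 = ‖z‖ ^ 2 + 1 + 2 * z.im := by
      rw [hn, Complex.sq_norm, Complex.normSq_apply]; simp; ring
    rw [this]; linarith [h3.1]
  have h4 : (1 : ℂ) + z ^ 2 = (z - I) * (z + I) := by linear_combination I_sq
  rw [h4, norm_mul]
  refine (sq_le_sq₀ hA (by positivity)).1 ?_
  rw [mul_pow ‖z - I‖, sq (_ * _)]
  exact mul_le_mul e1 e2 hA (by positivity)

theorem one_sub_sin_pos {θ : ℝ} (hθ : θ ∈ Ioo 0 (Real.pi / 2)) : 0 < 1 - Real.sin θ := by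
  have := Real.sin_lt_sin_of_lt_of_le_pi_div_two (by linarith [hθ.1, Real.pi_pos]) le_rfl hθ.2
  rw [Real.sin_pi_div_two] at this
  linarith

theorem one_add_sq_ne_zero {θ : ℝ} (hθ : θ ∈ Ioo 0 (Real.pi / 2)) {z : ℂ} (hz : z ∈ sector θ) :
    1 + z ^ 2 ≠ 0 := by
  rw [← norm_pos_iff]
  exact lt_of_lt_of_le (mul_pos (one_sub_sin_pos hθ) (by positivity)) (le_norm_one_add_sq hθ hz)

theorem differentiableOn_inv_one_add_sq {θ : ℝ} (hθ : θ ∈ Ioo 0 (Real.pi / 2)) :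
    DifferentiableOn ℂ (fun z : ℂ => (1 + z ^ 2)⁻¹) (sector θ) :=
  DifferentiableOn.inv (by fun_prop) fun _ hz => one_add_sq_ne_zero hθ hz

theorem norm_inv_one_add_sq_le {θ : ℝ} (hθ : θ ∈ Ioo 0 (Real.pi / 2)) {z : ℂ}
    (hz : z ∈ sector θ) : ‖(1 + z ^ 2)⁻¹‖ ≤ (1 - Real.sin θ)⁻¹ * (1 + ‖z‖ ^ 2)⁻¹ := by
  rw [norm_inv, ← mul_inv]
  exact inv_anti₀ (mul_pos (one_sub_sin_pos hθ) (by positivity)) (le_norm_one_add_sq hθ hz)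

theorem exists_norm_inv_one_add_sq_le {θ : ℝ} (hθ : θ ∈ Ioo 0 (Real.pi / 2)) :
    ∃ M : ℝ, ∀ z ∈ sector θ, ‖(1 + z ^ 2)⁻¹‖ ≤ M := by
  refine ⟨(1 - Real.sin θ)⁻¹, fun z hz => (norm_inv_one_add_sq_le hθ hz).trans ?_⟩
  refine mul_le_of_le_one_right (inv_nonneg.2 (one_sub_sin_pos hθ).le) ?_
  exact inv_le_one_of_one_le₀ (by nlinarith [sq_nonneg ‖z‖])

/-- The function `(1 + z²)⁻¹` is not `dt/t`-integrable at `0`; the factor `z` cancels the `1/t`,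
leaving a multiple of `(1 + t²)⁻¹` as a bound. -/
theorem holDecay_mul_inv_one_add_sq {θ : ℝ} (hθ : θ ∈ Ioo 0 (Real.pi / 2)) :
    HolDecay θ (fun z : ℂ => z * (1 + z ^ 2)⁻¹) := by
  have hd : DifferentiableOn ℂ (fun z : ℂ => z * (1 + z ^ 2)⁻¹) (sector θ) :=
    differentiableOn_id.mul (differentiableOn_inv_one_add_sq hθ)
  have hp := inv_nonneg.2 (one_sub_sin_pos hθ).le
  refine ⟨hd, ⟨(1 - Real.sin θ)⁻¹, fun z hz => ?_⟩, fun α hα => ?_⟩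
  · rw [norm_mul]
    calc ‖z‖ * ‖(1 + z ^ 2)⁻¹‖ ≤ ‖z‖ * ((1 - Real.sin θ)⁻¹ * (1 + ‖z‖ ^ 2)⁻¹) :=
          mul_le_mul_of_nonneg_left (norm_inv_one_add_sq_le hθ hz) (norm_nonneg z)
      _ = (1 - Real.sin θ)⁻¹ * (‖z‖ * (1 + ‖z‖ ^ 2)⁻¹) := by ring
      _ ≤ (1 - Real.sin θ)⁻¹ * 1 := by
          refine mul_le_mul_of_nonneg_left ?_ hp
          rw [← div_eq_mul_inv, div_le_one (by positivity)]
          nlinarith [sq_nonneg (‖z‖ - 1)]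
      _ = _ := mul_one _
  · refine Integrable.mono' (integrable_inv_one_add_sq.integrableOn.const_mul
      (1 - Real.sin θ)⁻¹) ?_ ?_
    · refine ContinuousOn.aestronglyMeasurable ?_ measurableSet_Ioi
      exact (HolDecay.continuousOn_ray hd hθ hα).norm.div continuousOn_id fun t ht => ne_of_gt ht
    · refine (ae_restrict_iff' measurableSet_Ioi).2 (Filter.Eventually.of_forall fun t ht => ?_)
      have ht0 : 0 < t := ht
      have h1 := norm_inv_one_add_sq_le hθ (polar_mem_sector hθ hα ht0)
      rw [norm_mul_exp_mul_I ht0.le] at h1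
      rw [norm_div, norm_norm, Real.norm_of_nonneg ht0.le, norm_mul, norm_mul_exp_mul_I ht0.le,
        mul_div_cancel_left₀ _ ht0.ne']
      exact h1

/-! ### Contour integrals against scalar resolvents -/

/-- Holomorphic functions outside the double sector of angle `ω` that behave like resolvents. -/
structure ScalarResolvent (ω : ℝ) (r : ℂ → ℂ) : Prop where
  differentiableOn : DifferentiableOn ℂ r (cosector ω)
  bound : ∀ ψ ∈ Ioo ω (Real.pi / 2), ∃ C : ℝ, ∀ z ∈ cosector ψ, ‖z‖ * ‖r z‖ ≤ C

theorem exists_contourAngle_eq {φ φ' α : ℝ} {k : Fin 4}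
    (hα : α ∈ uIcc (contourAngle φ k) (contourAngle φ' k)) :
    ∃ ψ ∈ uIcc φ φ', α = contourAngle ψ k := by
  simp only [mem_uIcc] at *
  fin_cases k
  · refine ⟨-α, ?_, by simp [contourAngle]⟩
    simp [contourAngle] at hα
    rcases hα with h | h
    · right; constructor <;> linarith [h.1, h.2]
    · left; constructor <;> linarith [h.1, h.2]
  · exact ⟨α, by simpa [contourAngle] using hα, by simp [contourAngle]⟩
  · refine ⟨Real.pi - α, ?_, by simp [contourAngle]⟩
    simp [contourAngle] at hα
    rcases hα with h | h
    · right; constructor <;> linarith [h.1, h.2]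
    · left; constructor <;> linarith [h.1, h.2]
  · refine ⟨α - Real.pi, ?_, by simp [contourAngle]⟩
    simp [contourAngle] at hα
    rcases hα with h | h
    · left; constructor <;> linarith [h.1, h.2]
    · right; constructor <;> linarith [h.1, h.2]

namespace ScalarResolvent

variable {ω θ φ φ' : ℝ} {r f g : ℂ → ℂ}

theorem continuousOn_ray (hr : ScalarResolvent ω r) (hω : 0 < ω) (h1 : ω < φ)
    (h2 : φ < Real.pi / 2) (k : Fin 4) :
    ContinuousOn (fun t : ℝ => r (t * contourDir φ k)) (Ioi 0) :=
  hr.differentiableOn.continuousOn.comp (by fun_prop)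
    fun _ ht => contour_mem_cosector hω h1 h2 ht k

theorem exists_bound (hr : ScalarResolvent ω r) (hω : 0 < ω) (h1 : ω < φ)
    (h2 : φ < Real.pi / 2) :
    ∃ C : ℝ, ∀ ψ : ℝ, φ ≤ ψ → ψ < Real.pi / 2 → ∀ k : Fin 4, ∀ t : ℝ, 0 < t →
      t * ‖r (t * contourDir ψ k)‖ ≤ C := by
  -- The midpoint lies strictly between `ω` and every `ψ ≥ φ`, so one constant serves all contours
  -- of angle at least `φ`.
  obtain ⟨C, hC⟩ := hr.bound ((ω + φ) / 2) ⟨by linarith, by linarith⟩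
  refine ⟨C, fun ψ h3 h4 k t ht => ?_⟩
  have := hC _ (contour_mem_cosector (t := t) (φ := ψ) (by linarith) (by linarith) h4 ht k)
  rwa [norm_mul, norm_contourDir, mul_one, Complex.norm_real, Real.norm_of_nonneg ht.le] at this

theorem rayIntegrable_mul (hr : ScalarResolvent ω r) (hf : HolDecay θ f) (hω : 0 < ω)
    (hθ : θ < Real.pi / 2) (hφ : φ ∈ Ioo ω θ) (k : Fin 4) :
    RayIntegrable (fun z => f z * r z) (contourDir φ k) := by
  obtain ⟨C, hC⟩ := hr.exists_bound hω hφ.1 (hφ.2.trans hθ)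
  exact hf.rayIntegrable_mul ⟨by linarith [hφ.1, hφ.2], hθ⟩
    (contourAngle_mem_angles (hω.trans hφ.1) hφ.2 k)
    (hr.continuousOn_ray hω hφ.1 (hφ.2.trans hθ) k) (hC φ le_rfl (hφ.2.trans hθ) k)

/-- The contour integrals do not depend on the angle. -/
theorem contourIntegral_mul_eq (hr : ScalarResolvent ω r) (hf : HolDecay θ f) (hω : 0 < ω)
    (hθ : θ < Real.pi / 2) (hφ : φ ∈ Ioo ω θ) (hφ' : φ' ∈ Ioo ω θ) :
    contourIntegral φ (fun z => f z * r z) = contourIntegral φ' (fun z => f z * r z) := by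
  obtain ⟨M, hM⟩ := hf.bounded
  have hmin : min φ φ' ∈ Ioo ω θ := ⟨lt_min hφ.1 hφ'.1, min_lt_of_left_lt hφ.2⟩
  obtain ⟨C, hC⟩ := hr.exists_bound hω hmin.1 (hmin.2.trans hθ)
  unfold contourIntegral
  refine Finset.sum_congr rfl fun k _ => ?_
  congr 1
  have hmem : ∀ ψ ∈ uIcc φ φ', ψ ∈ Ioo ω θ := fun ψ hψ =>
    ⟨lt_of_lt_of_le hmin.1 hψ.1, lt_of_le_of_lt hψ.2 (max_lt hφ.2 hφ'.2)⟩
  refine rayIntegral_eq_of_sector (U := sector θ ∩ cosector ω) (R := 1) (B := M * C) one_pos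
    ((isOpen_sector θ).inter (isOpen_cosector ω)) ?_
    ((hf.differentiableOn.mono inter_subset_left).mul
      (hr.differentiableOn.mono inter_subset_right)) ?_
    (hr.rayIntegrable_mul hf hω hθ hφ k) (hr.rayIntegrable_mul hf hω hθ hφ' k)
  · intro α hα t ht
    obtain ⟨ψ, hψ, rfl⟩ := exists_contourAngle_eq hα
    have h := hmem ψ hψ
    exact ⟨contour_mem_sector (hω.trans h.1) h.2 hθ ht k,
      contour_mem_cosector hω h.1 (h.2.trans hθ) ht k⟩
  · intro α hα t ht _
    obtain ⟨ψ, hψ, rfl⟩ := exists_contourAngle_eq hα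
    have h := hmem ψ hψ
    have h1 := hM _ (contour_mem_sector (hω.trans h.1) h.2 hθ ht k)
    have h2 := hC ψ hψ.1 (h.2.trans hθ) k t ht
    rw [norm_mul, mul_left_comm]
    exact mul_le_mul h1 h2 (by positivity) ((norm_nonneg _).trans h1)

/-- As `r` is holomorphic outside the double sector, the four rays are regrouped as the boundaries
of the two complementary sectors, around `i` and `-i`. Their residues are `r i / 2` and `r (-i) /
2`, and the orientation is reversed. The bound on `z r(z)` is exactly what Cauchy's formula for a
sector asks for. -/
theorem contourIntegral_mul_inv_one_add_sq (hr : ScalarResolvent ω r) (hω : 0 < ω)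
    (h1 : ω < φ) (h2 : φ < Real.pi / 2) :
    contourIntegral φ (fun z => z * (1 + z ^ 2)⁻¹ * r z) = -(Real.pi * I) * (r I + r (-I)) := by
  have hpi := Real.pi_pos
  have hθ : (φ + Real.pi / 2) / 2 < Real.pi / 2 := by linarith
  have hφ : φ ∈ Ioo ω ((φ + Real.pi / 2) / 2) := ⟨h1, by linarith⟩
  have hω' : ω ∈ Ioo 0 (Real.pi / 2) := ⟨hω, h1.trans h2⟩
  have hint := hr.rayIntegrable_mul (holDecay_mul_inv_one_add_sq (by constructor <;> linarith))
    hω hθ hφ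
  obtain ⟨C, hC⟩ := hr.bound ((ω + φ) / 2) ⟨by linarith, by linarith⟩
  have hfac : ∀ z : ℂ, z * (1 + z ^ 2)⁻¹ * r z = z * r z / (z + I) / (z - I) := by
    intro z
    rw [div_div, show (z + I) * (z - I) = 1 + z ^ 2 by linear_combination -I_sq, div_eq_mul_inv]
    ring
  have hfac' : ∀ z : ℂ, z * (1 + z ^ 2)⁻¹ * r z = z * r z / (z - I) / (z - -I) := by
    intro z
    rw [div_div, show (z - I) * (z - -I) = 1 + z ^ 2 by linear_combination -I_sq, div_eq_mul_inv]
    ring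
  have hI : ((1 : ℝ) : ℂ) * cexp ((Real.pi / 2 : ℝ) * I) = I := by
    push_cast
    rw [Complex.exp_pi_div_two_mul_I, one_mul]
  have hI' : ((1 : ℝ) : ℂ) * cexp ((-(Real.pi / 2) : ℝ) * I) = -I := by
    push_cast
    rw [neg_mul, Complex.exp_neg, Complex.exp_pi_div_two_mul_I, one_mul, Complex.inv_I]
  have hup : ∀ α ∈ Icc φ (Real.pi - φ), ∀ t : ℝ, 0 < t →
      (t : ℂ) * cexp (α * I) ∈ cosector ((ω + φ) / 2) ∧ 0 < ((t : ℂ) * cexp (α * I)).im := by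
    intro α hα t ht
    refine ⟨polar_mem_cosector ⟨by linarith, by linarith⟩
      (Or.inl ⟨by linarith [hα.1], by linarith [hα.2]⟩) ht, ?_⟩
    rw [im_ofReal_mul, exp_ofReal_mul_I_im]
    exact mul_pos ht (Real.sin_pos_of_pos_of_lt_pi (by linarith [hα.1]) (by linarith [hα.2]))
  have hlow : ∀ α ∈ Icc (φ - Real.pi) (-φ), ∀ t : ℝ, 0 < t →
      (t : ℂ) * cexp (α * I) ∈ cosector ((ω + φ) / 2) ∧ ((t : ℂ) * cexp (α * I)).im < 0 := by
    intro α hα t ht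
    refine ⟨polar_mem_cosector ⟨by linarith, by linarith⟩
      (Or.inr (Or.inl ⟨by linarith [hα.1], by linarith [hα.2]⟩)) ht, ?_⟩
    rw [im_ofReal_mul, exp_ofReal_mul_I_im]
    exact mul_neg_of_pos_of_neg ht
      (Real.sin_neg_of_neg_of_neg_pi_lt (by linarith [hα.2]) (by linarith [hα.1]))
  have hcos : cosector ((ω + φ) / 2) ⊆ cosector ω := cosector_anti hω (by linarith) (by linarith)
  have i0 := hint 0
  have i1 := hint 1
  have i2 := hint 2
  have i3 := hint 3
  simp only [contourDir, contourAngle, Matrix.cons_val_zero, Matrix.cons_val_one,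
    Matrix.cons_val] at i0 i1 i2 i3
  -- Renaming the fourth ray makes the lower complementary sector the interval of angles from `φ -
  -- π` to `-φ`.
  have e3 : cexp ((Real.pi + φ : ℝ) * I) = cexp ((φ - Real.pi : ℝ) * I) := by
    rw [exp_sub_pi, add_comm]
  rw [e3] at i3
  have upper := rayIntegral_sub_eq_of_mem_sector (f := fun z => z * r z / (z + I))
    (a := φ) (b := Real.pi - φ) (α₀ := Real.pi / 2) (s := 1) (R := 1) (B := C)
    (U := cosector ω ∩ {z | 0 < z.im}) one_pos h2 (by linarith) (by linarith) one_pos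
    ((isOpen_cosector ω).inter (isOpen_lt (by fun_prop) (by fun_prop)))
    (fun α hα t ht => ⟨hcos (hup α hα t ht).1, (hup α hα t ht).2⟩)
    (by
      refine DifferentiableOn.div (differentiableOn_id.mul
        (hr.differentiableOn.mono inter_subset_left)) (by fun_prop) fun z hz h => ?_
      have h3 : 0 < z.im := hz.2
      have h4 := congrArg Complex.im h
      simp at h4
      linarith)
    (by
      intro α hα t ht _
      have h3 := hC _ (hup α hα t ht).1
      have h4 := (hup α hα t ht).2
      have h5 : 1 ≤ ‖(t : ℂ) * cexp (α * I) + I‖ := by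
        refine le_trans ?_ ((le_abs_self _).trans (Complex.abs_im_le_norm _))
        rw [add_im, I_im]; linarith
      rw [norm_div, norm_mul (_ * _) (r _)]
      exact (div_le_self (by positivity) h5).trans h3)
    (by simp only [hI, ← hfac]; exact i1)
    (by simp only [hI, ← hfac]; exact i2)
  have lower := rayIntegral_sub_eq_of_mem_sector (f := fun z => z * r z / (z - I))
    (a := φ - Real.pi) (b := -φ) (α₀ := -(Real.pi / 2)) (s := 1) (R := 1) (B := C)
    (U := cosector ω ∩ {z | z.im < 0}) one_pos (by linarith) (by linarith) (by linarith) one_pos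
    ((isOpen_cosector ω).inter (isOpen_lt (by fun_prop) (by fun_prop)))
    (fun α hα t ht => ⟨hcos (hlow α hα t ht).1, (hlow α hα t ht).2⟩)
    (by
      refine DifferentiableOn.div (differentiableOn_id.mul
        (hr.differentiableOn.mono inter_subset_left)) (by fun_prop) fun z hz h => ?_
      have h3 : z.im < 0 := hz.2
      have h4 := congrArg Complex.im h
      simp at h4
      linarith)
    (by
      intro α hα t ht _
      have h3 := hC _ (hlow α hα t ht).1
      have h4 := (hlow α hα t ht).2
      have h5 : 1 ≤ ‖(t : ℂ) * cexp (α * I) - I‖ := by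
        refine le_trans ?_ ((neg_le_abs _).trans (Complex.abs_im_le_norm _))
        rw [sub_im, I_im]; linarith
      rw [norm_div, norm_mul (_ * _) (r _)]
      exact (div_le_self (by positivity) h5).trans h3)
    (by simp only [hI', ← hfac']; exact i3)
    (by simp only [hI', ← hfac']; exact i0)
  simp only [hI, ← hfac] at upper
  simp only [hI', ← hfac'] at lower
  rw [contourIntegral_def', e3]
  have hu : I * r I / (I + I) = r I / 2 := by field_simp; ring
  have hl : -I * r (-I) / (-I - I) = r (-I) / 2 := by
    rw [show -I - I = 2 * -I by ring, mul_comm (2 : ℂ), mul_div_mul_left _ _ (neg_ne_zero.2 I_ne_zero)]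
  rw [hu] at upper
  rw [hl] at lower
  linear_combination -upper - lower

end ScalarResolvent

end BisectorialCalculus

end

/-! ### Resolvent identity and Fubini under contour integrals. -/

noncomputable section

namespace BisectorialCalculus

open Complex

theorem not_mem_cosector_of_mem_sector {ψ : ℝ} {z : ℂ} (hz : z ∈ sector ψ) : z ∉ cosector ψ :=
  fun h => lt_asymm (show |z.im| * Real.cos ψ < |z.re| * Real.sin ψ from hz) h

theorem contourDir_ne_contourDir {φ φ' : ℝ} (h0 : 0 < φ) (h : φ < φ') (h' : φ' < Real.pi / 2)
    (k l : Fin 4) : contourDir φ k ≠ contourDir φ' l := by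
  intro heq
  have h1 := contour_mem_sector (t := 1) h0 (show φ < (φ + φ') / 2 by linarith) (by linarith)
    one_pos k
  have h2 := contour_mem_cosector (t := 1) (ω := (φ + φ') / 2) (by linarith) (by linarith) h'
    one_pos l
  rw [← heq] at h2
  exact not_mem_cosector_of_mem_sector h1 h2

theorem contourDir_ne_of_mem_cosector {φ : ℝ} (hφ : φ ∈ Ioo 0 (Real.pi / 2)) {w : ℂ}
    (hw : w ∈ cosector φ) (k : Fin 4) : contourDir φ k ≠ cexp (w.arg * I) := by
  intro heq
  obtain ⟨ψ, hψ, hmem⟩ := exists_mem_cosector_gt hφ hw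
  have h1 := contour_mem_sector hφ.1 hψ.1 hψ.2 (norm_pos_iff.2 (ne_zero_of_mem_cosector hw)) k
  rw [heq, Complex.norm_mul_exp_arg_mul_I] at h1
  exact not_mem_cosector_of_mem_sector h1 hmem

theorem contourIntegral_congr {φ : ℝ} {h h' : ℂ → ℂ}
    (he : ∀ k, ∀ t : ℝ, 0 < t → h (t * contourDir φ k) = h' (t * contourDir φ k)) :
    contourIntegral φ h = contourIntegral φ h' := by
  unfold contourIntegral rayIntegral
  refine Finset.sum_congr rfl fun k _ => ?_
  rw [setIntegral_congr_fun measurableSet_Ioi fun t ht => he k t ht]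

theorem contourIntegral_sub {φ : ℝ} {h h' : ℂ → ℂ} (i : ∀ k, RayIntegrable h (contourDir φ k))
    (i' : ∀ k, RayIntegrable h' (contourDir φ k)) :
    contourIntegral φ (fun z => h z - h' z) = contourIntegral φ h - contourIntegral φ h' := by
  simp only [contourIntegral, rayIntegral_sub (i _) (i' _), mul_sub, Finset.sum_sub_distrib]

theorem contourIntegral_const_mul (φ : ℝ) (c : ℂ) (h : ℂ → ℂ) :
    contourIntegral φ (fun z => c * h z) = c * contourIntegral φ h := by
  simp only [contourIntegral, rayIntegral_const_mul, Finset.mul_sum]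
  exact Finset.sum_congr rfl fun k _ => by ring

theorem RayIntegrable.const_mul {h : ℂ → ℂ} {d : ℂ} (i : RayIntegrable h d) (c : ℂ) :
    RayIntegrable (fun z => c * h z) d :=
  Integrable.const_mul i c

theorem rayIntegral_sum {ι : Type*} (s : Finset ι) {h : ι → ℂ → ℂ} {d : ℂ}
    (i : ∀ k ∈ s, RayIntegrable (h k) d) :
    rayIntegral (fun z => ∑ k ∈ s, h k z) d = ∑ k ∈ s, rayIntegral (h k) d := by
  simp only [rayIntegral]
  rw [integral_finsetSum s i, Finset.mul_sum]

namespace ScalarResolvent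

variable {ω θ φ φ' : ℝ} {r f g : ℂ → ℂ}

/-- Dividing by `μ - z` splits `f q` into `f / (μ - z) * r` and a multiple of `f / (μ - z)`. The
second part integrates to zero, because `μ` lies outside the contour. In the application `q z` is a
functional evaluated on a product of resolvents at `z` and `μ`. -/
theorem contourIntegral_resolvent (hr : ScalarResolvent ω r) (hf : HolDecay θ f) (hω : 0 < ω)
    (hθ : θ < Real.pi / 2) (hφ : φ ∈ Ioo ω θ) {μ : ℂ} (hμ : μ ∈ cosector φ)
    (hfμ : HolDecay θ fun z => f z / (μ - z)) {q : ℂ → ℂ}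
    (hq : ∀ z ∈ cosector ω, (μ - z) * q z = r z - r μ) :
    contourIntegral φ (fun z => f z * q z) = contourIntegral φ (fun z => f z / (μ - z) * r z) := by
  have h0 : 0 < φ := hω.trans hφ.1
  have hθ' : θ ∈ Ioo 0 (Real.pi / 2) := ⟨h0.trans hφ.2, hθ⟩
  have hφ' : φ ∈ Ioo 0 (Real.pi / 2) := ⟨h0, hφ.2.trans hθ⟩
  have hμ0 : 0 < ‖μ‖ := norm_pos_iff.2 (ne_zero_of_mem_cosector hμ)
  have hne : ∀ k, ∀ t : ℝ, 0 < t → μ - t * contourDir φ k ≠ 0 := by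
    intro k t ht h
    obtain ⟨ψ, hψ, hmem⟩ := exists_mem_cosector_gt hφ' hμ
    rw [sub_eq_zero.1 h] at hmem
    exact not_mem_cosector_of_mem_sector (contour_mem_sector h0 hψ.1 hψ.2 ht k) hmem
  have i1 : ∀ k, RayIntegrable (fun z => f z / (z - μ)) (contourDir φ k) := by
    intro k
    rw [← Complex.norm_mul_exp_arg_mul_I μ]
    exact hf.rayIntegrable_div hθ' (contourAngle_mem_angles h0 hφ.2 k) hμ0
      (contourDir_ne_of_mem_cosector hφ' hμ k)
  have i2 : ∀ k, RayIntegrable (fun z => -r μ * (f z / (z - μ))) (contourDir φ k) :=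
    fun k => (i1 k).const_mul _
  rw [contourIntegral_congr (h' := fun z => f z / (μ - z) * r z - -r μ * (f z / (z - μ))),
    contourIntegral_sub (fun k => hr.rayIntegrable_mul hfμ hω hθ hφ k) i2,
    contourIntegral_const_mul, hf.contourIntegral_div_eq_zero hθ' ⟨h0, hφ.2⟩ hμ, mul_zero, sub_zero]
  intro k t ht
  have h1 := hne k t ht
  have h3 : t * contourDir φ k - μ ≠ 0 := by rw [← neg_ne_zero, neg_sub]; exact h1
  have h2 := hq _ (contour_mem_cosector hω hφ.1 hφ'.2 ht k)
  have h4 : q (t * contourDir φ k) = (r (t * contourDir φ k) - r μ) / (μ - t * contourDir φ k) := by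
    rw [eq_div_iff h1, mul_comm]; exact h2
  rw [h4, ← neg_sub μ, div_neg]
  field_simp

theorem rayIntegral_swap (hr : ScalarResolvent ω r) (hf : HolDecay θ f) (hg : HolDecay θ g)
    (hω : 0 < ω) (hθ : θ < Real.pi / 2) (hφ : φ ∈ Ioo ω θ) (hφ' : φ' ∈ Ioo ω θ) (h : φ < φ')
    (k l : Fin 4) :
    RayIntegrable (fun z => g z * rayIntegral (fun w => f w * r w / (w - z)) (contourDir φ' l))
      (contourDir φ k) ∧
    RayIntegrable (fun w => f w * r w * rayIntegral (fun z => g z / (w - z)) (contourDir φ k))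
      (contourDir φ' l) ∧
    rayIntegral (fun z => g z * rayIntegral (fun w => f w * r w / (w - z)) (contourDir φ' l))
      (contourDir φ k) =
    rayIntegral (fun w => f w * r w * rayIntegral (fun z => g z / (w - z)) (contourDir φ k))
      (contourDir φ' l) := by
  set d := contourDir φ k with hd
  set d' := contourDir φ' l with hd'
  have h0 : 0 < φ := hω.trans hφ.1
  have h0' : 0 < φ' := hω.trans hφ'.1
  have hθ' : θ ∈ Ioo 0 (Real.pi / 2) := ⟨h0.trans hφ.2, hθ⟩
  obtain ⟨c, hc, hb⟩ := exists_le_norm_sub (norm_contourDir φ' l) (norm_contourDir φ k)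
    (contourDir_ne_contourDir h0 h (hφ'.2.trans hθ) k l).symm
  obtain ⟨C, hC⟩ := hr.exists_bound hω hφ'.1 (hφ'.2.trans hθ)
  have hCr := hC φ' le_rfl (hφ'.2.trans hθ) l
  have ig := hg.integrable _ (contourAngle_mem_angles h0 hφ.2 k)
  have if' := hf.integrable _ (contourAngle_mem_angles h0' hφ'.2 l)
  set ν : Measure ℝ := volume.restrict (Ioi 0) with hν
  set K : ℝ → ℝ → ℂ := fun t s => g (t * d) * (f (s * d') * r (s * d') / (s * d' - t * d)) with hK
  have hint : Integrable (Function.uncurry K) (ν.prod ν) := by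
    -- The estimates `|w - z| ≥ c |z|` and `|r(w)| ≤ C / |w|` supply exactly the weights `1/t` and
    -- `1/s`, so the kernel is dominated by a product of two integrable functions.
    refine Integrable.mono' ((ig.mul_prod if').const_mul (C / c)) ?_ ?_
    · have m1 : AEStronglyMeasurable (fun t : ℝ => g (t * d)) ν :=
        (HolDecay.continuousOn_ray hg.differentiableOn hθ'
          (contourAngle_mem_angles h0 hφ.2 k)).aestronglyMeasurable measurableSet_Ioi
      have m2 : AEStronglyMeasurable (fun t : ℝ => f (t * d') * r (t * d')) ν :=
        ((HolDecay.continuousOn_ray hf.differentiableOn hθ'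
          (contourAngle_mem_angles h0' hφ'.2 l)).mul
          (hr.continuousOn_ray hω hφ'.1 (hφ'.2.trans hθ) l)).aestronglyMeasurable measurableSet_Ioi
      have m3 : Measurable (fun p : ℝ × ℝ => ((p.2 : ℂ) * d' - p.1 * d)⁻¹) := by fun_prop
      have := m1.comp_fst (ν := ν) |>.mul ((m2.comp_snd (μ := ν)).mul m3.aestronglyMeasurable)
      exact this
    · rw [hν, Measure.prod_restrict]
      refine (ae_restrict_iff' (measurableSet_Ioi.prod measurableSet_Ioi)).2
        (Filter.Eventually.of_forall fun p hp => ?_)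
      obtain ⟨t, s⟩ := p
      have ht : 0 < t := hp.1
      have hs : 0 < s := hp.2
      have e1 : c * t ≤ ‖(s : ℂ) * d' - t * d‖ :=
        le_trans (by nlinarith [mul_pos hc hs]) (hb s t hs.le ht.le)
      have e2 : 0 < ‖(s : ℂ) * d' - t * d‖ := lt_of_lt_of_le (mul_pos hc ht) e1
      have e3 := hCr s hs
      have hC0 : 0 ≤ C := le_trans (by positivity) e3
      simp only [Function.uncurry, hK]
      rw [norm_mul, norm_div, norm_mul]
      have e4 : ‖r (s * d')‖ ≤ C / s := by rw [le_div_iff₀ hs]; linarith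
      calc ‖g (t * d)‖ * (‖f (s * d')‖ * ‖r (s * d')‖ / ‖(s : ℂ) * d' - t * d‖)
          ≤ ‖g (t * d)‖ * (‖f (s * d')‖ * (C / s) / (c * t)) := by gcongr
        _ = C / c * (‖g (t * d)‖ / t * (‖f (s * d')‖ / s)) := by field_simp
  have hint' : Integrable (Function.uncurry fun s t => K t s) (ν.prod ν) := hint.swap
  have eL : ∀ t : ℝ, g (t * d) * rayIntegral (fun w => f w * r w / (w - t * d)) d' =
      d' * ∫ s, K t s ∂ν := by
    intro t
    simp only [rayIntegral, hK]
    rw [integral_const_mul]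
    ring
  have eR : ∀ s : ℝ, f (s * d') * r (s * d') * rayIntegral (fun z => g z / (s * d' - z)) d =
      d * ∫ t, K t s ∂ν := by
    intro s
    simp only [rayIntegral]
    rw [mul_left_comm, ← integral_const_mul]
    congr 1
    refine integral_congr_ae (Filter.Eventually.of_forall fun t => ?_)
    simp only [hK]
    ring
  refine ⟨?_, ?_, ?_⟩
  · simp only [RayIntegrable, eL]
    exact hint.integral_prod_left.const_mul d'
  · simp only [RayIntegrable, eR]
    exact hint'.integral_prod_left.const_mul d
  · rw [rayIntegral, rayIntegral]
    simp only [eL, eR]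
    rw [integral_const_mul, integral_const_mul, integral_integral_swap hint]
    ring

/-- The core of multiplicativity. With `q z w = (r z - r w) / (w - z)` the double integral splits in
two. In the first part Cauchy's formula for `f` on the outer contour yields `2πi f(z)`. In the
second the order of integration is exchanged, and the integral of `g z / (w - z)` vanishes since `w`
lies outside the inner contour. -/
theorem contourIntegral_mul_contourIntegral (hr : ScalarResolvent ω r) (hf : HolDecay θ f)
    (hg : HolDecay θ g) (hω : 0 < ω) (hθ : θ < Real.pi / 2) (hφ : φ ∈ Ioo ω θ)
    (hφ' : φ' ∈ Ioo ω θ) (h : φ < φ') {q : ℂ → ℂ → ℂ}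
    (hq : ∀ z ∈ cosector ω, ∀ w ∈ cosector ω, (w - z) * q z w = r z - r w) :
    contourIntegral φ (fun z => g z * contourIntegral φ' (fun w => f w * q z w)) =
      2 * Real.pi * I * contourIntegral φ (fun z => g z * f z * r z) := by
  have h0 : 0 < φ := hω.trans hφ.1
  have h0' : 0 < φ' := hω.trans hφ'.1
  have hθ' : θ ∈ Ioo 0 (Real.pi / 2) := ⟨h0.trans hφ.2, hθ⟩
  have hlt : φ < Real.pi / 2 := hφ.2.trans hθ
  have hlt' : φ' < Real.pi / 2 := hφ'.2.trans hθ
  have hgf : HolDecay θ (fun z => g z * f z) := hf.mul_bounded hθ' hg.differentiableOn hg.bounded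
  obtain ⟨C, hC⟩ := hr.exists_bound hω hφ'.1 hlt'
  set c : ℂ → ℂ := fun z => contourIntegral φ' (fun w => f w * r w / (w - z)) with hc
  have hinner : ∀ k, ∀ t : ℝ, 0 < t →
      contourIntegral φ' (fun w => f w * q (t * contourDir φ k) w) =
        r (t * contourDir φ k) * (2 * Real.pi * I * f (t * contourDir φ k)) -
          c (t * contourDir φ k) := by
    intro k t ht
    set z : ℂ := t * contourDir φ k with hz
    have hzc : z ∈ cosector ω := contour_mem_cosector hω hφ.1 hlt ht k
    have hge : ∀ l, ∃ b : ℝ, 0 < b ∧ ∀ s : ℝ, 0 < s → b ≤ ‖(s : ℂ) * contourDir φ' l - z‖ := by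
      intro l
      obtain ⟨b, hb, hb'⟩ := exists_le_norm_sub (norm_contourDir φ' l) (norm_contourDir φ k)
        (contourDir_ne_contourDir h0 h hlt' k l).symm
      exact ⟨b * t, mul_pos hb ht, fun s hs =>
        le_trans (by nlinarith [mul_pos hb hs]) (hb' s t hs.le ht.le)⟩
    have i1 : ∀ l, RayIntegrable (fun w => r z * (f w / (w - z))) (contourDir φ' l) := fun l =>
      (hf.rayIntegrable_div hθ' (contourAngle_mem_angles h0' hφ'.2 l) ht
        (contourDir_ne_contourDir h0 h hlt' k l).symm).const_mul _
    have i2 : ∀ l, RayIntegrable (fun w => f w * r w / (w - z)) (contourDir φ' l) := by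
      intro l
      obtain ⟨b, hb, hb'⟩ := hge l
      simp only [mul_div_assoc]
      refine hf.rayIntegrable_mul (C := C / b) hθ' (contourAngle_mem_angles h0' hφ'.2 l) ?_ ?_
      · refine (hr.continuousOn_ray hω hφ'.1 hlt' l).div (by fun_prop) fun s hs => ?_
        rw [← norm_pos_iff]
        exact lt_of_lt_of_le hb (hb' s hs)
      · intro s hs
        have e1 : s * ‖r (s * contourDir φ' l)‖ ≤ C := hC φ' le_rfl hlt' l s hs
        rw [norm_div, ← mul_div_assoc]
        exact div_le_div₀ (le_trans (by positivity) e1) e1 hb (hb' s hs)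
    rw [contourIntegral_congr (h' := fun w => r z * (f w / (w - z)) - f w * r w / (w - z)),
      contourIntegral_sub i1 i2, contourIntegral_const_mul,
      show z = t * cexp (contourAngle φ k * I) from rfl,
      hf.contourIntegral_div hθ' ⟨h0', hφ'.2⟩ ht (contourAngle_mem_angles h0 h k)]
    intro l s hs
    obtain ⟨b, hb, hb'⟩ := hge l
    have h1 : (s : ℂ) * contourDir φ' l - z ≠ 0 := by
      rw [← norm_pos_iff]
      exact lt_of_lt_of_le hb (hb' s hs)
    have h2 := hq z hzc _ (contour_mem_cosector hω hφ'.1 hlt' hs l)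
    have h4 : q z (s * contourDir φ' l) =
        (r z - r (s * contourDir φ' l)) / (s * contourDir φ' l - z) := by
      rw [eq_div_iff h1, mul_comm]; exact h2
    rw [h4]
    field_simp
  have hswap := fun k l => hr.rayIntegral_swap hf hg hω hθ hφ hφ' h k l
  have hgc : ∀ z, g z * c z = ∑ l, contourSign l *
      (g z * rayIntegral (fun w => f w * r w / (w - z)) (contourDir φ' l)) := by
    intro z
    simp only [hc, contourIntegral, Finset.mul_sum]
    exact Finset.sum_congr rfl fun l _ => by ring
  have igc' : ∀ k, ∀ l ∈ Finset.univ, RayIntegrable (fun z => contourSign l *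
      (g z * rayIntegral (fun w => f w * r w / (w - z)) (contourDir φ' l))) (contourDir φ k) :=
    fun k l _ => (hswap k l).1.const_mul _
  have igc : ∀ k, RayIntegrable (fun z => g z * c z) (contourDir φ k) := by
    intro k
    simp only [hgc]
    exact integrable_finsetSum _ (igc' k)
  -- The exchange is made separately for each of the sixteen pairs of rays and reassembled, so that
  -- the inner integral is a full contour integral to which Cauchy's theorem applies.
  have hzero : contourIntegral φ (fun z => g z * c z) = 0 := by
    have e1 : contourIntegral φ (fun z => g z * c z) = ∑ l, contourSign l * rayIntegral
        (fun w => f w * r w * contourIntegral φ (fun z => g z / (w - z))) (contourDir φ' l) := by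
      have e2 : ∀ l, rayIntegral
          (fun w => f w * r w * contourIntegral φ (fun z => g z / (w - z))) (contourDir φ' l) =
          ∑ k, contourSign k * rayIntegral (fun z => g z *
            rayIntegral (fun w => f w * r w / (w - z)) (contourDir φ' l)) (contourDir φ k) := by
        intro l
        have e3 : ∀ w, f w * r w * contourIntegral φ (fun z => g z / (w - z)) =
            ∑ k, contourSign k * (f w * r w *
              rayIntegral (fun z => g z / (w - z)) (contourDir φ k)) := by
          intro w
          simp only [contourIntegral, Finset.mul_sum]
          exact Finset.sum_congr rfl fun k _ => by ring
        simp only [e3]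
        rw [rayIntegral_sum _ fun k _ => (hswap k l).2.1.const_mul _]
        exact Finset.sum_congr rfl fun k _ => by
          rw [rayIntegral_const_mul, (hswap k l).2.2]
      simp only [e2, Finset.mul_sum]
      rw [Finset.sum_comm, contourIntegral]
      refine Finset.sum_congr rfl fun k _ => ?_
      simp only [hgc]
      rw [rayIntegral_sum _ (igc' k), Finset.mul_sum]
      refine Finset.sum_congr rfl fun l _ => ?_
      rw [rayIntegral_const_mul]
      ring
    rw [e1]
    refine Finset.sum_eq_zero fun l _ => ?_
    have e4 : rayIntegral (fun w => f w * r w * contourIntegral φ (fun z => g z / (w - z)))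
        (contourDir φ' l) = 0 := by
      unfold rayIntegral
      rw [setIntegral_congr_fun (g := fun _ => (0 : ℂ)) measurableSet_Ioi, integral_zero, mul_zero]
      intro s hs
      have e5 := hg.contourIntegral_div_eq_zero hθ' ⟨h0, hφ.2⟩
        (contour_mem_cosector h0 h hlt' (t := s) hs l)
      have e6 : contourIntegral φ (fun z => g z / (s * contourDir φ' l - z)) = 0 := by
        rw [contourIntegral_congr (h' := fun z => -1 * (g z / (z - s * contourDir φ' l))),
          contourIntegral_const_mul, e5, mul_zero]
        intro k t _
        rw [← neg_sub, div_neg, neg_one_mul]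
      simp only [e6, mul_zero]
    rw [e4, mul_zero]
  rw [contourIntegral_congr (h' := fun z => 2 * Real.pi * I * (g z * f z * r z) - g z * c z),
    contourIntegral_sub (fun k => (hr.rayIntegrable_mul hgf hω hθ hφ k).const_mul _) igc,
    contourIntegral_const_mul, hzero, sub_zero]
  intro k t ht
  rw [hinner k t ht]
  ring

end ScalarResolvent

end BisectorialCalculus

end

noncomputable section

namespace BisectorialCalculus

open Complex

/-! ### The holomorphic functional calculus of a sectorial pseudo-resolvent

The complex numbers act on the real Banach algebra `𝒜` through an algebra homomorphism `M`. -/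

section Algebra

variable {𝒜 : Type*} [NormedRing 𝒜] [NormedAlgebra ℝ 𝒜]

/-- Pseudo-resolvents outside a double sector, with the scaling bound of bisectorial operators. -/
structure SectorialResolvent (ω : ℝ) (M : ℂ →ₐ[ℝ] 𝒜) (ρ : ℂ → 𝒜) : Prop where
  comm : ∀ z ∈ cosector ω, ∀ c, M c * ρ z = ρ z * M c
  sub_eq : ∀ z ∈ cosector ω, ∀ w ∈ cosector ω, ρ z - ρ w = M (w - z) * (ρ z * ρ w)
  bound : ∀ ψ ∈ Ioo ω (Real.pi / 2), ∃ C : ℝ, ∀ z ∈ cosector ψ, ‖z‖ * ‖ρ z‖ ≤ C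

/-- Real-linear functionals that are complex linear for the action of `ℂ` through `M`. -/
def IsCompatible (M : ℂ →ₐ[ℝ] 𝒜) (Λ : 𝒜 →L[ℝ] ℂ) : Prop := ∀ c A, Λ (M c * A) = c * Λ A

theorem algHom_complex_apply (M : ℂ →ₐ[ℝ] 𝒜) (c : ℂ) :
    M c = c.re • (1 : 𝒜) + c.im • M I := by
  conv_lhs => rw [← Complex.re_add_im c]
  rw [map_add, ← Complex.real_smul, map_smul, ← mul_one (c.re : ℂ), ← Complex.real_smul, map_smul,
    map_one]

theorem continuous_algHom_complex (M : ℂ →ₐ[ℝ] 𝒜) : Continuous M :=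
  LinearMap.continuous_of_finiteDimensional M.toLinearMap

theorem exists_norm_algHom_le (M : ℂ →ₐ[ℝ] 𝒜) : ∃ K : ℝ, 0 ≤ K ∧ ∀ c, ‖M c‖ ≤ K * ‖c‖ := by
  let L : ℂ →L[ℝ] 𝒜 := LinearMap.toContinuousLinearMap M.toLinearMap
  exact ⟨‖L‖, norm_nonneg _, fun c => L.le_opNorm c⟩

/-- Real functionals separate points, and a real functional `l` is the real part of the compatible
functional `A ↦ l A - i l (M i * A)`. This reduces operator identities to scalar ones. -/
theorem eq_of_forall_isCompatible (M : ℂ →ₐ[ℝ] 𝒜) {A B : 𝒜}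
    (h : ∀ Λ : 𝒜 →L[ℝ] ℂ, IsCompatible M Λ → Λ A = Λ B) : A = B := by
  rw [SeparatingDual.eq_iff_forall_dual_eq (R := ℝ)]
  intro l
  set Λ : 𝒜 →L[ℝ] ℂ := Complex.ofRealCLM.comp l -
    I • (Complex.ofRealCLM.comp (l.comp (ContinuousLinearMap.mul ℝ 𝒜 (M I)))) with hΛ
  have hval : ∀ A, Λ A = (l A : ℂ) - I * (l (M I * A) : ℂ) := fun A => rfl
  have hMI : M I * M I = -1 := by rw [← map_mul, I_mul_I, map_neg, map_one]
  have hcomp : IsCompatible M Λ := by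
    intro c A
    have h1 : M I * (M c * A) = c.re • (M I * A) - c.im • A := by
      rw [algHom_complex_apply M c, add_mul, mul_add, smul_mul_assoc, one_mul, mul_smul_comm,
        smul_mul_assoc, mul_smul_comm, ← mul_assoc, hMI, neg_one_mul, smul_neg, sub_eq_add_neg]
    have h2 : M c * A = c.re • A + c.im • (M I * A) := by
      rw [algHom_complex_apply M c, add_mul, smul_mul_assoc, one_mul, smul_mul_assoc]
    rw [hval, hval, h1, h2, map_add, map_sub, map_smul, map_smul, map_smul, map_smul]
    conv_rhs => rw [← Complex.re_add_im c]
    simp only [smul_eq_mul]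
    push_cast
    linear_combination (c.im : ℂ) * l (M I * A) * I_sq
  have := congrArg Complex.re (h Λ hcomp)
  rw [hval, hval] at this
  simpa using this

theorem IsCompatible.comp_mulRight {M : ℂ →ₐ[ℝ] 𝒜} {Λ : 𝒜 →L[ℝ] ℂ} (hΛ : IsCompatible M Λ)
    (B : 𝒜) : IsCompatible M (Λ.comp ((ContinuousLinearMap.mul ℝ 𝒜).flip B)) := by
  intro c A
  simp only [ContinuousLinearMap.comp_apply, ContinuousLinearMap.flip_apply,
    ContinuousLinearMap.mul_apply', mul_assoc]
  exact hΛ c _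

/-- A fixed factor on the right can always be absorbed into the functional; a factor on the left
must commute with the complex action. -/
theorem IsCompatible.comp_mulLeft {M : ℂ →ₐ[ℝ] 𝒜} {Λ : 𝒜 →L[ℝ] ℂ} (hΛ : IsCompatible M Λ)
    {B : 𝒜} (hB : ∀ c, M c * B = B * M c) :
    IsCompatible M (Λ.comp (ContinuousLinearMap.mul ℝ 𝒜 B)) := by
  intro c A
  simp only [ContinuousLinearMap.comp_apply, ContinuousLinearMap.mul_apply']
  rw [← mul_assoc, ← hB, mul_assoc]
  exact hΛ c _

/-- The functional calculus `f ↦ (2πi)⁻¹ ∫_{∂D_φ} f(z) ρ(z) dz`. -/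
def contourCalculus (M : ℂ →ₐ[ℝ] 𝒜) (ρ : ℂ → 𝒜) (φ : ℝ) (f : ℂ → ℂ) : 𝒜 :=
  ∑ k, ∫ t in Ioi (0 : ℝ),
    M ((2 * Real.pi * I)⁻¹ * (contourSign k * contourDir φ k) * f (t * contourDir φ k)) *
      ρ (t * contourDir φ k)

theorem contourCalculus_congr {M : ℂ →ₐ[ℝ] 𝒜} {ρ : ℂ → 𝒜} {φ θ : ℝ} {f g : ℂ → ℂ} (h0 : 0 < φ)
    (h : φ < θ) (hθ : θ < Real.pi / 2) (hfg : EqOn f g (sector θ)) :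
    contourCalculus M ρ φ f = contourCalculus M ρ φ g := by
  unfold contourCalculus
  refine Finset.sum_congr rfl fun k _ => ?_
  refine setIntegral_congr_fun measurableSet_Ioi fun t ht => ?_
  simp only [hfg (contour_mem_sector h0 h hθ ht k)]

theorem I_mem_cosector {ω : ℝ} (hω : ω ∈ Ioo 0 (Real.pi / 2)) : I ∈ cosector ω := by
  simp only [cosector, mem_ofPred_eq, I_re, I_im, abs_zero, zero_mul, abs_one, one_mul]
  exact Real.cos_pos_of_mem_Ioo ⟨by linarith [hω.1, hω.2], hω.2⟩

theorem neg_I_mem_cosector {ω : ℝ} (hω : ω ∈ Ioo 0 (Real.pi / 2)) : -I ∈ cosector ω := by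
  simp only [cosector, mem_ofPred_eq, neg_re, neg_im, abs_neg]
  exact I_mem_cosector hω

namespace SectorialResolvent

variable {ω θ φ : ℝ} {M : ℂ →ₐ[ℝ] 𝒜} {ρ : ℂ → 𝒜} {f g : ℂ → ℂ}

/-- The resolvent identity bounds `ρ w - ρ z` by `‖z - w‖` times norms of resolvents, which stay
bounded near `z`. -/
theorem continuousOn (h : SectorialResolvent ω M ρ) (hω : ω ∈ Ioo 0 (Real.pi / 2)) :
    ContinuousOn ρ (cosector ω) := by
  intro z hz
  refine ContinuousAt.continuousWithinAt ?_
  obtain ⟨ψ, hψ, hzψ⟩ := exists_mem_cosector_gt hω hz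
  obtain ⟨C, hC⟩ := h.bound ψ hψ
  obtain ⟨K, hK0, hK⟩ := exists_norm_algHom_le M
  have hz0 := ne_zero_of_mem_cosector hz
  rw [ContinuousAt, tendsto_iff_norm_sub_tendsto_zero]
  have hlim : Filter.Tendsto (fun w : ℂ => K * ‖z - w‖ * (C / ‖w‖ * ‖ρ z‖)) (nhds z) (nhds 0) := by
    have : ContinuousAt (fun w : ℂ => K * ‖z - w‖ * (C / ‖w‖ * ‖ρ z‖)) z := by
      refine ContinuousAt.mul (by fun_prop) (ContinuousAt.mul ?_ continuousAt_const)
      exact continuousAt_const.div (by fun_prop) (norm_ne_zero_iff.2 hz0)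
    have h2 := this.tendsto
    simpa using h2
  refine squeeze_zero' (Filter.Eventually.of_forall fun w => norm_nonneg _) ?_ hlim
  filter_upwards [(isOpen_cosector ψ).mem_nhds hzψ] with w hw
  have hsub := cosector_anti hω.1 hψ.1.le hψ.2
  have hw0 : 0 < ‖w‖ := norm_pos_iff.2 (ne_zero_of_mem_cosector hw)
  have h1 : ‖ρ w‖ ≤ C / ‖w‖ := by
    rw [le_div_iff₀ hw0, mul_comm]
    exact hC w hw
  rw [h.sub_eq w (hsub hw) z hz]
  calc ‖M (z - w) * (ρ w * ρ z)‖ ≤ ‖M (z - w)‖ * (‖ρ w‖ * ‖ρ z‖) :=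
        (norm_mul_le _ _).trans (mul_le_mul_of_nonneg_left (norm_mul_le _ _) (norm_nonneg _))
    _ ≤ K * ‖z - w‖ * (C / ‖w‖ * ‖ρ z‖) := by
        gcongr
        exact hK _

/-- By the resolvent identity and compatibility, the difference quotient at `z` is `-Λ (ρ z * ρ w)`,
which converges to `-Λ (ρ z * ρ z)` by continuity. -/
theorem scalarResolvent (h : SectorialResolvent ω M ρ) (hω : ω ∈ Ioo 0 (Real.pi / 2))
    {Λ : 𝒜 →L[ℝ] ℂ} (hΛ : IsCompatible M Λ) : ScalarResolvent ω (fun z => Λ (ρ z)) where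
  differentiableOn := by
    intro z hz
    refine DifferentiableAt.differentiableWithinAt (HasDerivAt.differentiableAt
      (f' := -Λ (ρ z * ρ z)) ?_)
    rw [hasDerivAt_iff_tendsto_slope]
    have hc : ContinuousAt (fun w => -Λ (ρ z * ρ w)) z := by
      have := (h.continuousOn hω).continuousAt ((isOpen_cosector ω).mem_nhds hz)
      exact (Λ.continuous.continuousAt.comp (continuousAt_const.mul this)).neg
    refine (hc.tendsto.mono_left nhdsWithin_le_nhds).congr' ?_
    have h1 : ∀ᶠ w in nhdsWithin z {z}ᶜ, w ∈ cosector ω :=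
      nhdsWithin_le_nhds ((isOpen_cosector ω).mem_nhds hz)
    filter_upwards [h1, self_mem_nhdsWithin] with w hw hne
    have h2 : w - z ≠ 0 := sub_ne_zero.2 hne
    rw [slope_def_field, ← map_sub, ← neg_sub (ρ z), h.sub_eq z hz w hw, map_neg, hΛ, neg_div,
      mul_div_cancel_left₀ _ h2]
  bound ψ hψ := by
    obtain ⟨C, hC⟩ := h.bound ψ hψ
    refine ⟨‖Λ‖ * C, fun z hz => ?_⟩
    calc ‖z‖ * ‖Λ (ρ z)‖ ≤ ‖z‖ * (‖Λ‖ * ‖ρ z‖) :=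
          mul_le_mul_of_nonneg_left (Λ.le_opNorm _) (norm_nonneg _)
      _ = ‖Λ‖ * (‖z‖ * ‖ρ z‖) := by ring
      _ ≤ _ := mul_le_mul_of_nonneg_left (hC z hz) (norm_nonneg _)

theorem integrableOn (h : SectorialResolvent ω M ρ) (hω : 0 < ω) (hθ : θ < Real.pi / 2)
    (hφ : φ ∈ Ioo ω θ) (hf : HolDecay θ f) (c : ℂ) (k : Fin 4) :
    IntegrableOn (fun t : ℝ => M (c * f (t * contourDir φ k)) * ρ (t * contourDir φ k))
      (Ioi 0) := by
  obtain ⟨K, hK0, hK⟩ := exists_norm_algHom_le M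
  have hlt := hφ.2.trans hθ
  have hω' : ω ∈ Ioo 0 (Real.pi / 2) := ⟨hω, hφ.1.trans hlt⟩
  obtain ⟨C, hC⟩ := h.bound ((ω + φ) / 2) ⟨by linarith [hφ.1], by linarith [hφ.1]⟩
  have hang := contourAngle_mem_angles (hω.trans hφ.1) hφ.2 k
  refine Integrable.mono' ((hf.integrable _ hang).const_mul (K * ‖c‖ * C)) ?_ ?_
  · refine ContinuousOn.aestronglyMeasurable ?_ measurableSet_Ioi
    refine ContinuousOn.mul ?_ ?_
    · exact (continuous_algHom_complex M).comp_continuousOn (continuousOn_const.mul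
        (HolDecay.continuousOn_ray hf.differentiableOn ⟨hω.trans (hφ.1.trans hφ.2), hθ⟩ hang))
    · exact (h.continuousOn hω').comp (by fun_prop)
        fun t ht => contour_mem_cosector hω hφ.1 hlt ht k
  · refine (ae_restrict_iff' measurableSet_Ioi).2 (Filter.Eventually.of_forall fun t ht => ?_)
    have ht0 : 0 < t := ht
    have h1 := hC _ (contour_mem_cosector (ω := (ω + φ) / 2) (by linarith [hφ.1])
      (by linarith [hφ.1]) hlt ht0 k)
    rw [norm_mul, norm_contourDir, mul_one, Complex.norm_real, Real.norm_of_nonneg ht0.le] at h1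
    have h2 := hK (c * f (t * contourDir φ k))
    rw [norm_mul] at h2
    have h3 : ‖ρ (t * contourDir φ k)‖ ≤ C / t := by rw [le_div_iff₀ ht0]; linarith
    calc _ ≤ ‖M (c * f (t * contourDir φ k))‖ * ‖ρ (t * contourDir φ k)‖ := norm_mul_le _ _
      _ ≤ K * (‖c‖ * ‖f (t * contourDir φ k)‖) * (C / t) :=
          mul_le_mul h2 h3 (norm_nonneg _) (by positivity)
      _ = K * ‖c‖ * C * (‖f (t * contourDir φ k)‖ / t) := by ring

theorem contourCalculus_add (h : SectorialResolvent ω M ρ) (hω : 0 < ω) (hθ : θ < Real.pi / 2)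
    (hφ : φ ∈ Ioo ω θ) (hf : HolDecay θ f) (hg : HolDecay θ g) :
    contourCalculus M ρ φ (fun z => f z + g z) =
      contourCalculus M ρ φ f + contourCalculus M ρ φ g := by
  unfold contourCalculus
  rw [← Finset.sum_add_distrib]
  refine Finset.sum_congr rfl fun k _ => ?_
  rw [← integral_add (h.integrableOn hω hθ hφ hf _ k) (h.integrableOn hω hθ hφ hg _ k)]
  simp only [mul_add, map_add, add_mul]

theorem contourCalculus_const_mul (a : ℝ) :
    contourCalculus M ρ φ (fun z => a * f z) = a • contourCalculus M ρ φ f := by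
  unfold contourCalculus
  rw [Finset.smul_sum]
  refine Finset.sum_congr rfl fun k _ => ?_
  rw [← integral_smul]
  refine integral_congr_ae (Filter.Eventually.of_forall fun t => ?_)
  simp only
  rw [← smul_mul_assoc, ← map_smul, Complex.real_smul]
  congr 2
  ring

variable [CompleteSpace 𝒜]

theorem map_contourCalculus (h : SectorialResolvent ω M ρ) (hω : 0 < ω) (hθ : θ < Real.pi / 2)
    (hφ : φ ∈ Ioo ω θ) (hf : HolDecay θ f) {Λ : 𝒜 →L[ℝ] ℂ} (hΛ : IsCompatible M Λ) :
    Λ (contourCalculus M ρ φ f) =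
      (2 * Real.pi * I)⁻¹ * contourIntegral φ (fun z => f z * Λ (ρ z)) := by
  unfold contourCalculus contourIntegral
  rw [map_sum, Finset.mul_sum]
  refine Finset.sum_congr rfl fun k _ => ?_
  have hval : ∀ t : ℝ, Λ (M ((2 * Real.pi * I)⁻¹ * (contourSign k * contourDir φ k) *
      f (t * contourDir φ k)) * ρ (t * contourDir φ k)) = (2 * Real.pi * I)⁻¹ *
      (contourSign k * contourDir φ k) * (f (t * contourDir φ k) * Λ (ρ (t * contourDir φ k))) :=
    fun t => by rw [hΛ]; ring
  rw [← ContinuousLinearMap.integral_comp_comm _ (h.integrableOn hω hθ hφ hf _ k)]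
  simp only [hval]
  rw [integral_const_mul, rayIntegral]
  ring

theorem contourCalculus_eq (h : SectorialResolvent ω M ρ) (hω : 0 < ω) (hθ : θ < Real.pi / 2)
    (hφ : φ ∈ Ioo ω θ) {φ' : ℝ} (hφ' : φ' ∈ Ioo ω θ) (hf : HolDecay θ f) :
    contourCalculus M ρ φ f = contourCalculus M ρ φ' f := by
  refine eq_of_forall_isCompatible M fun Λ hΛ => ?_
  rw [h.map_contourCalculus hω hθ hφ hf hΛ, h.map_contourCalculus hω hθ hφ' hf hΛ,
    (h.scalarResolvent ⟨hω, hφ.1.trans (hφ.2.trans hθ)⟩ hΛ).contourIntegral_mul_eq hf hω hθ hφ hφ']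

theorem contourCalculus_mul (h : SectorialResolvent ω M ρ) (hω : 0 < ω) (hθ : θ < Real.pi / 2)
    (hφ : φ ∈ Ioo ω θ) (hf : HolDecay θ f) (hg : HolDecay θ g) :
    contourCalculus M ρ φ (fun z => g z * f z) =
      contourCalculus M ρ φ g * contourCalculus M ρ φ f := by
  have hω' : ω ∈ Ioo 0 (Real.pi / 2) := ⟨hω, hφ.1.trans (hφ.2.trans hθ)⟩
  have hφ' : (φ + θ) / 2 ∈ Ioo ω θ := ⟨by linarith [hφ.1, hφ.2], by linarith [hφ.2]⟩
  have hgf : HolDecay θ (fun z => g z * f z) :=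
    hf.mul_bounded ⟨hω.trans (hφ.1.trans hφ.2), hθ⟩ hg.differentiableOn hg.bounded
  -- The second factor is moved to a strictly larger angle, so that the two contours are nested and
  -- `w - z` does not vanish.
  rw [h.contourCalculus_eq hω hθ hφ hφ' hf]
  refine eq_of_forall_isCompatible M fun Λ hΛ => ?_
  have h1 := h.map_contourCalculus hω hθ hφ hg
    (hΛ.comp_mulRight (contourCalculus M ρ ((φ + θ) / 2) f))
  simp only [ContinuousLinearMap.comp_apply, ContinuousLinearMap.flip_apply,
    ContinuousLinearMap.mul_apply'] at h1
  rw [h1, h.map_contourCalculus hω hθ hφ hgf hΛ]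
  have hsr := h.scalarResolvent hω' hΛ
  have key := hsr.contourIntegral_mul_contourIntegral hf hg hω hθ hφ hφ' (by linarith [hφ.2])
    (q := fun z w => Λ (ρ z * ρ w)) (by
      intro z hz w hw
      rw [← hΛ, ← h.sub_eq z hz w hw, map_sub])
  have hpi : (2 * Real.pi * I : ℂ) ≠ 0 := Complex.two_pi_I_ne_zero
  rw [← mul_right_inj' hpi, mul_inv_cancel_left₀ hpi, mul_inv_cancel_left₀ hpi,
    ← mul_right_inj' hpi, ← key, ← contourIntegral_const_mul]
  refine contourIntegral_congr fun k t ht => ?_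
  have h2 := h.map_contourCalculus hω hθ hφ' hf (hΛ.comp_mulLeft
    (h.comm _ (contour_mem_cosector hω hφ.1 (hφ.2.trans hθ) ht k)))
  simp only [ContinuousLinearMap.comp_apply, ContinuousLinearMap.mul_apply'] at h2
  rw [h2]
  field_simp

/-- Both orders of multiplication are recorded: later `u = (1 + z²)⁻¹` appears to the left of one
factor and to the right of the other. -/
theorem contourCalculus_mul_resolvent (h : SectorialResolvent ω M ρ) (hω : 0 < ω)
    (hθ : θ < Real.pi / 2) (hφ : φ ∈ Ioo ω θ) (hf : HolDecay θ f) {μ : ℂ} (hμ : μ ∈ cosector φ)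
    (hfμ : HolDecay θ fun z => f z / (μ - z)) :
    contourCalculus M ρ φ f * ρ μ = contourCalculus M ρ φ (fun z => f z / (μ - z)) ∧
      ρ μ * contourCalculus M ρ φ f = contourCalculus M ρ φ (fun z => f z / (μ - z)) := by
  have hlt := hφ.2.trans hθ
  have hω' : ω ∈ Ioo 0 (Real.pi / 2) := ⟨hω, hφ.1.trans hlt⟩
  have hμ' : μ ∈ cosector ω := cosector_anti hω hφ.1.le hlt hμ
  constructor
  · refine eq_of_forall_isCompatible M fun Λ hΛ => ?_
    have h1 := h.map_contourCalculus hω hθ hφ hf (hΛ.comp_mulRight (ρ μ))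
    simp only [ContinuousLinearMap.comp_apply, ContinuousLinearMap.flip_apply,
      ContinuousLinearMap.mul_apply'] at h1
    rw [h1, h.map_contourCalculus hω hθ hφ hfμ hΛ]
    congr 1
    refine (h.scalarResolvent hω' hΛ).contourIntegral_resolvent hf hω hθ hφ hμ hfμ
      (q := fun z => Λ (ρ z * ρ μ)) fun z hz => ?_
    rw [← hΛ, ← h.sub_eq z hz μ hμ', map_sub]
  · refine eq_of_forall_isCompatible M fun Λ hΛ => ?_
    have h1 := h.map_contourCalculus hω hθ hφ hf (hΛ.comp_mulLeft (h.comm μ hμ'))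
    simp only [ContinuousLinearMap.comp_apply, ContinuousLinearMap.mul_apply'] at h1
    rw [h1, h.map_contourCalculus hω hθ hφ hfμ hΛ]
    congr 1
    refine (h.scalarResolvent hω' hΛ).contourIntegral_resolvent hf hω hθ hφ hμ hfμ
      (q := fun z => Λ (ρ μ * ρ z)) fun z hz => ?_
    rw [← neg_sub z μ, neg_mul, ← hΛ, ← h.sub_eq μ hμ' z hz, map_sub, neg_sub]

theorem contourCalculus_mul_inv_one_add_sq (h : SectorialResolvent ω M ρ) (hω : 0 < ω)
    (hθ : θ < Real.pi / 2) (hφ : φ ∈ Ioo ω θ) :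
    contourCalculus M ρ φ (fun z => z * (1 + z ^ 2)⁻¹) = -(1 / 2 : ℝ) • (ρ I + ρ (-I)) := by
  refine eq_of_forall_isCompatible M fun Λ hΛ => ?_
  rw [h.map_contourCalculus hω hθ hφ (holDecay_mul_inv_one_add_sq
    ⟨hω.trans (hφ.1.trans hφ.2), hθ⟩) hΛ,
    (h.scalarResolvent ⟨hω, hφ.1.trans (hφ.2.trans hθ)⟩ hΛ).contourIntegral_mul_inv_one_add_sq hω
    hφ.1 (hφ.2.trans hθ), map_smul, map_add, Complex.real_smul]
  have : (Real.pi : ℂ) ≠ 0 := by exact_mod_cast Real.pi_ne_zero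
  have := I_ne_zero
  push_cast
  field_simp

/-- `(1 + z²)⁻¹ f` corresponds to multiplication by `ρ(i) ρ(-i)`. -/
theorem contourCalculus_inv_one_add_sq_mul (h : SectorialResolvent ω M ρ) (hω : 0 < ω)
    (hθ : θ < Real.pi / 2) (hφ : φ ∈ Ioo ω θ) (hf : HolDecay θ f) :
    contourCalculus M ρ φ (fun z => (1 + z ^ 2)⁻¹ * f z) =
        ρ I * ρ (-I) * contourCalculus M ρ φ f ∧
      contourCalculus M ρ φ (fun z => (1 + z ^ 2)⁻¹ * f z) =
        contourCalculus M ρ φ f * (ρ I * ρ (-I)) := by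
  have hθ' : θ ∈ Ioo 0 (Real.pi / 2) := ⟨hω.trans (hφ.1.trans hφ.2), hθ⟩
  have hφ' : φ ∈ Ioo 0 (Real.pi / 2) := ⟨hω.trans hφ.1, hφ.2.trans hθ⟩
  have hden : ∀ z : ℂ, 1 + z ^ 2 = (I - z) * (-I - z) := fun z => by linear_combination I_sq
  have hI : ∀ z ∈ sector θ, I - z ≠ 0 ∧ -I - z ≠ 0 := fun z hz =>
    mul_ne_zero_iff.1 (hden z ▸ one_add_sq_ne_zero hθ' hz)
  -- For `s = i` or `-i`, `(s - z)⁻¹ = (-s - z) / (1 + z²)`, and `(1 + x) / (1 + x²) ≤ 2`. So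
  -- dividing by `s - z` preserves the decay class, and `1 + z² = (i - z)(-i - z)` is handled one
  -- factor at a time.
  have bI : ∀ z ∈ sector θ, ∀ s : ℂ, s ^ 2 = -1 → ‖(s - z)⁻¹‖ ≤
      (1 - Real.sin θ)⁻¹ * 2 := by
    intro z hz s hs
    have h1 := norm_inv_one_add_sq_le hθ' hz
    have hns : ‖s‖ = 1 := by
      have := congrArg norm hs
      rw [norm_pow, norm_neg, norm_one] at this
      exact (pow_eq_one_iff_of_nonneg (norm_nonneg s) two_ne_zero).1 this
    have h2 : (1 : ℂ) + z ^ 2 = (s - z) * (-s - z) := by linear_combination hs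
    have h3 : (s - z)⁻¹ = (1 + z ^ 2)⁻¹ * (-s - z) := by
      have h4 := one_add_sq_ne_zero hθ' hz
      rw [h2] at h4 ⊢
      field_simp [(mul_ne_zero_iff.1 h4).1, (mul_ne_zero_iff.1 h4).2]
    rw [h3, norm_mul]
    have h5 : ‖-s - z‖ ≤ 1 + ‖z‖ := by
      refine (norm_sub_le _ _).trans ?_
      rw [norm_neg, hns]
    calc ‖(1 + z ^ 2)⁻¹‖ * ‖-s - z‖ ≤ ((1 - Real.sin θ)⁻¹ * (1 + ‖z‖ ^ 2)⁻¹) * (1 + ‖z‖) :=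
          mul_le_mul h1 h5 (norm_nonneg _) ((norm_nonneg _).trans h1)
      _ = (1 - Real.sin θ)⁻¹ * ((1 + ‖z‖) / (1 + ‖z‖ ^ 2)) := by ring
      _ ≤ (1 - Real.sin θ)⁻¹ * 2 := by
          refine mul_le_mul_of_nonneg_left ?_ (inv_nonneg.2 (one_sub_sin_pos hθ').le)
          rw [div_le_iff₀ (by positivity)]
          nlinarith [sq_nonneg (‖z‖ - 1), sq_nonneg ‖z‖]
  have hstep : ∀ {f : ℂ → ℂ}, HolDecay θ f → ∀ s : ℂ, s ^ 2 = -1 → (∀ z ∈ sector θ, s - z ≠ 0) →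
      HolDecay θ (fun z => f z / (s - z)) := by
    intro f hf s hs hne
    have := hf.mul_bounded hθ' (g := fun z => (s - z)⁻¹)
      (DifferentiableOn.inv (by fun_prop) hne) ⟨_, fun z hz => bI z hz s hs⟩
    simpa only [div_eq_mul_inv, mul_comm] using this
  have hI2 : (-I) ^ 2 = (-1 : ℂ) := by rw [neg_sq, I_sq]
  have d1 := hstep hf I I_sq fun z hz => (hI z hz).1
  have d2 := hstep hf (-I) hI2 fun z hz => (hI z hz).2
  have d3 := hstep d1 (-I) hI2 fun z hz => (hI z hz).2
  have d4 := hstep d2 I I_sq fun z hz => (hI z hz).1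
  have e1 := h.contourCalculus_mul_resolvent hω hθ hφ hf (I_mem_cosector hφ') d1
  have e2 := h.contourCalculus_mul_resolvent hω hθ hφ hf (neg_I_mem_cosector hφ') d2
  have e3 := h.contourCalculus_mul_resolvent hω hθ hφ d1 (neg_I_mem_cosector hφ') d3
  have e4 := h.contourCalculus_mul_resolvent hω hθ hφ d2 (I_mem_cosector hφ') d4
  constructor
  · rw [mul_assoc, e2.2, e4.2]
    congr 1
    funext z
    rw [div_div, mul_comm (-I - z), ← hden, div_eq_inv_mul]
  · rw [← mul_assoc, e1.1, e3.1]
    congr 1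
    funext z
    rw [div_div, ← hden, div_eq_inv_mul]

/-- The function `(1 + z²)⁻² - (1 + z²)⁻¹` decays at `0` and at `∞`. -/
theorem contourCalculus_inv_one_add_sq_sq_sub (h : SectorialResolvent ω M ρ) (hω : 0 < ω)
    (hθ : θ < Real.pi / 2) (hφ : φ ∈ Ioo ω θ) :
    HolDecay θ (fun z => ((1 + z ^ 2)⁻¹) ^ 2 - (1 + z ^ 2)⁻¹) ∧
    contourCalculus M ρ φ (fun z => ((1 + z ^ 2)⁻¹) ^ 2 - (1 + z ^ 2)⁻¹) =
      (ρ I * ρ (-I)) * (ρ I * ρ (-I)) - ρ I * ρ (-I) := by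
  have hθ' : θ ∈ Ioo 0 (Real.pi / 2) := ⟨hω.trans (hφ.1.trans hφ.2), hθ⟩
  have hω' : ω ∈ Ioo 0 (Real.pi / 2) := ⟨hω, hφ.1.trans (hφ.2.trans hθ)⟩
  have hd := holDecay_mul_inv_one_add_sq hθ'
  have hdd := (hd.mul_bounded hθ' hd.differentiableOn hd.bounded).const_mul hθ' ((-1 : ℝ) : ℂ)
  -- With `u = (1 + z²)⁻¹`, `u² - u = -(z u)²`. As `z u` decays, the product formula applies to its
  -- square, giving `-(ρ(i) + ρ(-i))² / 4`.
  have heq : EqOn (fun z : ℂ => ((-1 : ℝ) : ℂ) * (z * (1 + z ^ 2)⁻¹ * (z * (1 + z ^ 2)⁻¹)))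
      (fun z : ℂ => ((1 + z ^ 2)⁻¹) ^ 2 - (1 + z ^ 2)⁻¹) (sector θ) := by
    intro z hz
    have := one_add_sq_ne_zero hθ' hz
    simp only
    push_cast
    field_simp
    ring
  have hcalc := congrArg₂ (· * ·) (h.contourCalculus_mul_inv_one_add_sq hω hθ hφ)
    (h.contourCalculus_mul_inv_one_add_sq hω hθ hφ)
  rw [← h.contourCalculus_mul hω hθ hφ hd hd] at hcalc
  constructor
  · refine hdd.of_le hθ' ?_ 1 fun z hz => ?_
    · exact ((differentiableOn_inv_one_add_sq hθ').pow 2).sub (differentiableOn_inv_one_add_sq hθ')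
    · rw [one_mul]
      exact le_of_eq (congrArg norm (heq hz).symm)
  · rw [← contourCalculus_congr (hω.trans hφ.1) hφ.2 hθ heq, contourCalculus_const_mul, hcalc]
    have hI := I_mem_cosector hω'
    have hI' := neg_I_mem_cosector hω'
    have r1 := h.sub_eq I hI (-I) hI'
    have r2 := h.sub_eq (-I) hI' I hI
    have hM : M (-I - I) = (-2 : ℝ) • M I := by
      rw [← map_smul]; congr 1; rw [Complex.real_smul]; push_cast; ring
    have hM' : M (I - -I) = (2 : ℝ) • M I := by
      rw [← map_smul]; congr 1; rw [Complex.real_smul]; push_cast; ring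
    have hMI : M I * M I = -1 := by rw [← map_mul, I_mul_I, map_neg, map_one]
    rw [hM, smul_mul_assoc] at r1
    rw [hM', smul_mul_assoc] at r2
    have hcomm : ρ (-I) * ρ I = ρ I * ρ (-I) := by
      have h1 : M I * (ρ (-I) * ρ I) = M I * (ρ I * ρ (-I)) := by
        have h2 : (2 : ℝ) • (M I * (ρ (-I) * ρ I)) = (2 : ℝ) • (M I * (ρ I * ρ (-I))) := by
          rw [← r2, ← neg_sub, r1, ← neg_smul, neg_neg]
        exact smul_right_injective _ two_ne_zero h2
      have h3 := congrArg (fun A => M I * A) h1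
      simp only [← mul_assoc, hMI] at h3
      simpa only [neg_one_mul, neg_mul, neg_inj, one_mul] using h3
    set E := ρ I * ρ (-I) with hE
    have hEM : M I * E = E * M I := by
      rw [hE, ← mul_assoc, h.comm I hI, mul_assoc, h.comm (-I) hI', mul_assoc]
    -- The resolvent identity gives `ρ(i) - ρ(-i) = -2 M(i) E` with `M(i)² = -1`. The square of the
    -- sum then differs from this one by `4 E`.
    have hsq : (ρ I - ρ (-I)) * (ρ I - ρ (-I)) = (-4 : ℝ) • (E * E) := by
      rw [r1, smul_mul_smul_comm]
      have : M I * E * (M I * E) = -(E * E) := by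
        rw [mul_assoc, ← mul_assoc E, ← hEM, mul_assoc (M I) E, ← mul_assoc, hMI, neg_one_mul]
      rw [this, smul_neg, ← neg_smul]
      norm_num
    have hsq2 : (ρ I + ρ (-I)) * (ρ I + ρ (-I)) = (-4 : ℝ) • (E * E) + (4 : ℝ) • E := by
      rw [← hsq, sub_mul, mul_sub, mul_sub, add_mul, mul_add, mul_add, hcomm, ← hE]
      module
    rw [smul_mul_smul_comm, hsq2]
    module

end SectorialResolvent

end Algebra

end BisectorialCalculus

end

noncomputable section

namespace BisectorialCalculus

/-! ### Paravectors and slices of the Clifford algebra -/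

section Clifford

variable {n : ℕ} {E : Type*} [NormedAddCommGroup E] [NormedSpace ℝ E]

/-- Left multiplication as a linear map in the Clifford number. -/
def lmulLin (n : ℕ) (E : Type*) [NormedAddCommGroup E] [NormedSpace ℝ E] :
    Cliff n →ₗ[ℝ] (CliffMod n E →L[ℝ] CliffMod n E) where
  toFun := lmul
  map_add' s t := by
    ext v C
    simp [lmul_apply, mul_add, add_smul, Finset.sum_add_distrib]
  map_smul' a s := by
    ext v C
    simp [lmul_apply, Finset.smul_sum, smul_smul, mul_left_comm]

theorem lmulLin_apply (s : Cliff n) : lmulLin n E s = lmul s := rfl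

theorem lmul_one_eq : (lmul (1 : Cliff n) : CliffMod n E →L[ℝ] CliffMod n E) = 1 := by
  ext1 v
  exact lmul_one v

theorem lmul_mul_eq (s t : Cliff n) :
    (lmul (s * t) : CliffMod n E →L[ℝ] CliffMod n E) = lmul s * lmul t := by
  ext1 v
  exact lmul_mul s t v

theorem exists_norm_lmul_le (n : ℕ) (E : Type*) [NormedAddCommGroup E] [NormedSpace ℝ E] :
    ∃ K : ℝ, 0 ≤ K ∧ ∀ s : Cliff n, ‖(lmul s : CliffMod n E →L[ℝ] CliffMod n E)‖ ≤ K * ‖s‖ := by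
  let L : Cliff n →L[ℝ] (CliffMod n E →L[ℝ] CliffMod n E) :=
    LinearMap.toContinuousLinearMap (lmulLin n E)
  exact ⟨‖L‖, L.opNorm_nonneg, fun s => L.le_opNorm s⟩

theorem continuous_lmul :
    Continuous (fun s : Cliff n => (lmul s : CliffMod n E →L[ℝ] CliffMod n E)) :=
  LinearMap.continuous_of_finiteDimensional (lmulLin n E)

theorem cliff_smul_mul (a : ℝ) (s t : Cliff n) : (a • s) * t = a • (s * t) := by
  rw [mul_def, ← lmulLin_apply, map_smul]
  rfl

theorem cliff_mul_smul (a : ℝ) (s t : Cliff n) : s * (a • t) = a • (s * t) :=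
  map_smul (lmul s) a t

instance : IsScalarTower ℝ (Cliff n) (Cliff n) := ⟨fun a s t => cliff_smul_mul a s t⟩

instance : SMulCommClass ℝ (Cliff n) (Cliff n) := ⟨fun a s t => (cliff_mul_smul a s t).symm⟩

theorem basisVec_apply (A B : Finset (Fin n)) :
    (basisVec A : Cliff n) B = if B = A then 1 else 0 := by
  simp [basisVec]

theorem one_apply (B : Finset (Fin n)) : (1 : Cliff n) B = if B = ∅ then 1 else 0 := by
  simp [one_def]

theorem sum_smul_basisVec (s : Cliff n) : ∑ A, s A • (basisVec A : Cliff n) = s := by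
  ext B
  simp [basisVec_apply]

theorem norm_sq_eq_sum (s : Cliff n) : ‖s‖ ^ 2 = ∑ A, s A ^ 2 := by
  rw [EuclideanSpace.norm_sq_eq]
  simp

theorem apply_eq_zero_of_mem_imagSphere {J : Cliff n} (hJ : J ∈ imagSphere n)
    {A : Finset (Fin n)} (hA : A.card ≠ 1) : J A = 0 := by
  rcases Nat.lt_or_gt_of_ne hA with h | h
  · rw [Finset.card_eq_zero.1 (Nat.lt_one_iff.1 h)]
    exact hJ.2.1
  · exact hJ.1 A h

theorem sum_eq_sum_singleton {X : Type*} [AddCommMonoid X] (F : Finset (Fin n) → X)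
    (hF : ∀ A, A.card ≠ 1 → F A = 0) : ∑ A, F A = ∑ i : Fin n, F {i} := by
  rw [← Finset.sum_subset (Finset.subset_univ (Finset.univ.image (fun i : Fin n => ({i} : Finset (Fin n)))))]
  · rw [Finset.sum_image fun i _ j _ h => Finset.singleton_injective h]
  · intro A _ hA
    refine hF A fun h => hA ?_
    obtain ⟨i, rfl⟩ := Finset.card_eq_one.1 h
    exact Finset.mem_image_of_mem _ (Finset.mem_univ i)

/-- Adding the double sum for `J * J` to its transpose cancels the mixed terms by anticommutation;
the diagonal gives `-2 ‖J‖²`. -/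
theorem mul_self_of_mem_imagSphere {J : Cliff n} (hJ : J ∈ imagSphere n) : J * J = -1 := by
  have h1 : J = ∑ i : Fin n, J {i} • (basisVec {i} : Cliff n) := by
    conv_lhs => rw [← sum_smul_basisVec J]
    refine sum_eq_sum_singleton _ fun A hA => ?_
    rw [apply_eq_zero_of_mem_imagSphere hJ hA, zero_smul]
  have h2 : ∑ i : Fin n, J {i} ^ 2 = 1 := by
    rw [← sum_eq_sum_singleton (fun A => J A ^ 2), ← norm_sq_eq_sum, hJ.2.2, one_pow]
    intro A hA
    rw [apply_eq_zero_of_mem_imagSphere hJ hA]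
    norm_num
  have h3 : J * J = ∑ i : Fin n, ∑ j : Fin n,
      (J {i} * J {j}) • (basisVec {i} * basisVec {j} : Cliff n) := by
    conv_lhs => rw [h1]
    rw [Finset.sum_mul_sum]
    refine Finset.sum_congr rfl fun i _ => Finset.sum_congr rfl fun j _ => ?_
    rw [smul_mul_smul_comm]
  have h4 : J * J = ∑ i : Fin n, ∑ j : Fin n,
      (J {i} * J {j}) • (basisVec {j} * basisVec {i} : Cliff n) := by
    rw [h3, Finset.sum_comm]
    refine Finset.sum_congr rfl fun i _ => Finset.sum_congr rfl fun j _ => ?_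
    rw [mul_comm (J {j})]
  have h5 : J * J + J * J = (-2 : ℝ) • (1 : Cliff n) := by
    conv_lhs => rw [h4]
    nth_rw 1 [← h4]
    rw [h3, ← Finset.sum_add_distrib]
    have h6 : ∀ i : Fin n, (∑ j : Fin n, (J {i} * J {j}) • (basisVec {i} * basisVec {j} : Cliff n)) +
        ∑ j : Fin n, (J {i} * J {j}) • (basisVec {j} * basisVec {i} : Cliff n) =
        (-2 * J {i} ^ 2) • (1 : Cliff n) := by
      intro i
      rw [← Finset.sum_add_distrib, Finset.sum_eq_single i]
      · rw [unit_mul_self]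
        module
      · intro j _ hj
        rw [unit_anticomm hj.symm]
        simp
      · simp
    rw [Finset.sum_congr rfl fun i _ => h6 i, ← Finset.sum_smul, ← Finset.mul_sum, h2, mul_one]
  have h7 : (2 : ℝ) • (J * J) = (2 : ℝ) • (-1 : Cliff n) := by
    rw [two_smul, h5]
    module
  exact smul_right_injective _ two_ne_zero h7

/-- The copy `ℂ_J` of the complex numbers in `ℝ_n`. -/
def slice (J : Cliff n) (z : ℂ) : Cliff n := slicePt J z.re z.im

theorem slice_add (J : Cliff n) (z w : ℂ) : slice J (z + w) = slice J z + slice J w := by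
  simp only [slice, slicePt, Complex.add_re, Complex.add_im, add_smul]
  abel

theorem slice_ofReal (J : Cliff n) (a : ℝ) : slice J a = a • (1 : Cliff n) := by
  simp [slice, slicePt]

theorem slice_smul (J : Cliff n) (a : ℝ) (z : ℂ) : slice J (a * z) = a • slice J z := by
  simp [slice, slicePt, mul_smul]

theorem slice_neg (J : Cliff n) (z : ℂ) : slice J (-z) = -slice J z := by
  simp only [slice, slicePt, Complex.neg_re, Complex.neg_im, neg_smul]
  abel

theorem slice_zero (J : Cliff n) : slice J 0 = 0 := by simp [slice, slicePt]

theorem slice_one (J : Cliff n) : slice J 1 = 1 := by simp [slice, slicePt]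

theorem slice_I (J : Cliff n) : slice J Complex.I = J := by simp [slice, slicePt]

theorem slice_mul {J : Cliff n} (hJ : J ∈ imagSphere n) (z w : ℂ) :
    slice J (z * w) = slice J z * slice J w := by
  simp only [slice, slicePt, Complex.mul_re, Complex.mul_im, add_mul, mul_add, smul_mul_smul_comm,
    one_mul, mul_one, mul_self_of_mem_imagSphere hJ]
  module

theorem continuous_slice (J : Cliff n) : Continuous (slice J) := by
  unfold slice slicePt
  fun_prop

theorem slice_exp (J : Cliff n) (t α : ℝ) :
    slice J (t * Complex.exp (α * Complex.I)) = t • sliceExp J α := by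
  rw [slice_smul, sliceExp, slice, Complex.exp_ofReal_mul_I_re, Complex.exp_ofReal_mul_I_im]

theorem slice_apply_empty {J : Cliff n} (hJ : J ∈ imagSphere n) (z : ℂ) : slice J z ∅ = z.re := by
  simp [slice, slicePt, hJ.2.1, one_apply]

theorem slice_mem_paravectors {J : Cliff n} (hJ : J ∈ imagSphere n) (z : ℂ) :
    slice J z ∈ paravectors n := by
  intro A hA
  have h1 : A ≠ ∅ := by
    rintro rfl
    simp at hA
  simp [slice, slicePt, hJ.1 A hA, one_apply, h1]

theorem norm_slice {J : Cliff n} (hJ : J ∈ imagSphere n) (z : ℂ) : ‖slice J z‖ = ‖z‖ := by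
  have hin : inner ℝ (1 : Cliff n) J = 0 := by
    rw [one_def, EuclideanSpace.inner_single_left, hJ.2.1]
    simp
  have h1 : ‖(1 : Cliff n)‖ = 1 := by
    rw [one_def, PiLp.norm_single]
    simp
  have h2 : ‖slice J z‖ ^ 2 = ‖z‖ ^ 2 := by
    rw [slice, slicePt, norm_add_sq_real, norm_smul, norm_smul, h1, hJ.2.2, inner_smul_left,
      inner_smul_right, hin, Complex.sq_norm, Complex.normSq_apply]
    simp [← sq]
  exact (sq_eq_sq₀ (norm_nonneg _) (norm_nonneg _)).1 h2

theorem conj_slice {J : Cliff n} (hJ : J ∈ imagSphere n) (z : ℂ) :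
    conj (slice J z) = slice J (starRingEnd ℂ z) := by
  ext A
  simp only [conj, slice, slicePt, Complex.conj_re, Complex.conj_im, PiLp.add_apply,
    PiLp.smul_apply, smul_eq_mul, one_apply]
  by_cases hA : A = ∅
  · subst hA
    simp [hJ.2.1]
  · by_cases h1 : A.card = 1
    · simp [hA, h1]
    · simp [hA, apply_eq_zero_of_mem_imagSphere hJ h1]

theorem imagSphere_nonempty (hn : 1 ≤ n) : (imagSphere n).Nonempty := by
  refine ⟨basisVec {⟨0, hn⟩}, ?_, ?_, ?_⟩
  · intro A hA
    rw [basisVec_apply, if_neg]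
    rintro rfl
    simp at hA
  · simp [basisVec_apply]
  · rw [basisVec, PiLp.norm_single]
    simp

theorem neg_mem_imagSphere {J : Cliff n} (hJ : J ∈ imagSphere n) : -J ∈ imagSphere n :=
  ⟨fun A hA => by rw [PiLp.neg_apply, hJ.1 A hA, neg_zero], by rw [PiLp.neg_apply, hJ.2.1, neg_zero],
    by rw [norm_neg, hJ.2.2]⟩

/-! ### Double sectors -/

theorem exists_polar_of_mem_sector {θ : ℝ} (hθ : θ ∈ Ioo 0 (Real.pi / 2)) {z : ℂ}
    (hz : z ∈ sector θ) :
    ∃ α ∈ angles θ, ∃ r : ℝ, 0 < r ∧ z = r * Complex.exp (α * Complex.I) := by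
  have key : ∀ z ∈ sector θ, 0 < z.re → z.arg ∈ Ioo (-θ) θ ∧ 0 < ‖z‖ := by
    intro z hz hre
    have hz0 : z ≠ 0 := by rintro rfl; simp at hre
    have hn : 0 < ‖z‖ := norm_pos_iff.2 hz0
    have harg := abs_lt.1 (Complex.abs_arg_lt_pi_div_two_iff.2 (Or.inl hre))
    have hz' : |z.im| * Real.cos θ < z.re * Real.sin θ := by
      have : |z.im| * Real.cos θ < |z.re| * Real.sin θ := hz
      rwa [abs_of_pos hre] at this
    have him := abs_le.1 (le_refl |z.im|)
    have hcos : 0 < Real.cos θ := Real.cos_pos_of_mem_Ioo ⟨by linarith [hθ.1, hθ.2], hθ.2⟩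
    have e1 : z.re = ‖z‖ * Real.cos z.arg := by rw [Complex.norm_mul_cos_arg]
    have e2 : z.im = ‖z‖ * Real.sin z.arg := by rw [Complex.norm_mul_sin_arg]
    refine ⟨⟨?_, ?_⟩, hn⟩
    · by_contra hcon
      push Not at hcon
      have h1 : Real.sin (z.arg + θ) ≤ 0 :=
        Real.sin_nonpos_of_nonpos_of_neg_pi_le (by linarith) (by linarith [hθ.1, hθ.2])
      rw [Real.sin_add] at h1
      have h2 := mul_nonpos_of_nonneg_of_nonpos hn.le h1
      have h3 : z.im * Real.cos θ + z.re * Real.sin θ = ‖z‖ * (Real.sin z.arg * Real.cos θ +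
          Real.cos z.arg * Real.sin θ) := by
        linear_combination Real.cos θ * e2 + Real.sin θ * e1
      linarith [mul_le_mul_of_nonneg_right him.1 hcos.le]
    · by_contra hcon
      push Not at hcon
      have h1 : 0 ≤ Real.sin (z.arg - θ) :=
        Real.sin_nonneg_of_nonneg_of_le_pi (by linarith) (by linarith [hθ.1, hθ.2])
      rw [Real.sin_sub] at h1
      have h2 := mul_nonneg hn.le h1
      have h3 : z.im * Real.cos θ - z.re * Real.sin θ = ‖z‖ * (Real.sin z.arg * Real.cos θ -
          Real.cos z.arg * Real.sin θ) := by
        linear_combination Real.cos θ * e2 - Real.sin θ * e1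
      linarith [mul_le_mul_of_nonneg_right him.2 hcos.le]
  have hcos : 0 < Real.cos θ := Real.cos_pos_of_mem_Ioo ⟨by linarith [hθ.1, hθ.2], hθ.2⟩
  have hre : z.re ≠ 0 := by
    intro h
    have : |z.im| * Real.cos θ < |z.re| * Real.sin θ := hz
    rw [h, abs_zero, zero_mul] at this
    exact absurd this (not_lt.2 (by positivity))
  rcases lt_or_gt_of_ne hre with h | h
  · have hz' : -z ∈ sector θ := by simpa [sector] using hz
    obtain ⟨h1, h2⟩ := key (-z) hz' (by simpa using h)
    refine ⟨(-z).arg + Real.pi, Or.inr ⟨by linarith [h1.1], by linarith [h1.2]⟩, ‖-z‖, h2, ?_⟩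
    rw [mul_exp_add_pi, Complex.norm_mul_exp_arg_mul_I, neg_neg]
  · obtain ⟨h1, h2⟩ := key z hz h
    exact ⟨z.arg, Or.inl h1, ‖z‖, h2, (Complex.norm_mul_exp_arg_mul_I z).symm⟩

theorem slice_mem_doubleSector {θ : ℝ} (hθ : θ ∈ Ioo 0 (Real.pi / 2)) {J : Cliff n}
    (hJ : J ∈ imagSphere n) {z : ℂ} (hz : z ∈ sector θ) : slice J z ∈ doubleSector n θ := by
  obtain ⟨α, hα, r, hr, rfl⟩ := exists_polar_of_mem_sector hθ hz
  exact ⟨J, hJ, α, hα, r, hr, slice_exp J r α⟩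

theorem exists_slice_of_mem_doubleSector {θ : ℝ} (hθ : θ ∈ Ioo 0 (Real.pi / 2)) {s : Cliff n}
    (hs : s ∈ doubleSector n θ) : ∃ J ∈ imagSphere n, ∃ z ∈ sector θ, s = slice J z := by
  obtain ⟨J, hJ, α, hα, r, hr, rfl⟩ := hs
  exact ⟨J, hJ, r * Complex.exp (α * Complex.I), polar_mem_sector hθ hα hr, (slice_exp J r α).symm⟩

theorem norm_slice_sub {J : Cliff n} (hJ : J ∈ imagSphere n) (z : ℂ) :
    ‖slice J z - slice J z ∅ • (1 : Cliff n)‖ = |z.im| := by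
  rw [slice_apply_empty hJ, slice, slicePt, add_sub_cancel_left, norm_smul, hJ.2.2, mul_one,
    Real.norm_eq_abs]

/-- The numbers `Re z` and `|Im z|` can be read off from the point itself, as its scalar coordinate
and the norm of the rest. Membership in `sector` depends on nothing else, so the choice of `J` is
immaterial. -/
theorem mem_sector_of_slice_mem {θ : ℝ} (hθ : θ ∈ Ioo 0 (Real.pi / 2)) {J : Cliff n}
    (hJ : J ∈ imagSphere n) {z : ℂ} (hz : slice J z ∈ doubleSector n θ) : z ∈ sector θ := by
  obtain ⟨J', hJ', w, hw, heq⟩ := exists_slice_of_mem_doubleSector hθ hz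
  have h1 := norm_slice_sub hJ z
  have h2 := slice_apply_empty hJ z
  rw [heq, norm_slice_sub hJ'] at h1
  rw [heq, slice_apply_empty hJ'] at h2
  simpa only [sector, mem_ofPred_eq, ← h1, ← h2] using hw

/-- The same two quantities are continuous, so the non-strict cone inequality defines a closed set
containing the double sector. -/
theorem slice_not_mem_closure {ω : ℝ} (hω : ω ∈ Ioo 0 (Real.pi / 2)) {J : Cliff n}
    (hJ : J ∈ imagSphere n) {z : ℂ} (hz : z ∈ cosector ω) :
    slice J z ∉ closure (doubleSector n ω) := by
  have hclosed : IsClosed {s : Cliff n |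
      ‖s - s ∅ • (1 : Cliff n)‖ * Real.cos ω ≤ |s ∅| * Real.sin ω} := by
    apply isClosed_le <;> fun_prop
  have hsub : doubleSector n ω ⊆ {s : Cliff n |
      ‖s - s ∅ • (1 : Cliff n)‖ * Real.cos ω ≤ |s ∅| * Real.sin ω} := by
    intro s hs
    obtain ⟨J', hJ', w, hw, rfl⟩ := exists_slice_of_mem_doubleSector hω hs
    rw [mem_ofPred_eq, norm_slice_sub hJ', slice_apply_empty hJ']
    exact le_of_lt hw
  intro h
  have h1 := closure_minimal hsub hclosed h
  rw [mem_ofPred_eq, norm_slice_sub hJ, slice_apply_empty hJ] at h1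
  exact absurd (show |z.re| * Real.sin ω < |z.im| * Real.cos ω from hz) (not_lt.2 h1)

theorem mem_sliceDomain_iff (hn : 1 ≤ n) {θ : ℝ} (hθ : θ ∈ Ioo 0 (Real.pi / 2)) (p : ℝ × ℝ) :
    p ∈ sliceDomain (doubleSector n θ) ↔ (⟨p.1, p.2⟩ : ℂ) ∈ sector θ := by
  constructor
  · intro h
    obtain ⟨J, hJ⟩ := imagSphere_nonempty hn
    exact mem_sector_of_slice_mem hθ hJ (h J hJ)
  · exact fun h J hJ => slice_mem_doubleSector hθ hJ h

end Clifford

end BisectorialCalculus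

end

noncomputable section

namespace BisectorialCalculus

/-! ### Slice hyperholomorphic functions and their holomorphic components -/

section Components

variable {n : ℕ}

/-- The functions `F_A` are the holomorphic components of `f(s) = ∑_A F_A(s) e_A`, where `F_A` is
extended to an intrinsic function of `s`. -/
structure HasComponents (θ : ℝ) (f : Cliff n → Cliff n) (F : Finset (Fin n) → ℂ → ℂ) : Prop where
  repr : ∀ J ∈ imagSphere n, ∀ z ∈ sector θ, f (slice J z) = ∑ A, slice J (F A z) * basisVec A
  map_conj : ∀ A, ∀ z ∈ sector θ, F A (starRingEnd ℂ z) = starRingEnd ℂ (F A z)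
  decay : ∀ A, HolDecay θ (F A)

theorem exists_norm_mul_le (n : ℕ) :
    ∃ K : ℝ, 0 ≤ K ∧ ∀ s t : Cliff n, ‖s * t‖ ≤ K * ‖s‖ * ‖t‖ := by
  obtain ⟨K, hK0, hK⟩ := exists_norm_lmul_le n ℝ
  refine ⟨K, hK0, fun s t => ?_⟩
  have h1 : ‖(lmul s : Cliff n →L[ℝ] Cliff n) t‖ ≤ ‖(lmul s : Cliff n →L[ℝ] Cliff n)‖ * ‖t‖ :=
    ContinuousLinearMap.le_opNorm _ _
  rw [mul_def]
  refine h1.trans ?_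
  have h2 : ‖(lmul s : Cliff n →L[ℝ] Cliff n)‖ ≤ K * ‖s‖ := hK s
  exact mul_le_mul_of_nonneg_right h2 (norm_nonneg t)

theorem continuous_mul_basisVec (A : Finset (Fin n)) :
    Continuous (fun s : Cliff n => s * basisVec A) :=
  (continuous_lmul (E := ℝ)).clm_apply continuous_const

theorem norm_apply_le (s : Cliff n) (A : Finset (Fin n)) : ‖s A‖ ≤ ‖s‖ := PiLp.norm_apply_le s A

theorem isOpen_sliceDomain (hn : 1 ≤ n) {θ : ℝ} (hθ : θ ∈ Ioo 0 (Real.pi / 2)) :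
    IsOpen (sliceDomain (doubleSector n θ)) := by
  have : sliceDomain (doubleSector n θ) =
      Complex.equivRealProdCLM.symm ⁻¹' (sector θ) := by
    ext p
    rw [mem_sliceDomain_iff hn hθ]
    rfl
  rw [this]
  exact (isOpen_sector θ).preimage Complex.equivRealProdCLM.symm.continuous

/-- Taken coordinatewise, the equations for the pair are the Cauchy–Riemann equations of `(f₀)_A + i
(f₁)_A`, and the parity conditions are symmetry under conjugation. -/
theorem IsSlicePair.hasComponents (hn : 1 ≤ n) {θ : ℝ} (hθ : θ ∈ Ioo 0 (Real.pi / 2))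
    {f : Cliff n → Cliff n} {f₀ f₁ : ℝ × ℝ → Cliff n}
    (h : IsSlicePair (doubleSector n θ) f f₀ f₁) (hd : HasDecay θ f) :
    HasComponents θ f
      (fun A z => (f₀ (z.re, z.im) A : ℂ) + (f₁ (z.re, z.im) A : ℂ) * Complex.I) := by
  have hdom : ∀ z ∈ sector θ, (z.re, z.im) ∈ sliceDomain (doubleSector n θ) :=
    fun z hz => (mem_sliceDomain_iff hn hθ _).2 hz
  have hopen := isOpen_sliceDomain hn hθ
  have hrepr : ∀ J ∈ imagSphere n, ∀ z ∈ sector θ,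
      f (slice J z) = f₀ (z.re, z.im) + J * f₁ (z.re, z.im) :=
    fun J hJ z hz => h.repr _ (hdom z hz) J hJ
  have hdiff : ∀ A, DifferentiableOn ℂ
      (fun z : ℂ => (f₀ (z.re, z.im) A : ℂ) + (f₁ (z.re, z.im) A : ℂ) * Complex.I) (sector θ) := by
    intro A z hz
    refine DifferentiableAt.differentiableWithinAt ?_
    have hp := hdom z hz
    have d₀ := ((h.contDiff₀.differentiableOn one_ne_zero).differentiableAt
      (hopen.mem_nhds hp)).hasFDerivAt
    have d₁ := ((h.contDiff₁.differentiableOn one_ne_zero).differentiableAt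
      (hopen.mem_nhds hp)).hasFDerivAt
    have e := Complex.equivRealProdCLM.hasFDerivAt (x := z)
    let π : Cliff n →L[ℝ] ℂ := Complex.ofRealCLM.comp
      (PiLp.proj (𝕜 := ℝ) 2 (fun _ : Finset (Fin n) => ℝ) A)
    have c₀ := π.hasFDerivAt.comp z (HasFDerivAt.comp (f := Complex.equivRealProdCLM) z d₀ e)
    have c₁ := π.hasFDerivAt.comp z (HasFDerivAt.comp (f := Complex.equivRealProdCLM) z d₁ e)
    have hF := c₀.add (c₁.mul_const Complex.I)
    rw [differentiableAt_complex_iff_differentiableAt_real]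
    refine ⟨hF.differentiableAt, ?_⟩
    have cr₁ := congrArg (fun s : Cliff n => ((s A : ℝ) : ℂ)) (h.cauchyRiemann₁ _ hp)
    have cr₂ := congrArg (fun s : Cliff n => ((s A : ℝ) : ℂ)) (h.cauchyRiemann₂ _ hp)
    have key := hF.fderiv
    have k1 := congrArg (fun L : ℂ →L[ℝ] ℂ => L Complex.I) key
    have k2 := congrArg (fun L : ℂ →L[ℝ] ℂ => L 1) key
    simp [π] at k1 k2 cr₁ cr₂
    refine k1.trans ?_
    refine Eq.trans ?_ (congrArg (fun w => Complex.I • w) k2.symm)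
    simp only [smul_eq_mul]
    rw [cr₁, cr₂]
    linear_combination (-((fderiv ℝ f₁ (z.re, z.im)) (1, 0) A : ℂ)) * Complex.I_sq
  obtain ⟨K, hK0, hK⟩ := exists_norm_mul_le n
  -- Half the sum and half the difference of the values at `J` and `-J` are `f₀` and `J f₁`;
  -- multiplying by `-J` recovers `f₁`. Thus boundedness and integrability of `f` pass to its
  -- components.
  have hbound : ∀ A, ∀ J ∈ imagSphere n, ∀ z ∈ sector θ,
      ‖(f₀ (z.re, z.im) A : ℂ) + (f₁ (z.re, z.im) A : ℂ) * Complex.I‖ ≤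
        (1 + K) * (‖f (slice J z)‖ + ‖f (slice (-J) z)‖) := by
    intro A J hJ z hz
    set a := f₀ (z.re, z.im) with ha
    set b := f₁ (z.re, z.im) with hb
    have e1 := hrepr J hJ z hz
    have e2 := hrepr (-J) (neg_mem_imagSphere hJ) z hz
    rw [neg_mul] at e2
    have h1 : a = (1 / 2 : ℝ) • (f (slice J z) + f (slice (-J) z)) := by
      rw [e1, e2]; module
    have h2 : J * b = (1 / 2 : ℝ) • (f (slice J z) - f (slice (-J) z)) := by
      rw [e1, e2]; module
    have h3 : b = -(J * (J * b)) := by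
      rw [← mul_assoc, mul_self_of_mem_imagSphere hJ, neg_one_mul, neg_neg]
    have n1 : ‖a‖ ≤ ‖f (slice J z)‖ + ‖f (slice (-J) z)‖ := by
      rw [h1, norm_smul, Real.norm_of_nonneg (by norm_num)]
      linarith [norm_add_le (f (slice J z)) (f (slice (-J) z)), norm_nonneg (f (slice J z)),
        norm_nonneg (f (slice (-J) z))]
    have n2 : ‖J * b‖ ≤ ‖f (slice J z)‖ + ‖f (slice (-J) z)‖ := by
      rw [h2, norm_smul, Real.norm_of_nonneg (by norm_num)]
      linarith [norm_sub_le (f (slice J z)) (f (slice (-J) z)), norm_nonneg (f (slice J z)),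
        norm_nonneg (f (slice (-J) z))]
    have n3 : ‖b‖ ≤ K * (‖f (slice J z)‖ + ‖f (slice (-J) z)‖) := by
      have := hK J (J * b)
      rw [hJ.2.2, mul_one] at this
      rw [h3, norm_neg]
      exact this.trans (mul_le_mul_of_nonneg_left n2 hK0)
    calc _ ≤ ‖(a A : ℂ)‖ + ‖(b A : ℂ) * Complex.I‖ := norm_add_le _ _
      _ = ‖a A‖ + ‖b A‖ := by
          rw [norm_mul, Complex.norm_I, mul_one, Complex.norm_real, Complex.norm_real]
      _ ≤ ‖a‖ + ‖b‖ := add_le_add (norm_apply_le a A) (norm_apply_le b A)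
      _ ≤ _ := by linarith
  obtain ⟨J, hJ⟩ := imagSphere_nonempty hn
  refine ⟨?_, ?_, fun A => ⟨hdiff A, ?_, ?_⟩⟩
  · intro J hJ z hz
    rw [hrepr J hJ z hz]
    conv_lhs => rw [← sum_smul_basisVec (f₀ (z.re, z.im)), ← sum_smul_basisVec (f₁ (z.re, z.im)),
      Finset.mul_sum, ← Finset.sum_add_distrib]
    refine Finset.sum_congr rfl fun A _ => ?_
    rw [slice, slicePt]
    simp [add_mul, cliff_smul_mul, cliff_mul_smul]
  · intro A z hz
    have := h.even _ (hdom z hz)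
    have h' := h.odd _ (hdom z hz)
    simp only at this h'
    simp [this, h']
  · obtain ⟨B, hB⟩ := hd.1
    refine ⟨(1 + K) * (B + B), fun z hz => (hbound A J hJ z hz).trans ?_⟩
    refine mul_le_mul_of_nonneg_left (add_le_add ?_ ?_) (by linarith)
    · exact hB _ (slice_mem_doubleSector hθ hJ hz)
    · exact hB _ (slice_mem_doubleSector hθ (neg_mem_imagSphere hJ) hz)
  · intro α hα
    refine Integrable.mono' (((hd.2 J hJ α hα).add
      (hd.2 (-J) (neg_mem_imagSphere hJ) α hα)).const_mul (1 + K)) ?_ ?_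
    · refine ContinuousOn.aestronglyMeasurable ?_ measurableSet_Ioi
      exact (HolDecay.continuousOn_ray (hdiff A) hθ hα).norm.div continuousOn_id
        fun t ht => ne_of_gt ht
    · refine (ae_restrict_iff' measurableSet_Ioi).2 (Filter.Eventually.of_forall fun t ht => ?_)
      have ht0 : 0 < t := ht
      have := hbound A J hJ _ (polar_mem_sector hθ hα ht0)
      rw [slice_exp, slice_exp] at this
      rw [norm_div, norm_norm, Real.norm_of_nonneg ht0.le, Pi.add_apply, ← add_div,
        ← mul_div_assoc]
      exact div_le_div_of_nonneg_right this ht0.le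

theorem MemSH0.exists_components (hn : 1 ≤ n) {θ : ℝ} (hθ : θ ∈ Ioo 0 (Real.pi / 2))
    {f : Cliff n → Cliff n} (h : MemSH0 θ f) : ∃ F, HasComponents θ f F := by
  obtain ⟨⟨f₀, f₁, hf⟩, hd⟩ := h
  exact ⟨_, hf.hasComponents hn hθ hd⟩

theorem MemN0.exists_component (hn : 1 ≤ n) {θ : ℝ} (hθ : θ ∈ Ioo 0 (Real.pi / 2))
    {g : Cliff n → Cliff n} (h : MemN0 θ g) :
    ∃ G : ℂ → ℂ, HasComponents θ g (fun A => if A = ∅ then G else 0) ∧ HolDecay θ G ∧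
      (∀ z ∈ sector θ, G (starRingEnd ℂ z) = starRingEnd ℂ (G z)) ∧
      ∀ J ∈ imagSphere n, ∀ z ∈ sector θ, g (slice J z) = slice J (G z) := by
  obtain ⟨⟨g₀, g₁, hg⟩, hd⟩ := h
  have hc := hg.hasComponents hn hθ hd
  have heq : (fun (A : Finset (Fin n)) (z : ℂ) =>
      (((g₀ (z.re, z.im) • (1 : Cliff n)) A : ℝ) : ℂ) +
        (((g₁ (z.re, z.im) • (1 : Cliff n)) A : ℝ) : ℂ) * Complex.I) =
      fun A => if A = ∅ then
        (fun z : ℂ => (g₀ (z.re, z.im) : ℂ) + (g₁ (z.re, z.im) : ℂ) * Complex.I) else 0 := by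
    funext A z
    by_cases hA : A = ∅
    · simp [hA, one_apply]
    · simp [hA, one_apply]
  rw [heq] at hc
  refine ⟨_, hc, ?_, ?_, ?_⟩
  · simpa using hc.decay ∅
  · simpa using hc.map_conj ∅
  · intro J hJ z hz
    rw [hc.repr J hJ z hz, Finset.sum_eq_single ∅]
    · simp only [if_true]
      exact mul_one _
    · intro A _ hA
      simp [hA, slice_zero]
    · simp

/-- The converse passage, by which the remainder of the product `g f` is seen to lie in the decaying
class. -/
theorem HasComponents.memSH0 (hn : 1 ≤ n) {θ : ℝ} (hθ : θ ∈ Ioo 0 (Real.pi / 2))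
    {f : Cliff n → Cliff n} {F : Finset (Fin n) → ℂ → ℂ} (h : HasComponents θ f F) :
    MemSH0 θ f := by
  let e := Complex.equivRealProdCLM.symm
  have he : ∀ p : ℝ × ℝ, e p = ⟨p.1, p.2⟩ := fun p => rfl
  have hmem : ∀ p ∈ sliceDomain (doubleSector n θ), e p ∈ sector θ :=
    fun p hp => (mem_sliceDomain_iff hn hθ p).1 hp
  have hC : ∀ (L : ℂ →L[ℝ] ℝ), ContDiffOn ℝ 1
      (fun p => ∑ A, L (F A (e p)) • (basisVec A : Cliff n)) (sliceDomain (doubleSector n θ)) := by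
    intro L
    refine ContDiffOn.sum fun A _ => ContDiffOn.fun_smul ?_ contDiffOn_const
    have h1 : ContDiffOn ℝ 1 (F A) (sector θ) :=
      ((h.decay A).differentiableOn.contDiffOn (isOpen_sector θ)).restrict_scalars ℝ
    exact L.contDiff.comp_contDiffOn (h1.comp e.contDiff.contDiffOn hmem)
  -- Treating a general real-linear `L` covers real and imaginary parts at once; both Cauchy–Riemann
  -- equations then compare real and imaginary parts of `F'` and `i F'`.
  have hD : ∀ (L : ℂ →L[ℝ] ℝ), ∀ p ∈ sliceDomain (doubleSector n θ), ∀ v,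
      fderiv ℝ (fun p => ∑ A, L (F A (e p)) • (basisVec A : Cliff n)) p v =
        ∑ A, L (deriv (F A) (e p) * e v) • (basisVec A : Cliff n) := by
    intro L p hp v
    have h1 : ∀ A, HasFDerivAt (fun p => L (F A (e p)) • (basisVec A : Cliff n))
        (((L.comp (deriv (F A) (e p) • (1 : ℂ →L[ℝ] ℂ))).comp
          (e : ℝ × ℝ →L[ℝ] ℂ)).smulRight (basisVec A : Cliff n)) p := by
      intro A
      have h2 := ((h.decay A).differentiableOn.differentiableAt
        ((isOpen_sector θ).mem_nhds (hmem p hp))).hasDerivAt.complexToReal_fderiv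
      have h3 := (L.hasFDerivAt.comp (e p) h2).comp p e.hasFDerivAt
      exact h3.smul_const _
    have h4 := HasFDerivAt.fun_sum (u := Finset.univ) fun A _ => h1 A
    rw [h4.fderiv]
    simp
  have hrepr : ∀ p ∈ sliceDomain (doubleSector n θ), ∀ J ∈ imagSphere n,
      f (slicePt J p.1 p.2) = (∑ A, Complex.reCLM (F A (e p)) • (basisVec A : Cliff n)) +
        J * ∑ A, Complex.imCLM (F A (e p)) • (basisVec A : Cliff n) := by
    intro p hp J hJ
    rw [show slicePt J p.1 p.2 = slice J (e p) from rfl, h.repr J hJ _ (hmem p hp), Finset.mul_sum,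
      ← Finset.sum_add_distrib]
    refine Finset.sum_congr rfl fun A _ => ?_
    rw [slice, slicePt]
    simp [add_mul, cliff_smul_mul, cliff_mul_smul]
  have heconj : ∀ p : ℝ × ℝ, e (p.1, -p.2) = starRingEnd ℂ (e p) := by
    intro p
    rw [he, he]
    apply Complex.ext <;> simp
  obtain ⟨K, hK0, hK⟩ := exists_norm_mul_le n
  have hnorm : ∀ J ∈ imagSphere n, ∀ z,
      ‖∑ A, slice J (F A z) * basisVec A‖ ≤ ∑ A, K * ‖F A z‖ := by
    intro J hJ z
    refine (norm_sum_le _ _).trans (Finset.sum_le_sum fun A _ => ?_)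
    have := hK (slice J (F A z)) (basisVec A)
    rwa [norm_slice hJ, basisVec, PiLp.norm_single, norm_one, mul_one] at this
  refine ⟨⟨fun p => ∑ A, Complex.reCLM (F A (e p)) • (basisVec A : Cliff n),
    fun p => ∑ A, Complex.imCLM (F A (e p)) • (basisVec A : Cliff n),
    hC _, hC _, hrepr, ?_, ?_, ?_, ?_⟩, ?_, ?_⟩
  · intro p hp
    simp only [heconj, h.map_conj _ _ (hmem p hp)]
    simp
  · intro p hp
    simp only [heconj, h.map_conj _ _ (hmem p hp)]
    simp
  · intro p hp
    rw [hD _ p hp, hD _ p hp]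
    simp [he]
  · intro p hp
    rw [hD _ p hp, hD _ p hp]
    simp [he]
  · choose M hM using fun A => (h.decay A).bounded
    refine ⟨∑ A, K * M A, fun s hs => ?_⟩
    obtain ⟨J, hJ, z, hz, rfl⟩ := exists_slice_of_mem_doubleSector hθ hs
    rw [h.repr J hJ z hz]
    exact (hnorm J hJ z).trans
      (Finset.sum_le_sum fun A _ => mul_le_mul_of_nonneg_left (hM A z hz) hK0)
  · intro J hJ α hα
    have hcongr : EqOn (fun t : ℝ => ‖∑ A, slice J (F A (t * Complex.exp (α * Complex.I))) *
        basisVec A‖ / t) (fun t : ℝ => ‖f (t • sliceExp J α)‖ / t) (Ioi 0) := by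
      intro t ht
      simp only
      rw [← slice_exp, h.repr J hJ _ (polar_mem_sector hθ hα ht)]
    refine IntegrableOn.congr_fun ?_ hcongr measurableSet_Ioi
    refine Integrable.mono' (integrable_finsetSum Finset.univ fun A _ =>
      ((h.decay A).integrable α hα).const_mul K) ?_ ?_
    · refine ContinuousOn.aestronglyMeasurable ?_ measurableSet_Ioi
      refine ContinuousOn.div (ContinuousOn.norm (continuousOn_finsetSum _ fun A _ => ?_))
        continuousOn_id fun t ht => ne_of_gt ht
      exact (continuous_mul_basisVec A).comp_continuousOn ((continuous_slice J).comp_continuousOn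
        (HolDecay.continuousOn_ray (h.decay A).differentiableOn hθ hα))
    · refine (ae_restrict_iff' measurableSet_Ioi).2 (Filter.Eventually.of_forall fun t ht => ?_)
      have ht0 : 0 < t := ht
      rw [norm_div, norm_norm, Real.norm_of_nonneg ht0.le]
      refine (div_le_div_of_nonneg_right (hnorm J hJ _) ht0.le).trans (le_of_eq ?_)
      rw [Finset.sum_div]
      exact Finset.sum_congr rfl fun A _ => by ring

end Components

end BisectorialCalculus

end

noncomputable section

namespace BisectorialCalculus

/-! ### The resolvent of a bisectorial operator -/

section Resolvent

variable {n : ℕ} {E : Type*} [NormedAddCommGroup E] [NormedSpace ℝ E]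

theorem op_mul_smul (a : ℝ) (A B : CliffMod n E →L[ℝ] CliffMod n E) :
    A * (a • B) = a • (A * B) := by
  ext1 v
  exact map_smul A a (B v)

theorem op_smul_mul (a : ℝ) (A B : CliffMod n E →L[ℝ] CliffMod n E) :
    (a • A) * B = a • (A * B) := rfl

/-- Recovers `R` from `-2 c R J` if `J² = -1`. -/
theorem eq_smul_mul_of_sq_eq_neg_one {R J D : CliffMod n E →L[ℝ] CliffMod n E} {c : ℝ}
    (hc : c ≠ 0) (hJ : J * J = -1) (hD : D = (-2 * c) • (R * J)) :
    R = (2 * c)⁻¹ • (D * J) := by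
  subst hD
  ext1 v
  have h1 : J (J v) = -v := congrArg (fun A => A v) hJ
  change R v = (2 * c)⁻¹ • (-2 * c) • R (J (J v))
  rw [h1, map_neg, smul_smul, ← neg_smul_neg, neg_neg]
  have h2 : -((2 * c)⁻¹ * (-2 * c)) = 1 := by field_simp
  rw [h2, one_smul]

theorem rmul_basisVec_sq (i : Fin n) :
    (rmul (basisVec {i}) : CliffMod n E →L[ℝ] CliffMod n E) * rmul (basisVec {i}) = -1 := by
  have h1 : ∀ (v : CliffMod n E) (C : Finset (Fin n)),
      rmul (basisVec {i} : Cliff n) v C = sgn (symmDiff {i} C) {i} • v (symmDiff {i} C) := by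
    intro v C
    rw [rmul_apply, Finset.sum_eq_single {i}]
    · simp [basisVec_apply]
    · intro B _ hB
      simp [basisVec_apply, hB]
    · simp
  ext v C
  change rmul (basisVec {i} : Cliff n) (rmul (basisVec {i} : Cliff n) v) C = -(v C)
  rw [h1, h1, smul_smul, symmDiff_symmDiff_cancel_left, sgn_symmDiff_left, mul_assoc, sgn_mul_self]
  simp [sgn]

/-- The action of the complex numbers on `V` by right multiplication with elements of `ℂ_{e_1}`. -/
def rightAction (n : ℕ) (E : Type*) [NormedAddCommGroup E] [NormedSpace ℝ E] (hn : 1 ≤ n) :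
    ℂ →ₐ[ℝ] (CliffMod n E →L[ℝ] CliffMod n E) :=
  Complex.lift ⟨rmul (basisVec {⟨0, hn⟩}), rmul_basisVec_sq _⟩

theorem rightAction_apply (hn : 1 ≤ n) (c : ℂ) (v : CliffMod n E) :
    rightAction n E hn c v = c.re • v + c.im • rmul (basisVec {⟨0, hn⟩} : Cliff n) v := by
  have h1 : rightAction n E hn Complex.I = rmul (basisVec {⟨0, hn⟩}) := by
    rw [rightAction, Complex.lift_apply, Complex.liftAux_apply_I]
  rw [algHom_complex_apply, h1]
  rfl

theorem quadInverse_spec {T : ClosedOperator n E} {a b : ℝ} (h : ∃ B, IsQuadInverse T a b B) :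
    IsQuadInverse T a b (quadInverse T a b) := by
  rw [quadInverse, dif_pos h]
  exact h.choose_spec

theorem quadInverse_mem (T : ClosedOperator n E) (a b : ℝ) (v : CliffMod n E) :
    quadInverse T a b v ∈ T.toPMap.domain := by
  unfold quadInverse
  -- Without a bounded inverse the operator is `0`, whose range lies in every domain. Hence
  -- `opQuadInverse` needs no hypothesis.
  split_ifs with h
  · exact sqDomain_le T (h.choose_spec.mem v)
  · simp

theorem rmul_mem_graph (T : ClosedOperator n E) (c : Cliff n) {x y : CliffMod n E}
    (h : (x, y) ∈ T.toPMap.graph) : (rmul c x, rmul c y) ∈ T.toPMap.graph := by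
  obtain ⟨⟨x, hx⟩, rfl, rfl⟩ := (LinearPMap.mem_graph_iff _).1 h
  rw [LinearPMap.mem_graph_iff]
  exact ⟨⟨rmul c x, T.rmul_mem c x hx⟩, rfl, T.map_rmul c ⟨x, hx⟩⟩

theorem rightAction_mem_graph (T : ClosedOperator n E) (hn : 1 ≤ n) (c : ℂ) {x y : CliffMod n E}
    (h : (x, y) ∈ T.toPMap.graph) :
    (rightAction n E hn c x, rightAction n E hn c y) ∈ T.toPMap.graph := by
  rw [rightAction_apply, rightAction_apply]
  exact T.toPMap.graph.add_mem (T.toPMap.graph.smul_mem c.re h)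
    (T.toPMap.graph.smul_mem c.im (rmul_mem_graph T _ h))

namespace IsQuadInverse

variable {T : ClosedOperator n E} {a b : ℝ}

/-- The formulation through the graph of `T` lets relations be added and scaled linearly, with no
domain membership to carry along. -/
theorem quad_left_inv (h : IsQuadInverse T a b (quadInverse T a b)) {x y z : CliffMod n E}
    (hxy : (x, y) ∈ T.toPMap.graph) (hyz : (y, z) ∈ T.toPMap.graph) :
    quadInverse T a b (z - (2 * a) • y + b • x) = x := by
  obtain ⟨⟨x, hx⟩, rfl, rfl⟩ := (LinearPMap.mem_graph_iff _).1 hxy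
  obtain ⟨⟨y, hy⟩, h1, rfl⟩ := (LinearPMap.mem_graph_iff _).1 hyz
  simp only at h1
  subst h1
  exact h.left_inv ⟨x, ⟨⟨x, hx⟩, hy, rfl⟩⟩

theorem comm_rightAction (h : IsQuadInverse T a b (quadInverse T a b)) (hn : 1 ≤ n) (c : ℂ)
    (v : CliffMod n E) : quadInverse T a b (rightAction n E hn c v) =
      rightAction n E hn c (quadInverse T a b v) := by
  rw [rightAction_apply, rightAction_apply, map_add, map_smul, map_smul, h.map_rmul]

end IsQuadInverse

section

variable {hn : 1 ≤ n}

theorem rightAction_mul_apply (c d : ℂ) (v : CliffMod n E) :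
    rightAction n E hn c (rightAction n E hn d v) = rightAction n E hn (c * d) v := by
  rw [map_mul]; rfl

theorem rightAction_ofReal (a : ℝ) (v : CliffMod n E) : rightAction n E hn a v = a • v := by
  rw [rightAction_apply]
  simp

theorem rightAction_add (c d : ℂ) (v : CliffMod n E) :
    rightAction n E hn c v + rightAction n E hn d v = rightAction n E hn (c + d) v := by
  rw [map_add]; rfl

theorem rightAction_normSq (z : ℂ) (v : CliffMod n E) :
    rightAction n E hn z (rightAction n E hn (starRingEnd ℂ z) v) = (‖z‖ ^ 2) • v := by
  rw [rightAction_mul_apply, Complex.mul_conj', ← rightAction_ofReal (hn := hn)]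
  norm_cast

theorem rightAction_trace (z : ℂ) (v : CliffMod n E) :
    rightAction n E hn z v + rightAction n E hn (starRingEnd ℂ z) v = (2 * z.re) • v := by
  rw [rightAction_add, Complex.add_conj, ← rightAction_ofReal (hn := hn)]

end

variable [CompleteSpace E]

/-- `T (T² - 2 a T + b)⁻¹`. -/
def opQuadInverse (T : ClosedOperator n E) (a b : ℝ) : CliffMod n E →L[ℝ] CliffMod n E :=
  compBounded T (quadInverse T a b) (quadInverse_mem T a b)

theorem quadInverse_mem_graph (T : ClosedOperator n E) (a b : ℝ) (v : CliffMod n E) :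
    (quadInverse T a b v, opQuadInverse T a b v) ∈ T.toPMap.graph := by
  rw [opQuadInverse, compBounded_apply]
  exact T.toPMap.mem_graph ⟨_, quadInverse_mem T a b v⟩

namespace IsQuadInverse

variable {T : ClosedOperator n E} {a b : ℝ}

theorem opQuadInverse_mem_graph (h : IsQuadInverse T a b (quadInverse T a b))
    (v : CliffMod n E) : (opQuadInverse T a b v,
      v + (2 * a) • opQuadInverse T a b v - b • quadInverse T a b v) ∈ T.toPMap.graph := by
  have h1 := h.right_inv v
  unfold quadOp at h1
  have h2 : opQuadInverse T a b v = T.toPMap ⟨quadInverse T a b v, sqDomain_le T (h.mem v)⟩ := rfl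
  rw [h2]
  have h3 := T.toPMap.mem_graph ⟨_, sqDomain_map T ⟨quadInverse T a b v, h.mem v⟩⟩
  convert h3 using 2
  nth_rw 1 [← h1]
  abel

/-- The inverse of `T² - 2 a T + b` commutes with `T` on its domain. For `v` in the domain, `T² Q⁻¹
v` is a combination of `v`, `T Q⁻¹ v` and `Q⁻¹ v`, so `T Q⁻¹ v` lies in the domain of `T²` and the
left inverse can be applied to it. -/
theorem opQuadInverse_eq (h : IsQuadInverse T a b (quadInverse T a b)) {v w : CliffMod n E}
    (hvw : (v, w) ∈ T.toPMap.graph) : opQuadInverse T a b v = quadInverse T a b w := by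
  have g1 := quadInverse_mem_graph T a b v
  have g2 := h.opQuadInverse_mem_graph v
  have g3 := T.toPMap.graph.sub_mem (T.toPMap.graph.add_mem hvw
    (T.toPMap.graph.smul_mem (2 * a) g2)) (T.toPMap.graph.smul_mem b g1)
  have g4 := h.quad_left_inv g2 g3
  rw [← g4]
  congr 1
  change w + (2 * a) • (v + (2 * a) • opQuadInverse T a b v - b • quadInverse T a b v) -
    b • opQuadInverse T a b v - (2 * a) • (v + (2 * a) • opQuadInverse T a b v - b • quadInverse T a b v) +
    b • opQuadInverse T a b v = w
  abel

theorem op_comm_rightAction (h : IsQuadInverse T a b (quadInverse T a b)) (hn : 1 ≤ n) (c : ℂ)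
    (v : CliffMod n E) : opQuadInverse T a b (rightAction n E hn c v) =
      rightAction n E hn c (opQuadInverse T a b v) := by
  have g1 := quadInverse_mem_graph T a b (rightAction n E hn c v)
  rw [h.comm_rightAction hn] at g1
  exact T.toPMap.mem_graph_snd_inj g1
    (rightAction_mem_graph T hn c (quadInverse_mem_graph T a b v)) rfl

end IsQuadInverse

/-- The resolvent `(z - T)⁻¹` with respect to the complex structure of `V` given by
`rightAction`. -/
def sliceResolvent (T : ClosedOperator n E) (hn : 1 ≤ n) (z : ℂ) :
    CliffMod n E →L[ℝ] CliffMod n E :=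
  quadInverse T z.re (‖z‖ ^ 2) * rightAction n E hn (starRingEnd ℂ z) -
    opQuadInverse T z.re (‖z‖ ^ 2)

variable {T : ClosedOperator n E} {hn : 1 ≤ n}

theorem sliceResolvent_apply (z : ℂ) (v : CliffMod n E) : sliceResolvent T hn z v =
    quadInverse T z.re (‖z‖ ^ 2) (rightAction n E hn (starRingEnd ℂ z) v) -
      opQuadInverse T z.re (‖z‖ ^ 2) v := rfl

/-- The points at which `T² - 2 (Re z) T + |z|²` is boundedly invertible. -/
def IsRegular (T : ClosedOperator n E) (z : ℂ) : Prop :=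
  IsQuadInverse T z.re (‖z‖ ^ 2) (quadInverse T z.re (‖z‖ ^ 2))

namespace IsRegular

variable {z w : ℂ}

theorem comm (h : IsRegular T z) (c : ℂ) :
    rightAction n E hn c * sliceResolvent T hn z = sliceResolvent T hn z * rightAction n E hn c := by
  ext1 v
  change rightAction n E hn c (sliceResolvent T hn z v) =
    sliceResolvent T hn z (rightAction n E hn c v)
  rw [sliceResolvent_apply, sliceResolvent_apply, map_sub, h.op_comm_rightAction hn,
    rightAction_mul_apply, ← h.comm_rightAction hn, rightAction_mul_apply,
    mul_comm c (starRingEnd ℂ z)]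

/-- The right-inverse relation `T ρ v = z ρ v - v`. Complex numbers act by operators commuting with
`Q⁻¹` and `T Q⁻¹`, so `z z̄ = |z|²` and `z + z̄ = 2 Re z` reduce it to `Q Q⁻¹ = 1`. -/
theorem sliceResolvent_mem_graph (h : IsRegular T z) (v : CliffMod n E) :
    (sliceResolvent T hn z v, rightAction n E hn z (sliceResolvent T hn z v) - v) ∈
      T.toPMap.graph := by
  have g := T.toPMap.graph.sub_mem
    (quadInverse_mem_graph T z.re (‖z‖ ^ 2) (rightAction n E hn (starRingEnd ℂ z) v))
    (h.opQuadInverse_mem_graph v)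
  convert g using 1
  refine Prod.ext rfl ?_
  change rightAction n E hn z (sliceResolvent T hn z v) - v = opQuadInverse T z.re (‖z‖ ^ 2) (rightAction n E hn (starRingEnd ℂ z) v) -
    (v + (2 * z.re) • opQuadInverse T z.re (‖z‖ ^ 2) v - ‖z‖ ^ 2 • quadInverse T z.re (‖z‖ ^ 2) v)
  rw [sliceResolvent_apply, map_sub, h.comm_rightAction hn, rightAction_normSq,
    h.op_comm_rightAction hn, ← rightAction_trace (hn := hn)]
  abel

theorem sliceResolvent_left_inv (h : IsRegular T z) {v y : CliffMod n E}
    (hv : (v, y) ∈ T.toPMap.graph) :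
    sliceResolvent T hn z (rightAction n E hn z v - y) = v := by
  have e1 := h.opQuadInverse_eq hv
  have g1 := quadInverse_mem_graph T z.re (‖z‖ ^ 2) y
  rw [← e1] at g1
  have e2 := T.toPMap.mem_graph_snd_inj g1 (h.opQuadInverse_mem_graph v) rfl
  rw [map_sub, sliceResolvent_apply, sliceResolvent_apply, h.comm_rightAction hn,
    h.comm_rightAction hn _ y, ← e1, e2, h.op_comm_rightAction hn, h.comm_rightAction hn,
    rightAction_mul_apply, mul_comm, ← rightAction_mul_apply, rightAction_normSq,
    ← rightAction_trace (hn := hn)]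
  abel

/-- Apply the left inverse at `z` to `ρ(w) v`, using `T ρ(w) v = w ρ(w) v - v`. -/
theorem sub_eq (hz : IsRegular T z) (hw : IsRegular T w) :
    sliceResolvent T hn z - sliceResolvent T hn w =
      rightAction n E hn (w - z) * (sliceResolvent T hn z * sliceResolvent T hn w) := by
  rw [← mul_assoc, hz.comm]
  ext1 v
  change sliceResolvent T hn z v - sliceResolvent T hn w v =
    sliceResolvent T hn z (rightAction n E hn (w - z) (sliceResolvent T hn w v))
  have h1 := hz.sliceResolvent_left_inv (hn := hn) (hw.sliceResolvent_mem_graph (hn := hn) v)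
  have h2 : rightAction n E hn (w - z) (sliceResolvent T hn w v) =
      rightAction n E hn w (sliceResolvent T hn w v) -
        rightAction n E hn z (sliceResolvent T hn w v) := by
    rw [map_sub]; rfl
  rw [map_sub, map_sub] at h1
  rw [h2, map_sub]
  refine (sub_right_inj.2 h1.symm).trans ?_
  abel

/-- The operators `Q⁻¹` and `T Q⁻¹` depend only on `Re z` and `|z|`, so the second one cancels. Off
the real axis `Q⁻¹`, and then `T Q⁻¹`, can thus be recovered from resolvents. -/
theorem sliceResolvent_conj_sub :
    sliceResolvent T hn z - sliceResolvent T hn (starRingEnd ℂ z) =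
      (-2 * z.im) • (quadInverse T z.re (‖z‖ ^ 2) * rightAction n E hn Complex.I) := by
  have h1 : starRingEnd ℂ z - z = ((-2 * z.im : ℝ) : ℂ) * Complex.I := by
    apply Complex.ext <;> simp
    ring
  rw [sliceResolvent, sliceResolvent, Complex.conj_re, Complex.norm_conj, Complex.conj_conj,
    sub_sub_sub_cancel_right, ← mul_sub, ← map_sub, h1, ← Complex.real_smul, map_smul,
    op_mul_smul]

theorem quadInverse_eq (hz : z.im ≠ 0) : quadInverse T z.re (‖z‖ ^ 2) = (2 * z.im)⁻¹ •
    ((sliceResolvent T hn z - sliceResolvent T hn (starRingEnd ℂ z)) *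
      rightAction n E hn Complex.I) := by
  refine eq_smul_mul_of_sq_eq_neg_one hz ?_ sliceResolvent_conj_sub
  rw [← map_mul, Complex.I_mul_I, map_neg, map_one]

theorem opQuadInverse_eq' : opQuadInverse T z.re (‖z‖ ^ 2) =
    quadInverse T z.re (‖z‖ ^ 2) * rightAction n E hn (starRingEnd ℂ z) -
      sliceResolvent T hn z := by
  rw [sliceResolvent]; abel

end IsRegular

theorem leftResolvent_slice {J : Cliff n} (hJ : J ∈ imagSphere n) (z : ℂ) :
    leftResolvent T (slice J z) =
      quadInverse T z.re (‖z‖ ^ 2) * lmul (slice J (starRingEnd ℂ z)) -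
        opQuadInverse T z.re (‖z‖ ^ 2) := by
  have hq : resolventQ T (slice J z) = quadInverse T z.re (‖z‖ ^ 2) := by
    rw [resolventQ, slice_apply_empty hJ, norm_slice hJ]
  ext1 v
  have h1 : leftResolvent T (slice J z) v = resolventQ T (slice J z) (lmul (conj (slice J z)) v) -
      T.toPMap ⟨resolventQ T (slice J z) v, resolventQ_mem T (slice J z) v⟩ := rfl
  have h2 : opQuadInverse T z.re (‖z‖ ^ 2) v =
    T.toPMap ⟨quadInverse T z.re (‖z‖ ^ 2) v, quadInverse_mem T _ _ v⟩ := rfl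
  rw [h1]
  simp only [hq, conj_slice hJ, ← h2]
  rfl

variable {ω : ℝ}

theorem IsBisectorial.isRegular (hT : IsBisectorial T ω) (hω : ω ∈ Ioo 0 (Real.pi / 2))
    (hn : 1 ≤ n) {z : ℂ} (hz : z ∈ cosector ω) : IsRegular T z := by
  obtain ⟨J, hJ⟩ := imagSphere_nonempty hn
  have h1 : slice J z ∈ resolventSet T := by
    by_contra hcon
    exact slice_not_mem_closure hω hJ hz (hT.1 ⟨slice_mem_paravectors hJ z, hcon⟩)
  have h2 := h1.2
  rw [slice_apply_empty hJ, norm_slice hJ] at h2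
  exact quadInverse_spec h2

theorem conj_mem_cosector {z : ℂ} (hz : z ∈ cosector ω) : starRingEnd ℂ z ∈ cosector ω := by
  simpa [cosector] using hz

theorem IsBisectorial.exists_norm_leftResolvent_le (hT : IsBisectorial T ω) (hω : 0 < ω) {ψ : ℝ}
    (hψ : ψ ∈ Ioo ω (Real.pi / 2)) : ∃ C : ℝ, 0 ≤ C ∧ ∀ J ∈ imagSphere n, ∀ z ∈ cosector ψ,
      ‖leftResolvent T (slice J z)‖ ≤ C / ‖z‖ := by
  obtain ⟨C, hC0, hC⟩ := hT.2 ψ hψ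
  have hψ' : ψ ∈ Ioo 0 (Real.pi / 2) := ⟨hω.trans hψ.1, hψ.2⟩
  refine ⟨C, hC0, fun J hJ z hz => ?_⟩
  rw [← norm_slice hJ z]
  refine hC _ ⟨slice_mem_paravectors hJ z, ?_⟩
  rintro (h | h)
  · exact slice_not_mem_closure hψ' hJ hz (subset_closure h)
  · apply ne_zero_of_mem_cosector hz
    rw [← norm_eq_zero, ← norm_slice hJ z, mem_singleton_iff.1 h, norm_zero]

theorem sin_mul_norm_le {ψ : ℝ} (hψ : ψ ∈ Ioo 0 (Real.pi / 2)) {z : ℂ} (hz : z ∈ cosector ψ) :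
    Real.sin ψ * ‖z‖ ≤ |z.im| := by
  have hs : 0 < Real.sin ψ := Real.sin_pos_of_pos_of_lt_pi hψ.1 (by linarith [hψ.2, Real.pi_pos])
  have hz' : |z.re| * Real.sin ψ ≤ |z.im| * Real.cos ψ := le_of_lt hz
  have hn : ‖z‖ ^ 2 = z.re ^ 2 + z.im ^ 2 := by rw [Complex.sq_norm, Complex.normSq_apply]; ring
  refine (sq_le_sq₀ (by positivity) (abs_nonneg _)).1 ?_
  have h2 := mul_self_le_mul_self (by positivity) hz'
  rw [mul_pow, hn, sq_abs]
  have h3 : |z.im| * |z.im| = z.im ^ 2 := by rw [← sq_abs z.im]; ring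
  have h4 : |z.re| * |z.re| = z.re ^ 2 := by rw [← sq_abs z.re]; ring
  nlinarith [Real.sin_sq_add_cos_sq ψ]

/-- The hypothesis bounds `S_L⁻¹`, where `z̄` acts from the left. Since `S_L⁻¹(s) - S_L⁻¹(s̄) = -2
(Im z) Q⁻¹ J` and `|Im z| ≥ sin ψ |z|`, it yields `‖Q⁻¹‖ = O(|z|⁻²)`, then `‖T Q⁻¹‖ = O(|z|⁻¹)`, and
these two bounds control the resolvent for the right action. -/
theorem IsBisectorial.sectorialResolvent (hT : IsBisectorial T ω)
    (hω : ω ∈ Ioo 0 (Real.pi / 2)) (hn : 1 ≤ n) :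
    SectorialResolvent ω (rightAction n E hn) (sliceResolvent T hn) where
  comm z hz c := (hT.isRegular hω hn hz).comm c
  sub_eq z hz w hw := (hT.isRegular hω hn hz).sub_eq (hT.isRegular hω hn hw)
  bound ψ hψ := by
    have hψ' : ψ ∈ Ioo 0 (Real.pi / 2) := ⟨hω.1.trans hψ.1, hψ.2⟩
    obtain ⟨C, hC0, hC⟩ := hT.exists_norm_leftResolvent_le hω.1 hψ
    obtain ⟨K, hK0, hK⟩ := exists_norm_lmul_le n E
    obtain ⟨K', hK0', hK'⟩ := exists_norm_algHom_le (rightAction n E hn)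
    obtain ⟨J, hJ⟩ := imagSphere_nonempty hn
    have hs : 0 < Real.sin ψ :=
      Real.sin_pos_of_pos_of_lt_pi hψ'.1 (by linarith [hψ.2, Real.pi_pos])
    refine ⟨C * K / Real.sin ψ * K' + (C * K / Real.sin ψ * K + C), fun z hz => ?_⟩
    have hz0 : 0 < ‖z‖ := norm_pos_iff.2 (ne_zero_of_mem_cosector hz)
    set R := quadInverse T z.re (‖z‖ ^ 2) with hR
    have him : 0 < |z.im| := lt_of_lt_of_le (by positivity) (sin_mul_norm_le hψ' hz)
    have him0 : z.im ≠ 0 := abs_pos.1 him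
    have hL1 := leftResolvent_slice (T := T) hJ z
    have hL2 := leftResolvent_slice (T := T) hJ (starRingEnd ℂ z)
    rw [Complex.conj_re, Complex.norm_conj, Complex.conj_conj] at hL2
    have hb1 := hC J hJ z hz
    have hb2 := hC J hJ _ (conj_mem_cosector hz)
    rw [Complex.norm_conj] at hb2
    have hJJ : (lmul J : CliffMod n E →L[ℝ] CliffMod n E) * lmul J = -1 := by
      rw [← lmul_mul_eq, mul_self_of_mem_imagSphere hJ, ← lmulLin_apply, map_neg, lmulLin_apply,
        lmul_one_eq]
    have hdiff : leftResolvent T (slice J z) - leftResolvent T (slice J (starRingEnd ℂ z)) =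
        (-2 * z.im) • (R * lmul J) := by
      rw [hL1, hL2, sub_sub_sub_cancel_right, ← mul_sub, ← lmulLin_apply, ← lmulLin_apply,
        ← map_sub]
      have : slice J (starRingEnd ℂ z) - slice J z = (-2 * z.im) • J := by
        simp only [slice, slicePt, Complex.conj_re, Complex.conj_im]
        module
      rw [this, map_smul, op_mul_smul, lmulLin_apply]
    have hReq : R = (2 * z.im)⁻¹ • ((leftResolvent T (slice J z) -
        leftResolvent T (slice J (starRingEnd ℂ z))) * lmul J) :=
      eq_smul_mul_of_sq_eq_neg_one him0 hJJ hdiff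
    have hKJ : ‖(lmul J : CliffMod n E →L[ℝ] CliffMod n E)‖ ≤ K := by
      have := hK J
      rwa [hJ.2.2, mul_one] at this
    have hRn : ‖R‖ ≤ C * K / Real.sin ψ / ‖z‖ ^ 2 := by
      have h1 : ‖leftResolvent T (slice J z) - leftResolvent T (slice J (starRingEnd ℂ z))‖ ≤
          C / ‖z‖ + C / ‖z‖ := (norm_sub_le _ _).trans (add_le_add hb1 hb2)
      calc ‖R‖ ≤ |2 * z.im|⁻¹ * ((C / ‖z‖ + C / ‖z‖) * K) := by
            rw [hReq, norm_smul, norm_inv, Real.norm_eq_abs]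
            refine mul_le_mul_of_nonneg_left ?_ (by positivity)
            exact (norm_mul_le _ _).trans (mul_le_mul h1 hKJ (norm_nonneg _) (by positivity))
        _ = C * K / (|z.im| * ‖z‖) := by
            rw [abs_mul, abs_two]; field_simp; ring
        _ ≤ C * K / (Real.sin ψ * ‖z‖ * ‖z‖) := by
            refine div_le_div_of_nonneg_left (by positivity) (by positivity) ?_
            exact mul_le_mul_of_nonneg_right (sin_mul_norm_le hψ' hz) hz0.le
        _ = C * K / Real.sin ψ / ‖z‖ ^ 2 := by field_simp
    have hPeq : opQuadInverse T z.re (‖z‖ ^ 2) =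
        R * lmul (slice J (starRingEnd ℂ z)) - leftResolvent T (slice J z) := by
      rw [hL1]; abel
    have hPn : ‖opQuadInverse T z.re (‖z‖ ^ 2)‖ ≤ (C * K / Real.sin ψ * K + C) / ‖z‖ := by
      have h1 := hK (slice J (starRingEnd ℂ z))
      rw [norm_slice hJ, Complex.norm_conj] at h1
      calc ‖opQuadInverse T z.re (‖z‖ ^ 2)‖
          ≤ (C * K / Real.sin ψ / ‖z‖ ^ 2) * (K * ‖z‖) + C / ‖z‖ := by
            rw [hPeq]
            refine (norm_sub_le _ _).trans (add_le_add ?_ hb1)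
            exact (norm_mul_le _ _).trans (mul_le_mul hRn h1 (norm_nonneg _) (by positivity))
        _ = _ := by field_simp
    have h2 := hK' (starRingEnd ℂ z)
    rw [Complex.norm_conj] at h2
    calc ‖z‖ * ‖sliceResolvent T hn z‖
        ≤ ‖z‖ * ((C * K / Real.sin ψ / ‖z‖ ^ 2) * (K' * ‖z‖) +
          (C * K / Real.sin ψ * K + C) / ‖z‖) := by
          refine mul_le_mul_of_nonneg_left ?_ hz0.le
          refine (norm_sub_le _ _).trans (add_le_add ?_ hPn)
          exact (norm_mul_le _ _).trans (mul_le_mul hRn h2 (norm_nonneg _) (by positivity))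
      _ = _ := by field_simp

end Resolvent

end BisectorialCalculus

end

noncomputable section

namespace BisectorialCalculus

/-! ### The `ω`-functional calculus in terms of the holomorphic functional calculus -/

theorem integral_eq_add_integral_Ioi {X : Type*} [NormedAddCommGroup X] [NormedSpace ℝ X]
    {h g₁ g₂ : ℝ → X} (h₁ : ∀ t, 0 < t → h t = g₁ t) (h₂ : ∀ t, 0 < t → h (-t) = g₂ t)
    (i₁ : IntegrableOn g₁ (Ioi 0)) (i₂ : IntegrableOn g₂ (Ioi 0)) :
    ∫ t, h t = (∫ t in Ioi 0, g₁ t) + ∫ t in Ioi 0, g₂ t := by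
  have e₁ : EqOn h g₁ (Ioi 0) := h₁
  have e₂ : EqOn (fun t => h (-t)) g₂ (Ioi 0) := h₂
  have j₁ : IntegrableOn h (Ioi 0) := i₁.congr_fun e₁.symm measurableSet_Ioi
  have j₂ : IntegrableOn h (Iic 0) := by
    rw [integrableOn_Iic_iff_integrableOn_Iio]
    have := i₂.congr_fun e₂.symm measurableSet_Ioi
    rw [← (Measure.measurePreserving_neg volume).integrableOn_comp_preimage
      (Homeomorph.neg ℝ).measurableEmbedding]
    change IntegrableOn (fun t => h (-t)) ((fun t : ℝ => -t) ⁻¹' Iio 0)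
    have e : (fun t : ℝ => -t) ⁻¹' Iio 0 = Ioi 0 := by ext; simp
    rwa [e]
  rw [← intervalIntegral.integral_Iic_add_Ioi j₂ j₁, add_comm, setIntegral_congr_fun
    measurableSet_Ioi e₁, ← setIntegral_congr_fun measurableSet_Ioi e₂, integral_comp_neg_Ioi,
    neg_zero]

section

variable {n : ℕ} {E : Type*} [NormedAddCommGroup E] [NormedSpace ℝ E] {J : Cliff n}

theorem pathIntegral_eq_add (hJ : J ∈ imagSphere n) {γ : ℝ → Cliff n} {d d' : ℂ}
    (hγ : ∀ t : ℝ, 0 < t → γ t = slice J (t * d))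
    (hγ' : ∀ t : ℝ, 0 < t → γ (-t) = slice J (t * d'))
    {S : Cliff n → (CliffMod n E →L[ℝ] CliffMod n E)} {f : Cliff n → Cliff n}
    (i : IntegrableOn (fun t : ℝ => S (slice J (t * d)) ∘L
      lmul (slice J (d * -Complex.I) * f (slice J (t * d)))) (Ioi 0))
    (i' : IntegrableOn (fun t : ℝ => S (slice J (t * d')) ∘L
      lmul (slice J (-d' * -Complex.I) * f (slice J (t * d')))) (Ioi 0)) :
    pathIntegral J γ S f =
      (∫ t in Ioi (0 : ℝ), S (slice J (t * d)) ∘L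
        lmul (slice J (d * -Complex.I) * f (slice J (t * d)))) +
      ∫ t in Ioi (0 : ℝ), S (slice J (t * d')) ∘L
        lmul (slice J (-d' * -Complex.I) * f (slice J (t * d'))) := by
  have hd : ∀ t : ℝ, 0 < t → deriv γ t = slice J d := fun t ht => by
    have h1 : γ =ᶠ[nhds t] fun s => s • slice J d := by
      filter_upwards [lt_mem_nhds ht] with s hs
      rw [hγ s hs, slice_smul]
    rw [h1.deriv_eq]
    simpa using ((hasDerivAt_id t).smul_const (slice J d)).deriv
  -- On the negative half-line `γ (-t) = t d'`, so the velocity is `-d'`: this ray is traversed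
  -- towards `0`.
  have hd' : ∀ t : ℝ, 0 < t → deriv γ (-t) = slice J (-d') := fun t ht => by
    have h1 : γ =ᶠ[nhds (-t)] fun s => s • slice J (-d') := by
      filter_upwards [gt_mem_nhds (neg_lt_zero.2 ht)] with s hs
      have := hγ' (-s) (neg_pos.2 hs)
      rw [neg_neg] at this
      rw [this, slice_smul, slice_neg, smul_neg, neg_smul]
    rw [h1.deriv_eq]
    simpa using ((hasDerivAt_id (-t)).smul_const (slice J (-d'))).deriv
  refine integral_eq_add_integral_Ioi (fun t ht => ?_) (fun t ht => ?_) i i'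
  · rw [hγ t ht, hd t ht, slice_mul hJ d, slice_neg, slice_I]
  · rw [hγ' t ht, hd' t ht, slice_mul hJ (-d'), slice_neg J Complex.I, slice_I]

theorem contourDir_one (φ : ℝ) : contourDir φ 1 = starRingEnd ℂ (contourDir φ 0) := by
  simp [contourDir, contourAngle, ← Complex.exp_conj]

theorem contourDir_three (φ : ℝ) : contourDir φ 3 = starRingEnd ℂ (contourDir φ 2) := by
  have h1 : (((Real.pi + φ : ℝ) : ℂ)) * Complex.I =
      -((Real.pi - φ : ℝ) : ℂ) * Complex.I + 2 * Real.pi * Complex.I := by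
    push_cast; ring
  simp only [contourDir, contourAngle, Matrix.cons_val]
  rw [h1, Complex.exp_add, Complex.exp_two_pi_mul_I, mul_one, ← Complex.exp_conj]
  congr 1
  simp
  ring

theorem boundaryCurve_of_pos (φ : ℝ) {t : ℝ} (ht : 0 < t) :
    boundaryCurve J φ t = slice J (t * contourDir φ 0) := by
  rw [boundaryCurve, Real.sign_of_pos ht, abs_of_pos ht, one_mul, contourDir, slice_exp]
  rfl

theorem boundaryCurve_neg_of_pos (φ : ℝ) {t : ℝ} (ht : 0 < t) :
    boundaryCurve J φ (-t) = slice J (t * contourDir φ 1) := by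
  rw [boundaryCurve, Real.sign_of_neg (neg_lt_zero.2 ht), abs_neg, abs_of_pos ht, contourDir,
    slice_exp]
  simp [contourAngle]

theorem neg_boundaryCurve_of_pos (φ : ℝ) {t : ℝ} (ht : 0 < t) :
    -boundaryCurve J φ t = slice J (t * contourDir φ 2) := by
  have h := mul_exp_add_pi t (-φ)
  rw [boundaryCurve_of_pos φ ht, ← slice_neg]
  congr 1
  simp only [contourDir, contourAngle, Matrix.cons_val]
  rw [← h]
  congr 4
  ring

theorem neg_boundaryCurve_neg_of_pos (φ : ℝ) {t : ℝ} (ht : 0 < t) :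
    -boundaryCurve J φ (-t) = slice J (t * contourDir φ 3) := by
  have h := mul_exp_add_pi t φ
  rw [boundaryCurve_neg_of_pos φ ht, ← slice_neg]
  congr 1
  simp only [contourDir, contourAngle, Matrix.cons_val]
  rw [← h]
  congr 4
  ring

variable {T : ClosedOperator n E}

theorem IsRegular.conj {z : ℂ} (hz : IsRegular T z) : IsRegular T (starRingEnd ℂ z) := by
  unfold IsRegular at *
  rwa [Complex.conj_re, Complex.norm_conj]

theorem lmul_slice_trace (z : ℂ) (v : CliffMod n E) :
    lmul (slice J z) v + lmul (slice J (starRingEnd ℂ z)) v = (2 * z.re) • v := by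
  have h1 : slice J z + slice J (starRingEnd ℂ z) = (2 * z.re) • (1 : Cliff n) := by
    rw [← slice_add, Complex.add_conj]
    exact_mod_cast slice_ofReal J (2 * z.re)
  have h2 : (lmul (slice J z) : CliffMod n E →L[ℝ] CliffMod n E) +
      lmul (slice J (starRingEnd ℂ z)) = (2 * z.re) • 1 := by
    rw [← lmulLin_apply, ← lmulLin_apply, ← map_add, h1, map_smul, lmulLin_apply, lmul_one_eq]
  exact congrArg (fun A => A v) h2

variable [CompleteSpace E]

/-- The left resolvent and the holomorphic resolvent agree after symmetrisation under complex
conjugation. -/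
theorem leftResolvent_add_conj (hn : 1 ≤ n) (hJ : J ∈ imagSphere n) {z : ℂ} (hz : IsRegular T z)
    (w : ℂ) :
    leftResolvent T (slice J z) * lmul (slice J w) +
        leftResolvent T (slice J (starRingEnd ℂ z)) * lmul (slice J (starRingEnd ℂ w)) =
      rightAction n E hn w * sliceResolvent T hn z +
        rightAction n E hn (starRingEnd ℂ w) * sliceResolvent T hn (starRingEnd ℂ z) := by
  rw [hz.comm, hz.conj.comm, leftResolvent_slice hJ, leftResolvent_slice hJ, sliceResolvent,
    sliceResolvent, Complex.conj_re, Complex.norm_conj, Complex.conj_conj]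
  set R := quadInverse T z.re (‖z‖ ^ 2)
  set P := opQuadInverse T z.re (‖z‖ ^ 2)
  ext1 v
  -- After summing over the conjugate pair only `z̄ w` plus its conjugate and `w` plus its conjugate
  -- act on `v`. These are real scalars, the same for left multiplication in `ℂ_J` and for the right
  -- action.
  have e1 : lmul (slice J (starRingEnd ℂ z)) (lmul (slice J w) v) +
      lmul (slice J z) (lmul (slice J (starRingEnd ℂ w)) v) =
        (2 * (starRingEnd ℂ z * w).re) • v := by
    rw [← lmul_slice_trace (starRingEnd ℂ z * w) v, map_mul, Complex.conj_conj, slice_mul hJ,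
      slice_mul hJ, lmul_mul, lmul_mul]
  have e2 : rightAction n E hn (starRingEnd ℂ z) (rightAction n E hn w v) +
      rightAction n E hn z (rightAction n E hn (starRingEnd ℂ w) v) =
        (2 * (starRingEnd ℂ z * w).re) • v := by
    rw [rightAction_mul_apply, rightAction_mul_apply,
      ← rightAction_trace (hn := hn) (starRingEnd ℂ z * w) v, map_mul (starRingEnd ℂ), Complex.conj_conj]
  have e3 := lmul_slice_trace (J := J) w v
  have e4 := rightAction_trace (hn := hn) w v
  have d1 : R (lmul (slice J (starRingEnd ℂ z)) (lmul (slice J w) v)) +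
      R (lmul (slice J z) (lmul (slice J (starRingEnd ℂ w)) v)) -
        (P (lmul (slice J w) v) + P (lmul (slice J (starRingEnd ℂ w)) v)) =
      R ((2 * (starRingEnd ℂ z * w).re) • v) - P ((2 * w.re) • v) := by
    rw [← map_add, ← map_add, e1, e3]
  have d2 : R (rightAction n E hn (starRingEnd ℂ z) (rightAction n E hn w v)) +
      R (rightAction n E hn z (rightAction n E hn (starRingEnd ℂ w) v)) -
        (P (rightAction n E hn w v) + P (rightAction n E hn (starRingEnd ℂ w) v)) =
      R ((2 * (starRingEnd ℂ z * w).re) • v) - P ((2 * w.re) • v) := by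
    rw [← map_add, ← map_add, e2, e4]
  change R (lmul (slice J (starRingEnd ℂ z)) (lmul (slice J w) v)) - P (lmul (slice J w) v) +
    (R (lmul (slice J z) (lmul (slice J (starRingEnd ℂ w)) v)) -
      P (lmul (slice J (starRingEnd ℂ w)) v)) =
    R (rightAction n E hn (starRingEnd ℂ z) (rightAction n E hn w v)) -
      P (rightAction n E hn w v) +
    (R (rightAction n E hn z (rightAction n E hn (starRingEnd ℂ w) v)) -
      P (rightAction n E hn (starRingEnd ℂ w) v))
  rw [sub_add_sub_comm, sub_add_sub_comm, d1, d2]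

variable {ω φ θ : ℝ}

/-- Continuity is known for the right-action resolvent; `Q⁻¹` and `T Q⁻¹` are expressed through its
values at `z` and `z̄`, which is possible because `cosector ω` avoids the real axis. -/
theorem IsBisectorial.continuousOn_leftResolvent (hT : IsBisectorial T ω)
    (hω : ω ∈ Ioo 0 (Real.pi / 2)) (hn : 1 ≤ n) (hJ : J ∈ imagSphere n) :
    ContinuousOn (fun z => leftResolvent T (slice J z)) (cosector ω) := by
  have hρ := (hT.sectorialResolvent hω hn).continuousOn hω
  have him : ∀ z ∈ cosector ω, z.im ≠ 0 := fun z hz => by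
    have h1 := sin_mul_norm_le hω hz
    have hs : 0 < Real.sin ω :=
      Real.sin_pos_of_pos_of_lt_pi hω.1 (by linarith [hω.2, Real.pi_pos])
    have := norm_pos_iff.2 (ne_zero_of_mem_cosector hz)
    exact abs_pos.1 (lt_of_lt_of_le (by positivity) h1)
  have hρ' : ContinuousOn (fun z => sliceResolvent T hn (starRingEnd ℂ z)) (cosector ω) :=
    hρ.comp (by fun_prop) fun z hz => conj_mem_cosector hz
  have hR : ContinuousOn (fun z : ℂ => quadInverse T z.re (‖z‖ ^ 2)) (cosector ω) := by
    refine ContinuousOn.congr (f := fun z : ℂ => (2 * z.im)⁻¹ •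
      ((sliceResolvent T hn z - sliceResolvent T hn (starRingEnd ℂ z)) *
        rightAction n E hn Complex.I)) ?_ fun z hz => IsRegular.quadInverse_eq (him z hz)
    refine ContinuousOn.smul (ContinuousOn.inv₀ (by fun_prop) fun z hz =>
      mul_ne_zero two_ne_zero (him z hz)) ((hρ.sub hρ').mul continuousOn_const)
  have hM := continuous_algHom_complex (rightAction n E hn)
  have hP : ContinuousOn (fun z : ℂ => opQuadInverse T z.re (‖z‖ ^ 2)) (cosector ω) := by
    refine ContinuousOn.congr (f := fun z : ℂ => quadInverse T z.re (‖z‖ ^ 2) *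
      rightAction n E hn (starRingEnd ℂ z) - sliceResolvent T hn z) ?_
      fun z _ => IsRegular.opQuadInverse_eq'
    exact (hR.mul (hM.comp Complex.continuous_conj).continuousOn).sub hρ
  refine ContinuousOn.congr ((hR.mul (f := fun z : ℂ => quadInverse T z.re (‖z‖ ^ 2))
    (g := fun z => lmul (slice J (starRingEnd ℂ z))) ?_).sub hP)
    fun z _ => leftResolvent_slice hJ z
  exact (continuous_lmul.comp ((continuous_slice J).comp Complex.continuous_conj)).continuousOn

theorem IsBisectorial.integrableOn_leftResolvent (hT : IsBisectorial T ω) (hω : 0 < ω)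
    (hθ : θ < Real.pi / 2) (hn : 1 ≤ n) (hφ : φ ∈ Ioo ω θ) (hJ : J ∈ imagSphere n) {F : ℂ → ℂ}
    (hF : HolDecay θ F) (c : ℂ) (k : Fin 4) :
    IntegrableOn (fun t : ℝ => leftResolvent T (slice J (t * contourDir φ k)) *
      lmul (slice J (c * F (t * contourDir φ k)))) (Ioi 0) := by
  obtain ⟨K, hK0, hK⟩ := exists_norm_lmul_le n E
  have hlt := hφ.2.trans hθ
  have hω' : ω ∈ Ioo 0 (Real.pi / 2) := ⟨hω, hφ.1.trans hlt⟩
  obtain ⟨C, hC0, hC⟩ := hT.exists_norm_leftResolvent_le (ψ := (ω + φ) / 2) hω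
    ⟨by linarith [hφ.1], by linarith [hφ.1]⟩
  have hang := contourAngle_mem_angles (hω.trans hφ.1) hφ.2 k
  refine Integrable.mono' ((hF.integrable _ hang).const_mul (C * (K * ‖c‖))) ?_ ?_
  · refine ContinuousOn.aestronglyMeasurable ?_ measurableSet_Ioi
    refine ContinuousOn.mul ?_ ?_
    · exact (hT.continuousOn_leftResolvent hω' hn hJ).comp (by fun_prop)
        fun t ht => contour_mem_cosector hω hφ.1 hlt ht k
    · refine continuous_lmul.comp_continuousOn ((continuous_slice J).comp_continuousOn
        (continuousOn_const.mul ?_))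
      exact HolDecay.continuousOn_ray hF.differentiableOn ⟨hω.trans (hφ.1.trans hφ.2), hθ⟩ hang
  · refine (ae_restrict_iff' measurableSet_Ioi).2 (Filter.Eventually.of_forall fun t ht => ?_)
    have ht0 : 0 < t := ht
    have h1 := hC J hJ (t * contourDir φ k)
      (contour_mem_cosector (by linarith [hφ.1]) (by linarith [hφ.1]) hlt ht k)
    have h2 := hK (slice J (c * F (t * contourDir φ k)))
    rw [norm_slice hJ, norm_mul] at h2
    rw [norm_mul, norm_contourDir, mul_one, Complex.norm_real, Real.norm_of_nonneg ht0.le] at h1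
    refine (norm_mul_le _ _).trans ((mul_le_mul h1 h2 (norm_nonneg _) (by positivity)).trans ?_)
    refine le_of_eq ?_
    simp only [contourDir]
    ring

/-- The contribution of one component of `f` to the `ω`-functional calculus. -/
theorem IsBisectorial.sum_integral_leftResolvent (hT : IsBisectorial T ω) (hω : 0 < ω)
    (hθ : θ < Real.pi / 2) (hn : 1 ≤ n) (hφ : φ ∈ Ioo ω θ) (hJ : J ∈ imagSphere n) {F : ℂ → ℂ}
    (hF : HolDecay θ F) (hconj : ∀ z ∈ sector θ, F (starRingEnd ℂ z) = starRingEnd ℂ (F z)) :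
    ∑ k, ∫ t in Ioi (0 : ℝ), leftResolvent T (slice J (t * contourDir φ k)) *
        lmul (slice J (contourSign k * contourDir φ k * -Complex.I * F (t * contourDir φ k))) =
      (2 * Real.pi) • contourCalculus (rightAction n E hn) (sliceResolvent T hn) φ F := by
  have hlt := hφ.2.trans hθ
  have hω' : ω ∈ Ioo 0 (Real.pi / 2) := ⟨hω, hφ.1.trans hlt⟩
  have hρ := hT.sectorialResolvent hω' hn
  have hi := fun k => hT.integrableOn_leftResolvent hω hθ hn hφ hJ hF
    (contourSign k * contourDir φ k * -Complex.I) k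
  have hi' := fun k => hρ.integrableOn hω hθ hφ hF
    (contourSign k * contourDir φ k * -Complex.I) k
  -- Rays `0, 1` and rays `2, 3` are conjugate pairs. The opposite orientations compensate the sign
  -- in the conjugate of `-i`, so the weights on the two rays are conjugate as well.
  have hpair : ∀ k l, contourDir φ l = starRingEnd ℂ (contourDir φ k) →
      contourSign l = -contourSign k → starRingEnd ℂ (contourSign k) = contourSign k →
      (∫ t in Ioi (0 : ℝ), leftResolvent T (slice J (t * contourDir φ k)) *
        lmul (slice J (contourSign k * contourDir φ k * -Complex.I * F (t * contourDir φ k)))) +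
      (∫ t in Ioi (0 : ℝ), leftResolvent T (slice J (t * contourDir φ l)) *
        lmul (slice J (contourSign l * contourDir φ l * -Complex.I * F (t * contourDir φ l)))) =
      (∫ t in Ioi (0 : ℝ), rightAction n E hn
        (contourSign k * contourDir φ k * -Complex.I * F (t * contourDir φ k)) *
          sliceResolvent T hn (t * contourDir φ k)) +
      (∫ t in Ioi (0 : ℝ), rightAction n E hn
        (contourSign l * contourDir φ l * -Complex.I * F (t * contourDir φ l)) *
          sliceResolvent T hn (t * contourDir φ l)) := by
    intro k l hkl hs hs'
    rw [← integral_add (hi k) (hi l), ← integral_add (hi' k) (hi' l)]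
    refine setIntegral_congr_fun measurableSet_Ioi fun t ht => ?_
    have hz := hT.isRegular hω' hn (contour_mem_cosector hω hφ.1 hlt ht k)
    have h1 : (t : ℂ) * contourDir φ l = starRingEnd ℂ (t * contourDir φ k) := by
      rw [hkl, map_mul, Complex.conj_ofReal]
    have h2 : contourSign l * contourDir φ l * -Complex.I * F (t * contourDir φ l) =
        starRingEnd ℂ (contourSign k * contourDir φ k * -Complex.I * F (t * contourDir φ k)) := by
      rw [h1, hconj _ (contour_mem_sector (hω.trans hφ.1) hφ.2 hθ ht k), hkl, hs]
      simp only [map_mul, map_neg, hs', Complex.conj_I]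
      ring
    have h3 := leftResolvent_add_conj hn hJ hz
      (contourSign k * contourDir φ k * -Complex.I * F (t * contourDir φ k))
    rwa [← h1, ← h2] at h3
  have h01 := hpair 0 1 (contourDir_one φ) (by simp [contourSign]) (by simp [contourSign])
  have h23 := hpair 2 3 (contourDir_three φ) (by simp [contourSign]) (by simp [contourSign])
  -- Here `2π (2πi)⁻¹ = -i` matches the factor `-J` coming from `ds_J = ds / J`.
  have hcal : (2 * Real.pi) • contourCalculus (rightAction n E hn) (sliceResolvent T hn) φ F =
      ∑ k, ∫ t in Ioi (0 : ℝ), rightAction n E hn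
        (contourSign k * contourDir φ k * -Complex.I * F (t * contourDir φ k)) *
          sliceResolvent T hn (t * contourDir φ k) := by
    rw [contourCalculus, Finset.smul_sum]
    refine Finset.sum_congr rfl fun k _ => ?_
    rw [← integral_smul]
    refine integral_congr_ae (Filter.Eventually.of_forall fun t => ?_)
    simp only
    rw [← op_smul_mul, ← map_smul, Complex.real_smul]
    congr 2
    have : (Real.pi : ℂ) ≠ 0 := by exact_mod_cast Real.pi_ne_zero
    rw [mul_inv, Complex.inv_I]
    push_cast
    field_simp
  rw [hcal, Fin.sum_univ_four, Fin.sum_univ_four, add_assoc, h01, h23, ← add_assoc]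

/-- The factors `e_A` stand to the right of everything depending on the path, so each component is
integrated separately. Nothing on the right-hand side involves `J`. -/
theorem IsBisectorial.omegaCalculus_eq (hT : IsBisectorial T ω) (hω : 0 < ω)
    (hθ : θ < Real.pi / 2) (hn : 1 ≤ n) (hφ : φ ∈ Ioo ω θ) (hJ : J ∈ imagSphere n)
    {f : Cliff n → Cliff n} {F : Finset (Fin n) → ℂ → ℂ} (hF : HasComponents θ f F) :
    omegaCalculus T J φ f =
      ∑ A, contourCalculus (rightAction n E hn) (sliceResolvent T hn) φ (F A) *
        lmul (basisVec A) := by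
  set U : Fin 4 → Finset (Fin n) → ℝ → (CliffMod n E →L[ℝ] CliffMod n E) := fun k A t =>
    leftResolvent T (slice J (t * contourDir φ k)) *
      lmul (slice J (contourSign k * contourDir φ k * -Complex.I * F A (t * contourDir φ k)))
  have hU : ∀ k A, IntegrableOn (U k A) (Ioi 0) := fun k A =>
    hT.integrableOn_leftResolvent hω hθ hn hφ hJ (hF.decay A) _ k
  let Rm : Finset (Fin n) → (CliffMod n E →L[ℝ] CliffMod n E) →L[ℝ]
      (CliffMod n E →L[ℝ] CliffMod n E) := fun A =>
    (ContinuousLinearMap.compL ℝ (CliffMod n E) (CliffMod n E) (CliffMod n E)).flip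
      (lmul (basisVec A))
  have hRm : ∀ A B, Rm A B = B * lmul (basisVec A) := fun A B => rfl
  have heq : ∀ k, EqOn (fun t : ℝ => leftResolvent T (slice J (t * contourDir φ k)) ∘L
      lmul (slice J (contourSign k * contourDir φ k * -Complex.I) *
        f (slice J (t * contourDir φ k)))) (fun t => ∑ A, Rm A (U k A t)) (Ioi 0) := by
    intro k t ht
    simp only [hRm, U]
    rw [hF.repr J hJ _ (contour_mem_sector (hω.trans hφ.1) hφ.2 hθ ht k), Finset.mul_sum,
      ← lmulLin_apply, map_sum]
    ext1 v
    simp only [ContinuousLinearMap.comp_apply, _root_.sum_apply, map_sum,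
      lmulLin_apply]
    refine Finset.sum_congr rfl fun A _ => ?_
    rw [← mul_assoc, ← slice_mul hJ, lmul_mul]
    rfl
  have hint : ∀ k, IntegrableOn (fun t : ℝ => leftResolvent T (slice J (t * contourDir φ k)) ∘L
      lmul (slice J (contourSign k * contourDir φ k * -Complex.I) *
        f (slice J (t * contourDir φ k)))) (Ioi 0) := fun k =>
    IntegrableOn.congr_fun (integrable_finsetSum _ fun A _ => (Rm A).integrable_comp (hU k A))
      (heq k).symm measurableSet_Ioi
  have hval : ∀ k, (∫ t in Ioi (0 : ℝ), leftResolvent T (slice J (t * contourDir φ k)) ∘L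
      lmul (slice J (contourSign k * contourDir φ k * -Complex.I) *
        f (slice J (t * contourDir φ k)))) = ∑ A, Rm A (∫ t in Ioi (0 : ℝ), U k A t) := by
    intro k
    rw [setIntegral_congr_fun measurableSet_Ioi (heq k),
      integral_finsetSum _ fun A _ => (Rm A).integrable_comp (hU k A)]
    exact Finset.sum_congr rfl fun A _ => (Rm A).integral_comp_comm (hU k A)
  have s0 : (contourSign 0 : ℂ) = 1 := rfl
  have s1 : (contourSign 1 : ℂ) = -1 := rfl
  have s2 : (contourSign 2 : ℂ) = 1 := rfl
  have s3 : (contourSign 3 : ℂ) = -1 := rfl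
  have p1 := pathIntegral_eq_add (S := leftResolvent T) (f := f) (d := contourDir φ 0)
    (d' := contourDir φ 1) hJ (fun t => boundaryCurve_of_pos φ)
    (fun t => boundaryCurve_neg_of_pos φ) (by simpa only [s0, one_mul] using hint 0)
    (by simpa only [s1, neg_one_mul] using hint 1)
  have p2 := pathIntegral_eq_add (S := leftResolvent T) (f := f) (d := contourDir φ 2)
    (d' := contourDir φ 3) (γ := fun t => -boundaryCurve J φ t) hJ
    (fun t => neg_boundaryCurve_of_pos φ)
    (fun t => neg_boundaryCurve_neg_of_pos φ) (by simpa only [s2, one_mul] using hint 2)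
    (by simpa only [s3, neg_one_mul] using hint 3)
  have v0 := hval 0
  have v1 := hval 1
  have v2 := hval 2
  have v3 := hval 3
  rw [s0, one_mul] at v0
  rw [s1, neg_one_mul] at v1
  rw [s2, one_mul] at v2
  rw [s3, neg_one_mul] at v3
  rw [omegaCalculus, p1, p2, v0, v1, v2, v3, ← add_assoc, ← Finset.sum_add_distrib,
    ← Finset.sum_add_distrib, ← Finset.sum_add_distrib, Finset.smul_sum]
  refine Finset.sum_congr rfl fun A _ => ?_
  have hs := hT.sum_integral_leftResolvent hω hθ hn hφ hJ (hF.decay A) (hF.map_conj A)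
  rw [Fin.sum_univ_four] at hs
  have hpi : (1 / (2 * Real.pi)) * (2 * Real.pi) = 1 := by field_simp
  rw [← map_add, ← map_add, ← map_add, hs, map_smul, smul_smul, hpi, one_smul, hRm]

end

end BisectorialCalculus

end

noncomputable section

namespace BisectorialCalculus

/-! ### The extended functional calculus -/

section Algebra

theorem mul_sum_mul {𝒜 : Type*} [Ring 𝒜] {ι : Type*} [Fintype ι] (X : 𝒜) (Y e : ι → 𝒜) :
    X * ∑ i, Y i * e i = ∑ i, X * Y i * e i := by
  simp only [Finset.mul_sum, mul_assoc]

theorem zero_smul_add_mul {𝒜 : Type*} [Ring 𝒜] [Algebra ℝ 𝒜] (X Y : 𝒜) :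
    ((0 : ℝ) • 1 + (0 : ℝ) • X + 0) * Y = 0 := by
  simp

theorem sum_smul_add_mul {𝒜 : Type*} [Ring 𝒜] [Algebra ℝ 𝒜] {ι : Type*} [Fintype ι] (X : 𝒜)
    (p b : ι → ℝ) (Y e : ι → 𝒜) :
    ∑ i, p i • e i + X * (∑ i, b i • e i) + ∑ i, Y i * e i =
      ∑ i, (p i • 1 + b i • X + Y i) * e i := by
  simp only [Finset.mul_sum, add_mul, Finset.sum_add_distrib, smul_mul_assoc, one_mul,
    mul_smul_comm]

variable {𝒜 : Type*} [NormedRing 𝒜] [NormedAlgebra ℝ 𝒜] [CompleteSpace 𝒜] {M : ℂ →ₐ[ℝ] 𝒜}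
  {ρ : ℂ → 𝒜} {ω φ θ : ℝ} {F G : ℂ → ℂ}

/-- The part in `HolDecay` of the product of `p + (1 + z²)⁻¹ a + G` and `q + (1 + z²)⁻¹ b + F`. -/
def mulTilde (p a q b : ℝ) (G F : ℂ → ℂ) (z : ℂ) : ℂ :=
  (a * b : ℝ) * (((1 + z ^ 2)⁻¹) ^ 2 - (1 + z ^ 2)⁻¹) + p * F z + a * ((1 + z ^ 2)⁻¹ * F z) +
    q * G z + b * ((1 + z ^ 2)⁻¹ * G z) + G z * F z

/-- Multiplicativity of the extended calculus for scalar functions. -/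
theorem SectorialResolvent.mulTilde_spec (h : SectorialResolvent ω M ρ) (hω : 0 < ω)
    (hθ : θ < Real.pi / 2) (hφ : φ ∈ Ioo ω θ) (hG : HolDecay θ G) (hF : HolDecay θ F)
    (p a q b : ℝ) :
    HolDecay θ (mulTilde p a q b G F) ∧
    (p * q) • (1 : 𝒜) + (p * b + a * q + a * b) • (ρ Complex.I * ρ (-Complex.I)) +
        contourCalculus M ρ φ (mulTilde p a q b G F) =
      (p • (1 : 𝒜) + a • (ρ Complex.I * ρ (-Complex.I)) + contourCalculus M ρ φ G) *
        (q • (1 : 𝒜) + b • (ρ Complex.I * ρ (-Complex.I)) + contourCalculus M ρ φ F) := by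
  have hθ' : θ ∈ Ioo 0 (Real.pi / 2) := ⟨hω.trans (hφ.1.trans hφ.2), hθ⟩
  obtain ⟨d0, c0⟩ := h.contourCalculus_inv_one_add_sq_sq_sub hω hθ hφ
  have hd := differentiableOn_inv_one_add_sq hθ'
  have hb := exists_norm_inv_one_add_sq_le hθ'
  have dF := hF.mul_bounded hθ' hd hb
  have dG := hG.mul_bounded hθ' hd hb
  have dGF := hF.mul_bounded hθ' hG.differentiableOn hG.bounded
  have e0 := d0.const_mul hθ' ((a * b : ℝ) : ℂ)
  have e1 := hF.const_mul hθ' (p : ℂ)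
  have e2 := dF.const_mul hθ' (a : ℂ)
  have e3 := hG.const_mul hθ' (q : ℂ)
  have e4 := dG.const_mul hθ' (b : ℂ)
  have s1 := e0.add e1 hθ'
  have s2 := s1.add e2 hθ'
  have s3 := s2.add e3 hθ'
  have s4 := s3.add e4 hθ'
  refine ⟨s4.add dGF hθ', ?_⟩
  unfold mulTilde
  -- The term `u F` is written with `ρ(i) ρ(-i)` on the left and `u G` with it on the right,
  -- matching the order in the expanded product. The term `a b u²` is split into `a b u` and the
  -- decaying `a b (u² - u)`.
  rw [h.contourCalculus_add hω hθ hφ s4 dGF, h.contourCalculus_add hω hθ hφ s3 e4,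
    h.contourCalculus_add hω hθ hφ s2 e3, h.contourCalculus_add hω hθ hφ s1 e2,
    h.contourCalculus_add hω hθ hφ e0 e1, contourCalculus_const_mul, contourCalculus_const_mul,
    contourCalculus_const_mul, contourCalculus_const_mul, contourCalculus_const_mul, c0,
    (h.contourCalculus_inv_one_add_sq_mul hω hθ hφ hF).1,
    (h.contourCalculus_inv_one_add_sq_mul hω hθ hφ hG).2,
    h.contourCalculus_mul hω hθ hφ hF hG]
  simp only [add_mul, mul_add, smul_mul_assoc, mul_smul_comm, one_mul, mul_one, smul_add]
  module

end Algebra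

section

variable {n : ℕ} {θ : ℝ}

theorem inverse_one_add_sq_slice (hθ : θ ∈ Ioo 0 (Real.pi / 2)) {J : Cliff n}
    (hJ : J ∈ imagSphere n) {z : ℂ} (hz : z ∈ sector θ) :
    Ring.inverse (1 + slice J z ^ 2) = slice J ((1 + z ^ 2)⁻¹) := by
  have h0 := one_add_sq_ne_zero hθ hz
  have h1 : 1 + slice J z ^ 2 = slice J (1 + z ^ 2) := by
    rw [slice_add, slice_one, pow_two, pow_two, slice_mul hJ]
  let u : (Cliff n)ˣ := ⟨slice J (1 + z ^ 2), slice J ((1 + z ^ 2)⁻¹),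
    by rw [← slice_mul hJ, mul_inv_cancel₀ h0, slice_one],
    by rw [← slice_mul hJ, inv_mul_cancel₀ h0, slice_one]⟩
  rw [h1]
  exact Ring.inverse_unit u

/-! ### Uniqueness of the coefficients. -/

theorem eq_zero_of_integrableOn_Ioi_div {a : ℝ} {C : ℝ}
    (h : IntegrableOn (fun t : ℝ => C / t) (Ioi a)) : C = 0 := by
  by_contra hC
  refine not_integrableOn_Ioi_inv (a := a) ?_
  refine IntegrableOn.congr_fun (h.const_mul C⁻¹) (fun t _ => ?_) measurableSet_Ioi
  field_simp

theorem eq_zero_of_integrableOn_Ioc_div {C : ℝ}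
    (h : IntegrableOn (fun t : ℝ => C / t) (Ioc 0 1)) : C = 0 := by
  by_contra hC
  have h1 : IntervalIntegrable (fun t : ℝ => t⁻¹) volume 0 1 := by
    rw [intervalIntegrable_iff_integrableOn_Ioc_of_le zero_le_one]
    refine IntegrableOn.congr_fun (h.const_mul C⁻¹) (fun t _ => ?_) measurableSet_Ioc
    field_simp
  rw [intervalIntegrable_inv_iff] at h1
  simp at h1

/-- A function `c + (1 + t²)⁻¹ (d - c)` that is integrable with respect to `dt / t` vanishes. -/
theorem eq_zero_of_integrableOn_div {X : Type*} [NormedAddCommGroup X] [NormedSpace ℝ X] {c d : X}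
    (h : IntegrableOn (fun t : ℝ => ‖c + (1 + t ^ 2)⁻¹ • (d - c)‖ / t) (Ioi 0)) :
    c = 0 ∧ d = 0 := by
  -- Near `∞` the function tends to `c` and `(1 + t²)⁻¹ ‖d - c‖` is integrable, so integrability
  -- would pass to `‖c‖ / t`.
  have hc : c = 0 := by
    rw [← norm_eq_zero]
    refine eq_zero_of_integrableOn_Ioi_div (a := 1) ?_
    refine Integrable.mono' ((h.mono_set (Ioi_subset_Ioi zero_le_one)).add
      (integrable_inv_one_add_sq.integrableOn.const_mul ‖d - c‖)) (by fun_prop) ?_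
    refine (ae_restrict_iff' measurableSet_Ioi).2 (Filter.Eventually.of_forall fun t ht => ?_)
    have ht1 : 1 < t := ht
    have ht0 : 0 < t := by linarith
    have h1 : ‖c‖ ≤ ‖c + (1 + t ^ 2)⁻¹ • (d - c)‖ + (1 + t ^ 2)⁻¹ * ‖d - c‖ := by
      have := norm_sub_le (c + (1 + t ^ 2)⁻¹ • (d - c)) ((1 + t ^ 2)⁻¹ • (d - c))
      rwa [add_sub_cancel_right, norm_smul, Real.norm_of_nonneg (by positivity)] at this
    have h2 : (1 + t ^ 2)⁻¹ * ‖d - c‖ / t ≤ ‖d - c‖ * (1 + t ^ 2)⁻¹ := by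
      rw [mul_comm]
      exact div_le_self (by positivity) ht1.le
    rw [Real.norm_of_nonneg (by positivity), Pi.add_apply]
    refine (div_le_div_of_nonneg_right h1 ht0.le).trans ?_
    rw [add_div]
    gcongr
  refine ⟨hc, ?_⟩
  -- Once `c = 0`, on `(0, 1]` the function has norm at least `‖d‖ / 2`, and `1 / t` is not
  -- integrable at `0`.
  subst hc
  rw [← norm_eq_zero]
  refine eq_zero_of_integrableOn_Ioc_div ?_
  refine Integrable.mono' ((h.mono_set Ioc_subset_Ioi_self).const_mul 2)
    (Measurable.aestronglyMeasurable (by fun_prop)) ?_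
  refine (ae_restrict_iff' measurableSet_Ioc).2 (Filter.Eventually.of_forall fun t ht => ?_)
  have ht0 : 0 < t := ht.1
  have h1 : 2⁻¹ ≤ (1 + t ^ 2)⁻¹ := inv_anti₀ (by positivity) (by nlinarith [ht.1, ht.2])
  rw [Real.norm_of_nonneg (by positivity), zero_add, sub_zero, norm_smul,
    Real.norm_of_nonneg (by positivity), ← mul_div_assoc]
  refine div_le_div_of_nonneg_right ?_ ht0.le
  nlinarith [norm_nonneg d]

/-- The coefficients of a decomposition are unique. -/
theorem HasDecomposition.unique (hn : 1 ≤ n) (hθ : θ ∈ Ioo 0 (Real.pi / 2))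
    {f : Cliff n → Cliff n} {a₀ a₁ b₀ b₁ : Cliff n} {h k : Cliff n → Cliff n}
    (hf : HasDecomposition θ f a₀ a₁ h) (hf' : HasDecomposition θ f b₀ b₁ k)
    (hh : HasDecay θ h) (hk : HasDecay θ k) :
    a₀ = b₀ ∧ a₁ = b₁ ∧ EqOn h k (doubleSector n θ) := by
  obtain ⟨J, hJ⟩ := imagSphere_nonempty hn
  have h0 : (0 : ℝ) ∈ angles θ := Or.inl ⟨by linarith [hθ.1], hθ.1⟩
  -- The two decompositions are compared on the positive real axis, where `(1 + s²)⁻¹` is a real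
  -- scalar.
  have hval : ∀ t : ℝ, 0 < t → (a₁ - b₁) + (1 + t ^ 2)⁻¹ • ((a₀ - b₀) - (a₁ - b₁)) =
      k (t • sliceExp J 0) - h (t • sliceExp J 0) := by
    intro t ht
    have hz : ((t : ℝ) : ℂ) * Complex.exp ((0 : ℝ) * Complex.I) ∈ sector θ :=
      polar_mem_sector hθ h0 ht
    have hs := slice_mem_doubleSector hθ hJ hz
    have e1 := hf _ hs
    have e2 := hf' _ hs
    have e3 := inverse_one_add_sq_slice hθ hJ hz
    have e4 : slice J ((1 + ((t : ℝ) * Complex.exp ((0 : ℝ) * Complex.I)) ^ 2)⁻¹) =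
        (1 + t ^ 2)⁻¹ • (1 : Cliff n) := by
      rw [← slice_ofReal J]
      simp
    rw [e3, e4, smul_mul_assoc, one_mul, slice_exp] at e1 e2
    have e5 := e1.symm.trans e2
    have e6 : k (t • sliceExp J 0) - h (t • sliceExp J 0) =
        (a₁ + (1 + t ^ 2)⁻¹ • (a₀ - a₁)) - (b₁ + (1 + t ^ 2)⁻¹ • (b₀ - b₁)) := by
      rw [sub_eq_sub_iff_add_eq_add, add_comm (k _), ← e5]
    rw [e6]
    module
  have hint : IntegrableOn (fun t : ℝ =>
      ‖(a₁ - b₁) + (1 + t ^ 2)⁻¹ • ((a₀ - b₀) - (a₁ - b₁))‖ / t) (Ioi 0) := by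
    refine Integrable.mono' ((hk.2 J hJ 0 h0).add (hh.2 J hJ 0 h0))
      (Measurable.aestronglyMeasurable (by fun_prop)) ?_
    refine (ae_restrict_iff' measurableSet_Ioi).2 (Filter.Eventually.of_forall fun t ht => ?_)
    have ht0 : 0 < t := ht
    rw [Real.norm_of_nonneg (by positivity), hval t ht, Pi.add_apply, ← add_div]
    exact div_le_div_of_nonneg_right (norm_sub_le _ _) ht0.le
  obtain ⟨h1, h2⟩ := eq_zero_of_integrableOn_div hint
  have h1' := sub_eq_zero.1 h1
  have h2' := sub_eq_zero.1 h2
  refine ⟨h2', h1', fun s hs => ?_⟩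
  have := (hf s hs).symm.trans (hf' s hs)
  rw [h1', h2'] at this
  exact add_left_cancel this

/-! ### The extended calculus in components, and its multiplicativity. -/

variable {E : Type*} [NormedAddCommGroup E] [NormedSpace ℝ E] [CompleteSpace E]
  {T : ClosedOperator n E} {ω φ : ℝ} {J : Cliff n}

/-- The difference `ρ(i) - ρ(-i)` equals `-2 X i` both for `X = (1 + T²)⁻¹` and, by the resolvent
identity, for `X = ρ(i) ρ(-i)`; the action of `i` is invertible. -/
theorem IsBisectorial.quadInverse_zero_one (hT : IsBisectorial T ω)
    (hω : ω ∈ Ioo 0 (Real.pi / 2)) (hn : 1 ≤ n) : quadInverse T 0 1 =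
      sliceResolvent T hn Complex.I * sliceResolvent T hn (-Complex.I) := by
  have hρ := hT.sectorialResolvent hω hn
  have hII : rightAction n E hn Complex.I * rightAction n E hn Complex.I = -1 := by
    rw [← map_mul, Complex.I_mul_I, map_neg, map_one]
  have h1 : sliceResolvent T hn Complex.I - sliceResolvent T hn (-Complex.I) =
      (-2 * 1 : ℝ) • (quadInverse T 0 1 * rightAction n E hn Complex.I) := by
    simpa only [Complex.conj_I, Complex.I_im, Complex.I_re, Complex.norm_I, one_pow] using
      IsRegular.sliceResolvent_conj_sub (T := T) (hn := hn) (z := Complex.I)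
  have h2 : sliceResolvent T hn Complex.I - sliceResolvent T hn (-Complex.I) =
      (-2 * 1 : ℝ) • (sliceResolvent T hn Complex.I * sliceResolvent T hn (-Complex.I) *
        rightAction n E hn Complex.I) := by
    have h3 : -Complex.I - Complex.I = ((-2 * 1 : ℝ) : ℂ) * Complex.I := by push_cast; ring
    rw [hρ.sub_eq _ (I_mem_cosector hω) _ (neg_I_mem_cosector hω), h3, ← Complex.real_smul,
      map_smul, op_smul_mul, ← mul_assoc, hρ.comm _ (I_mem_cosector hω), mul_assoc,
      hρ.comm _ (neg_I_mem_cosector hω), mul_assoc]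
  rw [eq_smul_mul_of_sq_eq_neg_one one_ne_zero hII h1,
    eq_smul_mul_of_sq_eq_neg_one one_ne_zero hII h2]

theorem HasComponents.congr {f g : Cliff n → Cliff n} {F : Finset (Fin n) → ℂ → ℂ}
    (hθ : θ ∈ Ioo 0 (Real.pi / 2)) (h : HasComponents θ f F)
    (hfg : EqOn g f (doubleSector n θ)) : HasComponents θ g F where
  repr J hJ z hz := (hfg (slice_mem_doubleSector hθ hJ hz)).trans (h.repr J hJ z hz)
  map_conj := h.map_conj
  decay := h.decay

theorem extendedCalculus_spec {f : Cliff n → Cliff n} (h : MemSHbnd θ f) :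
    ∃ fzero finf ftilde, MemSH0 θ ftilde ∧ HasDecomposition θ f fzero finf ftilde ∧
      extendedCalculus T θ J φ f =
        lmul finf + quadInverse T 0 1 ∘L lmul (fzero - finf) + omegaCalculus T J φ ftilde := by
  rw [extendedCalculus, dif_pos h]
  exact ⟨_, _, _, h.choose_spec.choose_spec.choose_spec.1,
    h.choose_spec.choose_spec.choose_spec.2, rfl⟩

/-- Uniqueness replaces the selected coefficients by any given ones. The remainders agree only on
`D_θ`, which is enough because components see no other values. -/
theorem IsBisectorial.extendedCalculus_eq (hT : IsBisectorial T ω) (hω : 0 < ω)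
    (hθ : θ < Real.pi / 2) (hn : 1 ≤ n) (hφ : φ ∈ Ioo ω θ) (hJ : J ∈ imagSphere n)
    {f : Cliff n → Cliff n} {fzero finf : Cliff n} {ftilde : Cliff n → Cliff n}
    {F : Finset (Fin n) → ℂ → ℂ} (hf : HasDecomposition θ f fzero finf ftilde)
    (hF : HasComponents θ ftilde F) :
    extendedCalculus T θ J φ f = ∑ A, (finf A • 1 + (fzero - finf) A •
        (sliceResolvent T hn Complex.I * sliceResolvent T hn (-Complex.I)) +
          contourCalculus (rightAction n E hn) (sliceResolvent T hn) φ (F A)) *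
        lmul (basisVec A) := by
  have hθ' : θ ∈ Ioo 0 (Real.pi / 2) := ⟨hω.trans (hφ.1.trans hφ.2), hθ⟩
  have hω' : ω ∈ Ioo 0 (Real.pi / 2) := ⟨hω, hφ.1.trans (hφ.2.trans hθ)⟩
  obtain ⟨a₀, a₁, h, hh, hdec, heq⟩ := extendedCalculus_spec (T := T) (J := J) (φ := φ)
    ⟨fzero, finf, ftilde, hF.memSH0 hn hθ', hf⟩
  obtain ⟨rfl, rfl, h2⟩ := hdec.unique hn hθ' hf hh.2 (hF.memSH0 hn hθ').2
  rw [heq, hT.omegaCalculus_eq hω hθ hn hφ hJ (hF.congr hθ' h2), hT.quadInverse_zero_one hω' hn]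
  have hl : ∀ s : Cliff n, (lmul s : CliffMod n E →L[ℝ] CliffMod n E) =
      ∑ A, s A • lmul (basisVec A) := fun s => by
    conv_lhs => rw [← sum_smul_basisVec s, ← lmulLin_apply, map_sum]
    simp only [map_smul, lmulLin_apply]
  rw [hl a₁, hl (a₀ - a₁)]
  exact sum_smul_add_mul _ _ _ _ _

theorem add_slice_mul_eq_sum (J p b : Cliff n) (c : ℂ) :
    p + slice J c * b = ∑ A, slice J (p A + b A * c) * basisVec A := by
  have h1 : p + slice J c * b = ∑ A, p A • basisVec A +
      slice J c * ∑ A, b A • (basisVec A : Cliff n) := by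
    rw [sum_smul_basisVec, sum_smul_basisVec]
  rw [h1, Finset.mul_sum, ← Finset.sum_add_distrib]
  refine Finset.sum_congr rfl fun A _ => ?_
  rw [slice_add, slice_smul, slice_ofReal, add_mul, smul_mul_assoc, one_mul, smul_mul_assoc,
    mul_smul_comm]

theorem HasDecomposition.apply_slice {f : Cliff n → Cliff n} {fzero finf : Cliff n}
    {ftilde : Cliff n → Cliff n} {F : Finset (Fin n) → ℂ → ℂ} (hθ : θ ∈ Ioo 0 (Real.pi / 2))
    (hf : HasDecomposition θ f fzero finf ftilde) (hF : HasComponents θ ftilde F)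
    (hJ : J ∈ imagSphere n) {z : ℂ} (hz : z ∈ sector θ) :
    f (slice J z) = ∑ A, slice J (finf A + (fzero - finf) A * (1 + z ^ 2)⁻¹ + F A z) *
      basisVec A := by
  rw [hf _ (slice_mem_doubleSector hθ hJ hz), hF.repr J hJ z hz, inverse_one_add_sq_slice hθ hJ hz,
    add_slice_mul_eq_sum, ← Finset.sum_add_distrib]
  refine Finset.sum_congr rfl fun A _ => ?_
  rw [slice_add _ _ (F A z), add_mul]

/-- The decomposition of a product. -/
theorem HasDecomposition.mul {g f : Cliff n → Cliff n} {gzero ginf : ℝ} {fzero finf : Cliff n}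
    {gtilde ftilde : Cliff n → Cliff n} {G : ℂ → ℂ} {F : Finset (Fin n) → ℂ → ℂ}
    (hθ : θ ∈ Ioo 0 (Real.pi / 2))
    (hg : HasDecomposition θ g (gzero • (1 : Cliff n)) (ginf • (1 : Cliff n)) gtilde)
    (hf : HasDecomposition θ f fzero finf ftilde)
    (hG : ∀ J ∈ imagSphere n, ∀ z ∈ sector θ, gtilde (slice J z) = slice J (G z))
    (hGconj : ∀ z ∈ sector θ, G (starRingEnd ℂ z) = starRingEnd ℂ (G z))
    (hF : HasComponents θ ftilde F)
    (hd : ∀ A, HolDecay θ (mulTilde ginf (gzero - ginf) (finf A) ((fzero - finf) A) G (F A))) :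
    ∃ h, HasDecomposition θ (fun s => g s * f s) (gzero • fzero) (ginf • finf) h ∧
      HasComponents θ h
        (fun A => mulTilde ginf (gzero - ginf) (finf A) ((fzero - finf) A) G (F A)) := by
  -- The remainder is defined so that the decomposition is automatic; the content is that its
  -- components are `mulTilde`, by the multiplicativity of `slice J`.
  refine ⟨fun s => g s * f s - (ginf • finf +
    Ring.inverse (1 + s ^ 2) * (gzero • fzero - ginf • finf)), fun s _ => ?_, ?_, ?_, hd⟩
  · rw [add_sub_cancel]
  · intro J hJ z hz
    have h1 : g (slice J z) = slice J (ginf + (gzero - ginf : ℝ) * (1 + z ^ 2)⁻¹ + G z) := by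
      rw [hg _ (slice_mem_doubleSector hθ hJ hz), hG J hJ z hz, inverse_one_add_sq_slice hθ hJ hz,
        ← sub_smul, mul_smul_comm, mul_one, slice_add, slice_add, slice_smul, slice_ofReal]
    rw [h1, hf.apply_slice hθ hF hJ hz, inverse_one_add_sq_slice hθ hJ hz, add_slice_mul_eq_sum,
      Finset.mul_sum, ← Finset.sum_sub_distrib]
    refine Finset.sum_congr rfl fun A _ => ?_
    rw [← mul_assoc, ← slice_mul hJ, ← sub_mul, sub_eq_add_neg, ← slice_neg, ← slice_add]
    congr 2
    simp only [mulTilde, PiLp.sub_apply, PiLp.smul_apply, smul_eq_mul]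
    push_cast
    ring
  · intro A z hz
    simp only [mulTilde, hF.map_conj A z hz, hGconj z hz, map_add, map_sub, map_mul, map_pow,
      map_inv₀, map_one, Complex.conj_ofReal]

/-- For real coefficients and an intrinsic remainder only `A = ∅` contributes, so no basis vector is
left to separate this operator from the one on its right. -/
theorem IsBisectorial.extendedCalculus_intrinsic (hT : IsBisectorial T ω) (hω : 0 < ω)
    (hθ : θ < Real.pi / 2) (hn : 1 ≤ n) (hφ : φ ∈ Ioo ω θ) (hJ : J ∈ imagSphere n)
    {g : Cliff n → Cliff n} {gzero ginf : ℝ} {gtilde : Cliff n → Cliff n} {G : ℂ → ℂ}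
    (hg : HasDecomposition θ g (gzero • (1 : Cliff n)) (ginf • (1 : Cliff n)) gtilde)
    (hG : HasComponents θ gtilde (fun A => if A = ∅ then G else 0)) :
    extendedCalculus T θ J φ g = ginf • 1 + (gzero - ginf) •
        (sliceResolvent T hn Complex.I * sliceResolvent T hn (-Complex.I)) +
          contourCalculus (rightAction n E hn) (sliceResolvent T hn) φ G := by
  rw [hT.extendedCalculus_eq hω hθ hn hφ hJ hg hG, Finset.sum_eq_single ∅]
  · have h1 : (lmul (basisVec ∅) : CliffMod n E →L[ℝ] CliffMod n E) = 1 := lmul_one_eq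
    rw [if_pos rfl, h1, mul_one]
    simp [one_apply]
  · intro A _ hA
    have h0 : contourCalculus (rightAction n E hn) (sliceResolvent T hn) φ (0 : ℂ → ℂ) = 0 := by
      simp [contourCalculus]
    rw [if_neg hA, h0]
    simp only [PiLp.sub_apply, PiLp.smul_apply, smul_eq_mul, one_apply, if_neg hA, mul_zero,
      sub_zero]
    exact zero_smul_add_mul _ _
  · simp

theorem IsBisectorial.extendedCalculus_mul (hT : IsBisectorial T ω) (hω : 0 < ω)
    (hθ : θ < Real.pi / 2) (hωθ : ω < θ) (hn : 1 ≤ n) {g f : Cliff n → Cliff n}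
    (hg : MemNbnd θ g) (hf : MemSHbnd θ f) :
    MemSHbnd θ (fun s => g s * f s) ∧
      ∀ J₁ ∈ imagSphere n, ∀ J₂ ∈ imagSphere n, ∀ J₃ ∈ imagSphere n,
      ∀ φ₁ ∈ Ioo ω θ, ∀ φ₂ ∈ Ioo ω θ, ∀ φ₃ ∈ Ioo ω θ,
        extendedCalculus T θ J₁ φ₁ (fun s => g s * f s) =
          extendedCalculus T θ J₂ φ₂ g ∘L extendedCalculus T θ J₃ φ₃ f := by
  have hθ' : θ ∈ Ioo 0 (Real.pi / 2) := ⟨hω.trans hωθ, hθ⟩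
  have hω' : ω ∈ Ioo 0 (Real.pi / 2) := ⟨hω, hωθ.trans hθ⟩
  obtain ⟨gzero, ginf, gtilde, hgt, hgd⟩ := hg
  obtain ⟨fzero, finf, ftilde, hft, hfd⟩ := hf
  obtain ⟨G, hGc, hGd, hGconj, hGs⟩ := hgt.exists_component hn hθ'
  obtain ⟨F, hF⟩ := hft.exists_components hn hθ'
  have hρ := hT.sectorialResolvent hω' hn
  have hφ₀ : (ω + θ) / 2 ∈ Ioo ω θ := ⟨by linarith, by linarith⟩
  obtain ⟨h, hdec, hH⟩ := hgd.mul hθ' hfd hGs hGconj hF fun A =>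
    (hρ.mulTilde_spec hω hθ hφ₀ hGd (hF.decay A) _ _ _ _).1
  refine ⟨⟨_, _, h, hH.memSH0 hn hθ', hdec⟩, ?_⟩
  intro J₁ hJ₁ J₂ hJ₂ J₃ hJ₃ φ₁ hφ₁ φ₂ hφ₂ φ₃ hφ₃
  rw [hT.extendedCalculus_eq hω hθ hn hφ₁ hJ₁ hdec hH,
    hT.extendedCalculus_intrinsic hω hθ hn hφ₂ hJ₂ hgd hGc,
    hT.extendedCalculus_eq hω hθ hn hφ₃ hJ₃ hfd hF]
  refine Eq.trans (Finset.sum_congr rfl fun A _ => ?_) (mul_sum_mul _ _ _).symm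
  congr 1
  -- The units `J₁`, `J₂`, `J₃` have already disappeared; the three angles are brought to `φ₁`,
  -- where the scalar product formula applies to each component.
  rw [hρ.contourCalculus_eq hω hθ hφ₂ hφ₁ hGd, hρ.contourCalculus_eq hω hθ hφ₃ hφ₁ (hF.decay A),
    ← (hρ.mulTilde_spec hω hθ hφ₁ hGd (hF.decay A) ginf (gzero - ginf) (finf A)
      ((fzero - finf) A)).2]
  congr 3
  simp only [PiLp.sub_apply, PiLp.smul_apply, smul_eq_mul]
  ring

end

end BisectorialCalculus
end

open BisectorialCalculus in
theorem mainTheorem5 {n : ℕ} (hn : 1 ≤ n) {E : Type*} [NormedAddCommGroup E] [NormedSpace ℝ E]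
    [CompleteSpace E] (T : ClosedOperator n E) {ω θ : ℝ} (hω : ω ∈ Set.Ioo 0 (Real.pi / 2))
    (hT : IsBisectorial T ω) (hθ : θ ∈ Set.Ioo ω (Real.pi / 2)) {g f : Cliff n → Cliff n}
    (hg : MemNbnd θ g) (hf : MemSHbnd θ f) :
    MemSHbnd θ (fun s => g s * f s) ∧
      ∀ J₁ ∈ imagSphere n, ∀ J₂ ∈ imagSphere n, ∀ J₃ ∈ imagSphere n,
      ∀ φ₁ ∈ Set.Ioo ω θ, ∀ φ₂ ∈ Set.Ioo ω θ, ∀ φ₃ ∈ Set.Ioo ω θ,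
        extendedCalculus T θ J₁ φ₁ (fun s => g s * f s) =
          extendedCalculus T θ J₂ φ₂ g ∘L extendedCalculus T θ J₃ φ₃ f :=
  hT.extendedCalculus_mul hω.1 hθ.2 hθ.1 hn hg hf
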